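/- **Setting.** Let $\Omega=(0,1)^2$, $1\le p,q\le 2$, $\nu_1,\nu_2\ge 0$, $f\in L_2(\Omega)$, and let $m\ge1$, $J\ge 1$ be integers. Let $B_m$ be the B-spline of order $m$ (the $m$-fold convolution of $\chi_{[0,1]}$ with itself), translated by $-\lfloor m/2\rfloor$, and $\phi=B_m\otimes B_m$. For $0\le l\le m$ let $q_l$ be the finitely supported sequence with $\sum_k q_l[k]z^k=\sigma_l\,2^{-m}\sqrt{\tbinom ml}\;z^{-\lfloor m/2\rfloor}(1-z)^l(1+z)^{m-l}$, where $\sigma_0=1$ and $\sigma_l=(-1)^{l+1}$ for $l\ge1$. For a band $b=(b_1,b_2)\in\{0,\dots,m\}^2$ put $\mathbf q^{(b)}=q_{b_1}\otimes q_{b_2}$, $\psi_b=4\sum_{\mathbf k\in\mathbb Z^2}\mathbf q^{(b)}[\mathbf k]\phi(2\cdot-\mathbf k)$ (tensor-product B-spline framelets), let $\varphi_b$ be the compactly supported function with $\partial^b\varphi_b=\psi_b$, and $c_b=\int\varphi_b$. For bands $a,b$ let $\varphi_{ab}$ be the compactly supported function with $(\partial^a\varphi_{ab})(z)=4c_b^{-1}\sum_{\mathbf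 r}\mathbf q^{(a)}[\mathbf r]\varphi_b(2z-\mathbf r/2)$, and $c_{ab}=\int\varphi_{ab}$. Choose bands $\beta_1,\dots,\beta_J\in\{0,\dots,m\}^2\setminus\{(0,0)\}$; put $D_j=\partial^{\beta_j}$, $s_j=|\beta_j|$, $s=\max_j s_j$, $\mathbf D'u=(D_ju)_{j}$, $\mathbf D''v=(D_iv_j)_{i,j}$. For $n\in\mathbb N$ put $\phi_{n,\mathbf k}=2^n\phi(2^n\cdot-\mathbf k)$, $\varphi_{b,n-1,\mathbf k}=2^{n-2}\varphi_b(2^{n-1}\cdot-\mathbf k/2)$, $\mathbf M_n=\{\mathbf k\in\mathbb Z^2:\operatorname{supp}\phi_{n,\mathbf k}\subset\overline\Omega\}$, and, for a fixed integer $C\ge2$, let $\mathbf K_n$ be the set of $\mathbf k\in\mathbf M_n$ with $\mathbf k+C\operatorname{supp}\mathbf q^{(b)}\subset\mathbf M_n$ for $b\in\{(0,0),\beta_1,\dots,\beta_J\}$. Define $$(\mathbf T_nu)[\mathbf k]=2^n\int_\Omega u\,\phi_{n,\mathbf k},\qquad (\mathbf S_nv)[j;\mathbf k]=2^n\int_\Omega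 v_j\,c_{\beta_j}^{-1}\varphi_{\beta_j,n-1,\mathbf k},$$ $$(\mathbf W_n'\mathbf u)[j;\mathbf k]=c_{\beta_j}^{-1}(-1)^{s_j}2^{(n-1)s_j}\sum_{\mathbf l}\mathbf q^{(\beta_j)}[\mathbf l-\mathbf k]\mathbf u[\mathbf l],\qquad (\mathbf W_n''\mathbf v)[i,j;\mathbf k]=c_{\beta_i\beta_j}^{-1}(-1)^{s_i}2^{(n-2)s_i}\sum_{\mathbf l}\mathbf q^{(\beta_i)}[\mathbf l-\mathbf k]\mathbf v[j;\mathbf l],$$ and $\|\mathbf a\|_{\ell_r(\mathbf K_n;\ell_2)}=\bigl(2^{-2n}\sum_{\mathbf k\in\mathbf K_n}(\sum_i|\mathbf a_i[\mathbf k]|^2)^{r/2}\bigr)^{1/r}$. Let $A:L_2(\Omega)\to L_2(\Omega)$ and $\mathbf A_n:\mathbb R^{\mathbf K_n}\to\mathbb R^{\mathbf K_n}$ be linear with $\lim_{n}\|\mathbf T_nAu-\mathbf A_n\mathbf T_nu\|_{\ell_2(\mathbf K_n)}=0$ for all $u\in L_2(\Omega)$. On $W_{2s}^p(\Omega)\times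 W_s^q(\Omega;\mathbb R^J)$ define $$E_n(u,v)=\nu_1\|\mathbf W_n'\mathbf T_nu-\mathbf S_nv\|^p_{\ell_p(\mathbf K_n;\ell_2)}+\nu_2\|\mathbf W_n''\mathbf S_nv\|^q_{\ell_q(\mathbf K_n;\ell_2)}+\tfrac12\|\mathbf A_n\mathbf T_nu-\mathbf T_nf\|^2_{\ell_2(\mathbf K_n)},$$ $$E(u,v)=\nu_1\|\mathbf D'u-v\|^p_{L_p(\Omega;\ell_2)}+\nu_2\|\mathbf D''v\|^q_{L_q(\Omega;\ell_2)}+\tfrac12\|Au-f\|^2_{L_2(\Omega)}.$$ For $\epsilon\ge0$, a point $x^\star$ is an $\epsilon$-optimal solution of a functional $F$ if $F(x^\star)\le\inf F+\epsilon$; a $0$-optimal solution is called a minimizer. **Corollary 3.2.** Let $\epsilon>0$ and, for every $n$, let $(u_n^\star,v_n^\star)\in W_{2s}^p(\Omega)\times W_s^q(\Omega;\mathbb R^J)$ be an $\epsilon$-optimal solution of $E_n$. Then every cluster point $(u^\star,v^\star)$ of the sequence $(u_n^\star,v_n^\star)_n$ in $W_{2s}^p(\Omega)\times W_s^q(\Omega;\mathbb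 R^J)$ is an $\epsilon$-optimal solution of $E$. In particular, if $(u_n^\star,v_n^\star)$ is a minimizer of $E_n$ for every $n$, then every cluster point of the sequence is a minimizer of $E$. -/

import Mathlib

open MeasureTheory Filter Topology
open scoped ENNReal NNReal ContDiff Polynomial

namespace WaveletFrame

noncomputable section

/-! ### The domain and Sobolev spaces -/

/-- The open unit square `Ω = (0,1)²`. -/
def Omega : Set (ℝ × ℝ) := Set.Ioo 0 1 ×ˢ Set.Ioo 0 1

/-- Lebesgue measure on `Ω`. -/
abbrev volOmega : Measure (ℝ × ℝ) := volume.restrict Omega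

/-- The partial derivative `∂^α = ∂₁^{α₁} ∂₂^{α₂}` of a function on the plane. -/
def partialDeriv (α : ℕ × ℕ) (η : ℝ × ℝ → ℝ) : ℝ × ℝ → ℝ :=
  (fun g x => fderiv ℝ g x (1, 0))^[α.1] ((fun g x => fderiv ℝ g x (0, 1))^[α.2] η)

/-- `g` is the weak derivative `∂^α u` on `Ω`. -/
def IsWeakDeriv (α : ℕ × ℕ) (u g : ℝ × ℝ → ℝ) : Prop :=
  ∀ η : ℝ × ℝ → ℝ, ContDiff ℝ ∞ η → HasCompactSupport η → tsupport η ⊆ Omega →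
    ∫ x in Omega, u x * partialDeriv α η x =
      (-1) ^ (α.1 + α.2) * ∫ x in Omega, g x * η x

/-- The multi-indices of order at most `k`. -/
def multiIndices (k : ℕ) : Finset (ℕ × ℕ) :=
  (Finset.range (k + 1) ×ˢ Finset.range (k + 1)).filter fun α => α.1 + α.2 ≤ k

theorem mem_multiIndices {k : ℕ} {α : ℕ × ℕ} : α ∈ multiIndices k ↔ α.1 + α.2 ≤ k := by
  simp only [multiIndices, Finset.mem_filter, Finset.mem_product, Finset.mem_range]
  omega

theorem contDiff_iterate_fderiv (v : ℝ × ℝ) (a : ℕ) {η : ℝ × ℝ → ℝ} (h : ContDiff ℝ ∞ η) :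
    ContDiff ℝ ∞ ((fun g x => fderiv ℝ g x v)^[a] η) := by
  induction a generalizing η with
  | zero => exact h
  | succ a ih =>
    rw [Function.iterate_succ_apply]
    exact ih ((h.fderiv_right (m := ∞) (by simp)).clm_apply contDiff_const)

theorem hasCompactSupport_iterate_fderiv (v : ℝ × ℝ) (a : ℕ) {η : ℝ × ℝ → ℝ}
    (h : HasCompactSupport η) : HasCompactSupport ((fun g x => fderiv ℝ g x v)^[a] η) := by
  induction a generalizing η with
  | zero => exact h
  | succ a ih =>
    rw [Function.iterate_succ_apply]
    exact ih (h.fderiv_apply (𝕜 := ℝ) v)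

theorem volOmega_lt_top : volume Omega < ⊤ := by
  rw [Omega, Measure.volume_eq_prod, Measure.prod_prod]
  simp

instance isFiniteMeasure_volOmega : IsFiniteMeasure volOmega :=
  ⟨by simpa using volOmega_lt_top⟩

theorem integrable_mul_of_test {p : ℝ≥0∞} (hp : 1 ≤ p) (u : Lp ℝ p volOmega) {η : ℝ × ℝ → ℝ}
    (h : Continuous η) (hc : HasCompactSupport η) :
    Integrable (fun x => u x * η x) volOmega := by
  obtain ⟨c, hcb⟩ := h.bounded_above_of_compact_support hc
  exact ((Lp.memLp u).integrable hp).mul_bdd (c := c) h.aestronglyMeasurable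
    (Eventually.of_forall hcb)

theorem integrable_mul_partialDeriv {p : ℝ≥0∞} (hp : 1 ≤ p) (u : Lp ℝ p volOmega) (α : ℕ × ℕ)
    {η : ℝ × ℝ → ℝ} (h : ContDiff ℝ ∞ η) (hc : HasCompactSupport η) :
    Integrable (fun x => u x * partialDeriv α η x) volOmega :=
  integrable_mul_of_test hp u
    (contDiff_iterate_fderiv _ _ (contDiff_iterate_fderiv _ _ h)).continuous
    (hasCompactSupport_iterate_fderiv _ _ (hasCompactSupport_iterate_fderiv _ _ hc))

/-- The Sobolev space `W_k^p(Ω)`. A function `u ∈ L_p(Ω)` whose weak derivatives `∂^α u` of order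
`|α| ≤ k` lie in `L_p(Ω)` is recorded together with these (unique) derivatives, as the family
`(∂^α u)_{|α| ≤ k}`; the norm inherited from the `ℓ_p`-product is the usual Sobolev norm
`(∑_{|α| ≤ k} ‖∂^α u‖_{L_p}^p)^{1/p}`. -/
def Sobolev (k : ℕ) (p : ℝ≥0∞) [hp : Fact (1 ≤ p)] :
    Submodule ℝ (PiLp p fun _ : multiIndices k => Lp ℝ p volOmega) where
  carrier := {U | ∀ α : multiIndices k,
    IsWeakDeriv α (U ⟨0, mem_multiIndices.2 (by simp)⟩) (U α)}
  zero_mem' := by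
    intro α η _ _ _
    have h0 : ((0 : Lp ℝ p volOmega) : ℝ × ℝ → ℝ) =ᵐ[volOmega] 0 := Lp.coeFn_zero _ _ _
    have key : ∀ θ : ℝ × ℝ → ℝ,
        ∫ x in Omega, (0 : Lp ℝ p volOmega) x * θ x = 0 := by
      intro θ
      rw [integral_congr_ae (g := fun _ => (0 : ℝ)), integral_zero]
      filter_upwards [h0] with x hx
      rw [hx, Pi.zero_apply, zero_mul]
    rw [PiLp.zero_apply, PiLp.zero_apply, key, key, mul_zero]
  add_mem' := by
    intro U V hU hV α η h1 h2 h3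
    have key : ∀ (a b : Lp ℝ p volOmega) (θ : ℝ × ℝ → ℝ),
        Integrable (fun x => a x * θ x) volOmega → Integrable (fun x => b x * θ x) volOmega →
        ∫ x in Omega, (a + b : Lp ℝ p volOmega) x * θ x =
          (∫ x in Omega, a x * θ x) + ∫ x in Omega, b x * θ x := by
      intro a b θ ha hb
      rw [← integral_add ha hb]
      refine integral_congr_ae ?_
      filter_upwards [Lp.coeFn_add a b] with x hx
      rw [hx, Pi.add_apply]
      ring
    simp only [PiLp.add_apply]
    rw [key _ _ _ (integrable_mul_partialDeriv hp.out _ _ h1 h2)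
      (integrable_mul_partialDeriv hp.out _ _ h1 h2),
      key _ _ _ (integrable_mul_of_test hp.out _ h1.continuous h2)
      (integrable_mul_of_test hp.out _ h1.continuous h2), hU α η h1 h2 h3, hV α η h1 h2 h3]
    ring
  smul_mem' := by
    intro c U hU α η h1 h2 h3
    have key : ∀ (a : Lp ℝ p volOmega) (θ : ℝ × ℝ → ℝ),
        ∫ x in Omega, (c • a : Lp ℝ p volOmega) x * θ x = c * ∫ x in Omega, a x * θ x := by
      intro a θ
      rw [← integral_const_mul]
      refine integral_congr_ae ?_
      filter_upwards [Lp.coeFn_smul c a] with x hx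
      rw [hx, Pi.smul_apply, smul_eq_mul]
      ring
    simp only [PiLp.smul_apply]
    rw [key, key, hU α η h1 h2 h3]
    ring

/-- The weak derivative `∂^α u` of `u ∈ W_k^p(Ω)`, `|α| ≤ k`, as a function. -/
def sobolevDeriv {k : ℕ} {p : ℝ≥0∞} [Fact (1 ≤ p)] (u : Sobolev k p) (α : ℕ × ℕ)
    (h : α.1 + α.2 ≤ k) : ℝ × ℝ → ℝ :=
  (u : PiLp p fun _ : multiIndices k => Lp ℝ p volOmega) ⟨α, mem_multiIndices.2 h⟩

/-- The function underlying `u ∈ W_k^p(Ω)`. -/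
def sobolevFun {k : ℕ} {p : ℝ≥0∞} [Fact (1 ≤ p)] (u : Sobolev k p) : ℝ × ℝ → ℝ :=
  sobolevDeriv u 0 (by simp)

/-! ### B-spline framelets -/

/-- The univariate cardinal B-spline of order `m ≥ 1`, supported on `[0, m]`. -/
def cardinalBSpline : ℕ → ℝ → ℝ
  | 0 => 0
  | 1 => Set.indicator (Set.Icc 0 1) 1
  | m + 2 => fun x => ∫ t in (x - 1)..x, cardinalBSpline (m + 1) t

/-- The refinable B-spline of order `m`: centred at `0` for even `m`, at `1/2` for odd `m`. -/
def bspline (m : ℕ) (x : ℝ) : ℝ := cardinalBSpline m (x + (m / 2 : ℕ))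

/-- The univariate B-spline tight frame masks `q_0, …, q_m` of order `m`: with `z = e^{-iξ}`,
the Fourier series of `q_l` is `± 2^{-m} √(m choose l) z^{-⌊m/2⌋} (1 - z)^l (1 + z)^{m-l}`.
The mask `q_0` is the refinement mask. -/
def mask (m l : ℕ) (k : ℤ) : ℝ :=
  if 0 ≤ k + (m / 2 : ℕ) then
    (if l = 0 then 1 else (-1) ^ (l + 1)) * √(m.choose l) / 2 ^ m *
      ((1 - Polynomial.X) ^ l * (1 + Polynomial.X) ^ (m - l) : ℝ[X]).coeff
        (k + (m / 2 : ℕ)).toNat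
  else 0

/-- The univariate framelet `ψ_l = 2 ∑_k q_l[k] φ(2 · - k)`; `ψ_0 = φ`. -/
def framelet (m l : ℕ) (x : ℝ) : ℝ := 2 * ∑' k : ℤ, mask m l k * bspline m (2 * x - k)

/-- The primitive `x ↦ ∫_{-∞}^x f`. -/
def primitive (f : ℝ → ℝ) (x : ℝ) : ℝ := ∫ t in Set.Iic x, f t

/-- The compactly supported function `φ_l` whose `l`-th derivative is the framelet `ψ_l`. -/
def varphi (m l : ℕ) : ℝ → ℝ := primitive^[l] (framelet m l)

/-- The compactly supported function whose `a`-th derivative is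
`z ↦ 2 ∑_r q_a[r] φ_b(2 z - r/2)`. -/
def varphiPair (m a b : ℕ) : ℝ → ℝ :=
  primitive^[a] fun z => 2 * ∑' r : ℤ, mask m a r * varphi m b (2 * z - r / 2)

/-- Tensor product of two univariate functions. -/
def tensor (f g : ℝ → ℝ) (x : ℝ × ℝ) : ℝ := f x.1 * g x.2

/-- The tensor-product mask `q^{(b)}` of the band `b`, `0 ≤ b₁, b₂ ≤ m`. -/
def mask₂ (m : ℕ) (b : ℕ × ℕ) (k : ℤ × ℤ) : ℝ := mask m b.1 k.1 * mask m b.2 k.2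

/-- The tensor-product refinable function `φ`. -/
def phi₂ (m : ℕ) : ℝ × ℝ → ℝ := tensor (bspline m) (bspline m)

/-- The compactly supported function `φ_b` with `∂^b φ_b = ψ_b`, where `ψ_b = ψ_{b₁} ⊗ ψ_{b₂}`. -/
def varphi₂ (m : ℕ) (b : ℕ × ℕ) : ℝ × ℝ → ℝ := tensor (varphi m b.1) (varphi m b.2)

/-- `c_b = ∫ φ_b`. -/
def cst (m : ℕ) (b : ℕ × ℕ) : ℝ := ∫ x, varphi₂ m b x

/-- The compactly supported function `φ_{ab}` with
`(∂^a φ_{ab})(z) = 4 c_b⁻¹ ∑_r q^{(a)}[r] φ_b(2 z - r/2)`, equivalently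
`∑_l q^{(a)}[l - k] c_b⁻¹ φ_{b,n-1,l} = 2^{-(n-2)|a|} ∂^a φ_{ab,n-2,k}` for
`φ_{ab,n-2,k} = 2^{n-4} φ_{ab}(2^{n-2} · - k/4)`. -/
def varphiPair₂ (m : ℕ) (a b : ℕ × ℕ) (x : ℝ × ℝ) : ℝ :=
  (cst m b)⁻¹ * tensor (varphiPair m a.1 b.1) (varphiPair m a.2 b.2) x

/-- `c_{ab} = ∫ φ_{ab}`. -/
def cstPair (m : ℕ) (a b : ℕ × ℕ) : ℝ := ∫ x, varphiPair₂ m a b x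

/-! ### Sampling and wavelet frame transforms

Arrays are written on all of `ℤ²`; the energies only read them at the indices in `K_n`, where
every sample that enters a convolution comes from a function supported in the closed square. -/

/-- `φ_{n,k} = 2^n φ(2^n · - k)`. -/
def phiScaled (m n : ℕ) (k : ℤ × ℤ) (x : ℝ × ℝ) : ℝ :=
  2 ^ n * phi₂ m (2 ^ n * x.1 - k.1, 2 ^ n * x.2 - k.2)

/-- `φ_{b,n-1,k} = 2^{n-2} φ_b(2^{n-1} · - k/2)`. -/
def varphiScaled (m : ℕ) (b : ℕ × ℕ) (n : ℕ) (k : ℤ × ℤ) (x : ℝ × ℝ) : ℝ :=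
  2 ^ ((n : ℤ) - 2) *
    varphi₂ m b (2 ^ ((n : ℤ) - 1) * x.1 - k.1 / 2, 2 ^ ((n : ℤ) - 1) * x.2 - k.2 / 2)

/-- `M_n`: the indices `k` with `supp φ_{n,k} ⊆ closure Ω`. -/
def indexM (m n : ℕ) : Set (ℤ × ℤ) := {k | tsupport (phiScaled m n k) ⊆ closure Omega}

/-- `K_n`: the `k ∈ M_n` with `k + C · supp q ⊆ M_n` for the masks `q` of the low-pass band and of
all the bands `β_j`. -/
def indexK (m : ℕ) {J : ℕ} (β : Fin J → ℕ × ℕ) (C n : ℕ) : Set (ℤ × ℤ) :=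
  {k | k ∈ indexM m n ∧ ∀ b : ℕ × ℕ, (b = 0 ∨ ∃ j, b = β j) →
    ∀ r : ℤ × ℤ, mask₂ m b r ≠ 0 → k + C • r ∈ indexM m n}

/-- The sampling operator `T_n`. -/
def sampleT (m n : ℕ) (g : ℝ × ℝ → ℝ) (k : ℤ × ℤ) : ℝ :=
  2 ^ n * ∫ x in Omega, g x * phiScaled m n k x

/-- The sampling operator `S_n`. -/
def sampleS (m : ℕ) {J : ℕ} (β : Fin J → ℕ × ℕ) (n : ℕ) (v : Fin J → ℝ × ℝ → ℝ) (j : Fin J)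
    (k : ℤ × ℤ) : ℝ :=
  2 ^ n * ∫ x in Omega, v j x * ((cst m (β j))⁻¹ * varphiScaled m (β j) n k x)

/-- The convolution `(q^{(b)}[-·] ⊛ a)[k] = ∑_l q^{(b)}[l - k] a[l]`. -/
def conv (m : ℕ) (b : ℕ × ℕ) (a : ℤ × ℤ → ℝ) (k : ℤ × ℤ) : ℝ :=
  ∑' l : ℤ × ℤ, mask₂ m b (l - k) * a l

/-- The order `|b|` of `∂^b`. -/
def order (b : ℕ × ℕ) : ℕ := b.1 + b.2

/-- The weighted transform `W'_n`, with weights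
`λ'_j = c_j⁻¹ (-1)^{s_j} 2^{(n-1) s_j}`. -/
def transform₁ (m : ℕ) {J : ℕ} (β : Fin J → ℕ × ℕ) (n : ℕ) (a : ℤ × ℤ → ℝ) (j : Fin J)
    (k : ℤ × ℤ) : ℝ :=
  (cst m (β j))⁻¹ * (-1) ^ order (β j) * (2 ^ ((n : ℤ) - 1)) ^ order (β j) * conv m (β j) a k

/-- The weighted transform `W''_n`, with weights
`λ''_{ij} = c_{ij}⁻¹ (-1)^{s_i} 2^{(n-2) s_i}`. -/
def transform₂ (m : ℕ) {J : ℕ} (β : Fin J → ℕ × ℕ) (n : ℕ) (a : Fin J → ℤ × ℤ → ℝ)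
    (ij : Fin J × Fin J) (k : ℤ × ℤ) : ℝ :=
  (cstPair m (β ij.1) (β ij.2))⁻¹ * (-1) ^ order (β ij.1) *
    (2 ^ ((n : ℤ) - 2)) ^ order (β ij.1) * conv m (β ij.1) (a ij.2) k

/-! ### The energies -/

/-- `‖a‖_{ℓ_r(K; ℓ_2)} = (2^{-2n} ∑_{k ∈ K} (∑_i |a_i[k]|²)^{r/2})^{1/r}`. -/
def discreteNorm {κ : Type} [Fintype κ] (n : ℕ) (K : Set (ℤ × ℤ)) (r : ℝ) (a : κ → K → ℝ) :
    ℝ≥0∞ :=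
  (((2 : ℝ≥0∞) ^ (2 * n))⁻¹ * ∑' k : K, ENNReal.ofReal ((∑ i, |a i k| ^ 2) ^ (r / 2))) ^ (1 / r)

/-- The `ℓ_2(K)`-norm of a scalar array. -/
def discreteNorm₂ (n : ℕ) (K : Set (ℤ × ℤ)) (a : K → ℝ) : ℝ≥0∞ :=
  discreteNorm n K 2 fun _ : Unit => a

/-- `‖g‖_{L_r(Ω; ℓ_2)} = (∫_Ω (∑_i |g_i|²)^{r/2})^{1/r}`. -/
def continuumNorm {κ : Type} [Fintype κ] (r : ℝ) (g : κ → ℝ × ℝ → ℝ) : ℝ≥0∞ :=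
  (∫⁻ x in Omega, ENNReal.ofReal ((∑ i, |g i x| ^ 2) ^ (r / 2))) ^ (1 / r)

/-- `s = |𝐃'| = max_j |D_j|` for `𝐃' = (∂^{β_1}, …, ∂^{β_J})`. -/
def maxOrder {J : ℕ} (β : Fin J → ℕ × ℕ) : ℕ := Finset.univ.sup fun j => order (β j)

theorem order_le_maxOrder {J : ℕ} (β : Fin J → ℕ × ℕ) (j : Fin J) :
    (β j).1 + (β j).2 ≤ maxOrder β :=
  Finset.le_sup (f := fun j => order (β j)) (Finset.mem_univ j)

/-- The space `W_{2s}^p(Ω) × W_s^q(Ω; ℝ^J)`, with its product topology. -/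
abbrev EnergySpace {J : ℕ} (β : Fin J → ℕ × ℕ) (p q : ℝ≥0∞) [Fact (1 ≤ p)] [Fact (1 ≤ q)] : Type :=
  Sobolev (2 * maxOrder β) p × (Fin J → Sobolev (maxOrder β) q)

/-- The restriction of `T_n g` to `K_n`. -/
def sampleTK (m : ℕ) {J : ℕ} (β : Fin J → ℕ × ℕ) (C n : ℕ) (g : ℝ × ℝ → ℝ)
    (k : indexK m β C n) : ℝ :=
  sampleT m n g k

/-- The functional `E_n` at resolution `n`. -/
def discreteEnergy (m : ℕ) {J : ℕ} (β : Fin J → ℕ × ℕ) (C : ℕ) (p q : ℝ≥0∞) [Fact (1 ≤ p)]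
    [Fact (1 ≤ q)] (ν₁ ν₂ : ℝ≥0) (f : Lp ℝ 2 volOmega) (n : ℕ)
    (An : (indexK m β C n → ℝ) →ₗ[ℝ] (indexK m β C n → ℝ)) (w : EnergySpace β p q) : ℝ≥0∞ :=
  ν₁ * discreteNorm n (indexK m β C n) p.toReal
      (fun j k => transform₁ m β n (sampleT m n (sobolevFun w.1)) j k -
        sampleS m β n (fun i => sobolevFun (w.2 i)) j k) ^ p.toReal
    + ν₂ * discreteNorm n (indexK m β C n) q.toReal
      (fun ij k => transform₂ m β n (sampleS m β n fun i => sobolevFun (w.2 i)) ij k) ^ q.toReal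
    + 2⁻¹ * discreteNorm₂ n (indexK m β C n)
      (An (sampleTK m β C n (sobolevFun w.1)) - sampleTK m β C n f) ^ 2

open Classical in
/-- `‖A u - f‖_{L_2(Ω)}`, and `+∞` for a function `u` outside `L_2(Ω)` (by Sobolev embedding the
functions in `W_{2s}^p(Ω)`, `s ≥ 1`, all belong to `L_2(Ω)`). -/
def fidelity (A : Lp ℝ 2 volOmega →ₗ[ℝ] Lp ℝ 2 volOmega) (f : Lp ℝ 2 volOmega)
    (u : ℝ × ℝ → ℝ) : ℝ≥0∞ :=
  if h : MemLp u 2 volOmega then ‖A (h.toLp u) - f‖ₑ else ⊤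

/-- The variational functional `E`. -/
def energy {J : ℕ} (β : Fin J → ℕ × ℕ) (p q : ℝ≥0∞) [Fact (1 ≤ p)] [Fact (1 ≤ q)]
    (ν₁ ν₂ : ℝ≥0) (A : Lp ℝ 2 volOmega →ₗ[ℝ] Lp ℝ 2 volOmega) (f : Lp ℝ 2 volOmega)
    (w : EnergySpace β p q) : ℝ≥0∞ :=
  ν₁ * continuumNorm p.toReal
      (fun j x => sobolevDeriv w.1 (β j) ((order_le_maxOrder β j).trans (by omega)) x -
        sobolevFun (w.2 j) x) ^ p.toReal
    + ν₂ * continuumNorm q.toReal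
      (fun (ij : Fin J × Fin J) x =>
        sobolevDeriv (w.2 ij.2) (β ij.1) (order_le_maxOrder β ij.1) x) ^ q.toReal
    + 2⁻¹ * fidelity A f (sobolevFun w.1) ^ 2

/-- `x` is an `ε`-optimal solution of `inf F`. -/
def IsEpsOptimal {X : Type} (F : X → ℝ≥0∞) (ε : ℝ≥0) (x : X) : Prop :=
  F x ≤ (⨅ y, F y) + ε

/-- A minimizer is a `0`-optimal solution. -/
def IsMinimizer {X : Type} (F : X → ℝ≥0∞) (x : X) : Prop := IsEpsOptimal F 0 x

end

end WaveletFrame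

open WaveletFrame

namespace WaveletFrame

noncomputable section

/-! ### Bounded, compactly supported univariate kernels -/

/-! The energies converge continuously: if `w n` tends to `w'` in the energy space along any filter
`l ≤ atTop`, then `E_n (w n)` tends to `E w'` (`tendsto_discreteEnergy`). The corollary follows at
once. A cluster point is a limit along some ultrafilter below `atTop`; for a competitor `y`, pass to
the limit in `E_n (w n) ≤ E_n y + ε`, using the constant sequence `y` on the right, and then take
the infimum over `y`.

Continuous convergence has three ingredients.

Exact integration by parts. Let `S` be the unit shift and `winInt g` the integral of `g` over `[x -
1, x]`. Then `(winInt g)' = (1 - S) g` for continuous `g`, while the mask `q_l` is, up to a constant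
and a translation, the polynomial `(1 - S)^l (1 + S)^(m - l)`. Filtering a kernel by `q_l` is
therefore formally the `l`-th derivative of its `liftOp`, and the frame transform of the samples of
`u` equals, at each index of `K_n` and with no error term, a local average of the weak derivative of
`u` (`transform₁_sampleT`, `transform₂_sampleS`). The weights of the transforms are those that give
the averaging kernel integral one. The kernels are not smooth and their supports may touch the
boundary of the square, so they are first approximated by admissible test functions
(`IsKernel.exists_smooth_approx`).

Strong convergence of averages. A discrete norm is the `L_r` norm of a step function on dyadic cells
(`discreteNorm_eq_eLpNorm`). Averaging against `4^n κ(2^n · - k)` is bounded on `L_r` uniformly in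
`n` and converges on continuous compactly supported functions, hence strongly by density; the
uniform bound also lets the averaged function vary with `n`
(`IsAvgKernel.tendsto_eLpNorm_stepFun_avg`).

The fidelity term. Consistency says that the operators `A_n T_n` converge pointwise on `L_2` to `A`,
so Banach–Steinhaus bounds them uniformly and they converge along `L_2`-convergent sequences.
Convergence of `u_n` in `L_2` comes from the embedding of `W_1^1` into `L_2`
(`exists_eLpNorm_two_le`), obtained by Gagliardo's slicing argument on mollified functions. The same
embedding makes sense of `v_j`, a priori only in `L_q`, inside an `L_p` norm. -/

/-- A bounded measurable function vanishing outside `[L, R]`. -/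
structure IsKernel (L R : ℝ) (g : ℝ → ℝ) : Prop where
  meas : Measurable g
  bdd : ∃ M, ∀ x, |g x| ≤ M
  supp : ∀ x, x ∉ Set.Icc L R → g x = 0

/-- The unit shift `g ↦ g(· - 1)`. -/
def shift : (ℝ → ℝ) →ₗ[ℝ] (ℝ → ℝ) where
  toFun g x := g (x - 1)
  map_add' _ _ := rfl
  map_smul' _ _ := rfl

/-- The window integral `x ↦ ∫_{x-1}^x g`. -/
def winInt (g : ℝ → ℝ) (x : ℝ) : ℝ := ∫ t in (x - 1)..x, g t

theorem shift_apply (g : ℝ → ℝ) (x : ℝ) : shift g x = g (x - 1) := rfl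

theorem shift_pow_apply (i : ℕ) (g : ℝ → ℝ) (x : ℝ) : (shift ^ i) g x = g (x - i) := by
  induction i generalizing x with
  | zero => simp
  | succ i ih =>
    rw [pow_succ', Module.End.mul_apply, shift_apply, ih]
    push_cast
    congr 1
    ring

namespace IsKernel

variable {L R : ℝ} {g g' : ℝ → ℝ}

theorem mono {L' R' : ℝ} (h : IsKernel L R g) (hL : L' ≤ L) (hR : R ≤ R') : IsKernel L' R' g :=
  ⟨h.meas, h.bdd, fun x hx => h.supp x fun hx' => hx ⟨hL.trans hx'.1, hx'.2.trans hR⟩⟩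

theorem add (h : IsKernel L R g) (h' : IsKernel L R g') : IsKernel L R (g + g') := by
  obtain ⟨M, hM⟩ := h.bdd
  obtain ⟨M', hM'⟩ := h'.bdd
  refine ⟨h.meas.add h'.meas, ⟨M + M', fun x => ?_⟩, fun x hx => ?_⟩
  · exact (abs_add_le _ _).trans (add_le_add (hM x) (hM' x))
  · simp [h.supp x hx, h'.supp x hx]

theorem const_mul (h : IsKernel L R g) (c : ℝ) : IsKernel L R (fun x => c * g x) := by
  obtain ⟨M, hM⟩ := h.bdd
  refine ⟨h.meas.const_mul c, ⟨|c| * M, fun x => ?_⟩, fun x hx => ?_⟩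
  · rw [abs_mul]
    exact mul_le_mul_of_nonneg_left (hM x) (abs_nonneg c)
  · simp [h.supp x hx]

theorem neg (h : IsKernel L R g) : IsKernel L R (-g) := by
  have := h.const_mul (-1)
  simpa [Pi.neg_def] using this

theorem sub (h : IsKernel L R g) (h' : IsKernel L R g') : IsKernel L R (g - g') := by
  rw [sub_eq_add_neg]
  exact h.add h'.neg

theorem translate (h : IsKernel L R g) (c : ℝ) :
    IsKernel (L - c) (R - c) (fun x => g (x + c)) := by
  obtain ⟨M, hM⟩ := h.bdd
  refine ⟨h.meas.comp (measurable_id.add_const c), ⟨M, fun x => hM _⟩, fun x hx => h.supp _ ?_⟩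
  contrapose! hx
  exact ⟨by linarith [hx.1], by linarith [hx.2]⟩

theorem shift (h : IsKernel L R g) : IsKernel (L + 1) (R + 1) (shift g) := by
  have := h.translate (-1)
  simpa [WaveletFrame.shift, sub_eq_add_neg] using this

theorem one_add_shift_pow (h : IsKernel L R g) (i : ℕ) :
    IsKernel L (R + i) (((1 + WaveletFrame.shift) ^ i) g) := by
  induction i with
  | zero => simpa using h
  | succ i ih =>
    rw [pow_succ', Module.End.mul_apply, LinearMap.add_apply, Module.End.one_apply]
    push_cast
    exact (ih.mono le_rfl (by linarith)).add (ih.shift.mono (by linarith) (by linarith))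

theorem one_sub_shift_pow (h : IsKernel L R g) (i : ℕ) :
    IsKernel L (R + i) (((1 - WaveletFrame.shift) ^ i) g) := by
  induction i with
  | zero => simpa using h
  | succ i ih =>
    rw [pow_succ', Module.End.mul_apply, LinearMap.sub_apply, Module.End.one_apply]
    push_cast
    exact (ih.mono le_rfl (by linarith)).sub (ih.shift.mono (by linarith) (by linarith))

theorem integrable (h : IsKernel L R g) : Integrable g := by
  obtain ⟨M, hM⟩ := h.bdd
  have h1 : IntegrableOn g (Set.Icc L R) :=
    Measure.integrableOn_of_bounded (M := M) (by simp) h.meas.aestronglyMeasurable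
      (Eventually.of_forall hM)
  exact (integrableOn_iff_integrable_of_support_subset
    (fun x hx => by_contra fun hx' => hx (h.supp x hx'))).1 h1

theorem intervalIntegrable (h : IsKernel L R g) (a b : ℝ) : IntervalIntegrable g volume a b :=
  h.integrable.intervalIntegrable

end IsKernel

theorem continuous_winInt {g : ℝ → ℝ} (h : Integrable g) : Continuous (winInt g) := by
  have hp : Continuous fun x => ∫ t in (0 : ℝ)..x, g t :=
    intervalIntegral.continuous_primitive (fun a b => h.intervalIntegrable) 0
  have : winInt g = fun x => (∫ t in (0 : ℝ)..x, g t) - ∫ t in (0 : ℝ)..(x - 1), g t := by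
    funext x
    rw [winInt, intervalIntegral.integral_interval_sub_left] <;> exact h.intervalIntegrable
  rw [this]
  exact hp.sub (hp.comp (continuous_id.sub continuous_const))

theorem abs_winInt_le {g : ℝ → ℝ} {M : ℝ} (h : ∀ x, |g x| ≤ M) (x : ℝ) : |winInt g x| ≤ M := by
  have := intervalIntegral.norm_integral_le_of_norm_le_const (a := x - 1) (b := x) (f := g)
    (C := M) (fun t _ => h t)
  simpa [winInt] using this

theorem IsKernel.winInt {L R : ℝ} {g : ℝ → ℝ} (h : IsKernel L R g) :
    IsKernel L (R + 1) (winInt g) := by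
  obtain ⟨M, hM⟩ := h.bdd
  refine ⟨(continuous_winInt h.integrable).measurable, ⟨M, abs_winInt_le hM⟩, fun x hx => ?_⟩
  rw [WaveletFrame.winInt, intervalIntegral.integral_of_le (by linarith),
    setIntegral_congr_fun (g := fun _ => (0 : ℝ)) measurableSet_Ioc]
  · simp
  intro t ht
  refine h.supp t fun ht' => hx ⟨?_, ?_⟩
  · linarith [ht.2, ht'.1]
  · linarith [ht.1, ht'.2]

theorem IsKernel.winInt_iterate {L R : ℝ} {g : ℝ → ℝ} (h : IsKernel L R g) (l : ℕ) :
    IsKernel L (R + l) (WaveletFrame.winInt^[l] g) := by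
  induction l with
  | zero => simpa using h
  | succ l ih =>
    rw [Function.iterate_succ_apply']
    push_cast
    rw [← add_assoc]
    exact ih.winInt

theorem winInt_shift (g : ℝ → ℝ) : winInt (shift g) = shift (winInt g) := by
  funext x
  simp only [winInt, shift_apply]
  rw [intervalIntegral.integral_comp_sub_right]

theorem winInt_one_sub_shift {g : ℝ → ℝ} (h : ∀ a b, IntervalIntegrable g volume a b) :
    winInt ((1 - shift) g) = (1 - shift) (winInt g) := by
  rw [LinearMap.sub_apply, LinearMap.sub_apply, ← winInt_shift]
  funext x
  simp only [winInt, Module.End.one_apply, Pi.sub_apply]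
  rw [intervalIntegral.integral_sub (h _ _)]
  have := (h (x - 1 - 1) (x - 1)).comp_sub_right (c := 1)
  simpa [shift] using this

/-- Lets the factors `1 - shift` be pulled through a window integral one at a time, so that each can
later meet its own primitive or derivative. Integrability is what makes the integral additive. -/
theorem winInt_one_sub_shift_pow {g : ℝ → ℝ} (h : ∀ a b, IntervalIntegrable g volume a b)
    (l : ℕ) : winInt (((1 - shift) ^ l) g) = ((1 - shift) ^ l) (winInt g) := by
  have key : ∀ i : ℕ, ∀ a b, IntervalIntegrable (((1 - shift) ^ i) g) volume a b := by
    intro i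
    induction i with
    | zero => simpa using h
    | succ i ih =>
      intro a b
      rw [pow_succ', Module.End.mul_apply, LinearMap.sub_apply, Module.End.one_apply]
      refine (ih a b).sub ?_
      have := (ih (a - 1) (b - 1)).comp_sub_right (c := 1)
      simpa [shift] using this
  induction l with
  | zero => simp
  | succ l ih =>
    rw [pow_succ', Module.End.mul_apply, Module.End.mul_apply, winInt_one_sub_shift (key l), ih]

theorem integral_shift (g : ℝ → ℝ) : ∫ x, shift g x = ∫ x, g x := by
  simp only [shift_apply]
  exact integral_sub_right_eq_self g 1

theorem IsKernel.integral_one_add_shift_pow {L R : ℝ} {g : ℝ → ℝ} (h : IsKernel L R g) (i : ℕ) :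
    ∫ x, ((1 + WaveletFrame.shift) ^ i) g x = 2 ^ i * ∫ x, g x := by
  induction i with
  | zero => simp
  | succ i ih =>
    rw [pow_succ', Module.End.mul_apply, LinearMap.add_apply, Module.End.one_apply]
    have h1 := (h.one_add_shift_pow i)
    rw [show (fun x => ((((1 + WaveletFrame.shift) ^ i) g) +
      WaveletFrame.shift (((1 + WaveletFrame.shift) ^ i) g)) x) =
      fun x => (((1 + WaveletFrame.shift) ^ i) g) x +
      WaveletFrame.shift (((1 + WaveletFrame.shift) ^ i) g) x from rfl,
      integral_add h1.integrable h1.shift.integrable, integral_shift, ih]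
    ring

theorem winInt_eq_setIntegral (g : ℝ → ℝ) (x : ℝ) :
    winInt g x = ∫ t in Set.Ico (0 : ℝ) 1, g (x - t) := by
  rw [integral_Ico_eq_integral_Ioc, ← intervalIntegral.integral_of_le zero_le_one,
    intervalIntegral.integral_comp_sub_left]
  simp [winInt]

/-- The window integral is convolution with the indicator of the unit interval, whose mass is one.
-/
theorem integral_winInt {g : ℝ → ℝ} (h : Integrable g) : ∫ x, winInt g x = ∫ x, g x := by
  have h1 : Integrable ((Set.Ico (0 : ℝ) 1).indicator fun _ => (1 : ℝ)) :=
    (integrable_indicator_iff measurableSet_Ico).2 (by simp)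
  have h2 := integral_convolution (ContinuousLinearMap.mul ℝ ℝ) h1 h
  have h3 : ∫ x : ℝ, (Set.Ico (0 : ℝ) 1).indicator (fun _ => (1 : ℝ)) x = 1 := by
    rw [integral_indicator measurableSet_Ico]
    simp
  rw [h3, ContinuousLinearMap.mul_apply', one_mul] at h2
  rw [← h2]
  congr 1
  funext x
  rw [winInt_eq_setIntegral, convolution, ← integral_indicator measurableSet_Ico]
  congr 1
  funext t
  by_cases ht : t ∈ Set.Ico (0 : ℝ) 1 <;> simp [ht]

theorem IsKernel.integral_winInt_iterate {L R : ℝ} {g : ℝ → ℝ} (h : IsKernel L R g) (l : ℕ) :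
    ∫ x, (WaveletFrame.winInt^[l] g) x = ∫ x, g x := by
  induction l with
  | zero => simp
  | succ l ih =>
    rw [Function.iterate_succ_apply', integral_winInt (h.winInt_iterate l).integrable, ih]

/-! ### Primitives -/

/-- The integrals up to `x` and up to `x - 1` cancel except on the window. This is why primitives of
framelets stay compactly supported. -/
theorem IsKernel.primitive_one_sub_shift {L R : ℝ} {g : ℝ → ℝ} (h : IsKernel L R g) :
    primitive ((1 - WaveletFrame.shift) g) = WaveletFrame.winInt g := by
  funext x
  rw [primitive, WaveletFrame.winInt]
  have h1 : ∫ t in Set.Iic x, WaveletFrame.shift g t = ∫ t in Set.Iic (x - 1), g t := by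
    simp only [shift_apply]
    rw [← integral_indicator measurableSet_Iic, ← integral_indicator measurableSet_Iic,
      ← integral_sub_right_eq_self ((Set.Iic (x - 1)).indicator g) (1 : ℝ)]
    congr 1
    funext t
    simp only [Set.indicator, Set.mem_Iic, sub_le_sub_iff_right]
  rw [show (fun t => ((1 - WaveletFrame.shift) g) t) = fun t => g t - WaveletFrame.shift g t from rfl,
    integral_sub h.integrable.integrableOn h.shift.integrable.integrableOn, h1,
    intervalIntegral.integral_Iic_sub_Iic h.integrable.integrableOn h.integrable.integrableOn]

theorem primitive_comp_affine (g : ℝ → ℝ) (c : ℝ) {lam : ℝ} (hl : 0 < lam) (d : ℝ) :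
    primitive (fun x => c * g (lam * x + d)) = fun x => c * lam⁻¹ * primitive g (lam * x + d) := by
  funext x
  rw [primitive, primitive, integral_const_mul, mul_assoc]
  congr 1
  rw [← integral_indicator measurableSet_Iic, ← integral_indicator measurableSet_Iic]
  have h1 := Measure.integral_comp_mul_left
    (fun y => (Set.Iic (lam * x + d)).indicator g (y + d)) lam
  rw [integral_add_right_eq_self (fun y => (Set.Iic (lam * x + d)).indicator g y) d,
    abs_of_pos (inv_pos.2 hl), smul_eq_mul] at h1
  rw [← h1]
  congr 1
  funext t
  simp only [Set.indicator, Set.mem_Iic, add_le_add_iff_right, mul_le_mul_iff_right₀ hl]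

/-- Each primitive absorbs one factor `1 - shift`, leaving a window integral, and contributes one
`lam⁻¹` from the dilation. The induction varies `g` and `R` because a window integral enlarges the
support. -/
theorem IsKernel.primitive_iterate {L R : ℝ} {g : ℝ → ℝ} (h : IsKernel L R g) (l : ℕ) (c : ℝ)
    {lam : ℝ} (hl : 0 < lam) (d : ℝ) :
    primitive^[l] (fun x => c * ((1 - WaveletFrame.shift) ^ l) g (lam * x + d)) =
      fun x => c * lam⁻¹ ^ l * (WaveletFrame.winInt^[l] g) (lam * x + d) := by
  induction l generalizing g R c with
  | zero => simp
  | succ l ih =>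
    rw [Function.iterate_succ_apply, primitive_comp_affine _ _ hl, pow_succ', Module.End.mul_apply,
      (h.one_sub_shift_pow l).primitive_one_sub_shift,
      winInt_one_sub_shift_pow h.intervalIntegrable, ih h.winInt, Function.iterate_succ_apply]
    funext x
    ring

/-! ### B-splines, masks and framelets -/

theorem cardinalBSpline_succ_succ (m : ℕ) :
    cardinalBSpline (m + 2) = winInt (cardinalBSpline (m + 1)) := by
  funext x
  rw [cardinalBSpline, winInt]

theorem isKernel_cardinalBSpline (m : ℕ) : IsKernel 0 (m + 1 : ℕ) (cardinalBSpline (m + 1)) := by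
  induction m with
  | zero =>
    refine ⟨measurable_one.indicator measurableSet_Icc, ⟨1, fun x => ?_⟩, fun x hx => ?_⟩
    · rw [cardinalBSpline]
      by_cases hx : x ∈ Set.Icc (0 : ℝ) 1 <;> simp [hx]
    · rw [cardinalBSpline]
      simp only [zero_add, Nat.cast_one] at hx
      simp [hx]
  | succ m ih =>
    rw [cardinalBSpline_succ_succ]
    have := ih.winInt
    push_cast at this ⊢
    exact this

theorem cardinalBSpline_nonneg (m : ℕ) (x : ℝ) : 0 ≤ cardinalBSpline (m + 1) x := by
  induction m generalizing x with
  | zero =>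
    rw [cardinalBSpline]
    exact Set.indicator_nonneg (fun _ _ => zero_le_one) _
  | succ m ih =>
    rw [cardinalBSpline_succ_succ, winInt]
    exact intervalIntegral.integral_nonneg (by linarith) fun t _ => ih t

/-- Strict positivity on the open support interval shows that the support of `φ_{n,k}` is no smaller
than expected, which is needed to describe `indexM` by inequalities. -/
theorem cardinalBSpline_pos (m : ℕ) {x : ℝ} (h0 : 0 < x) (h1 : x < (m + 1 : ℕ)) :
    0 < cardinalBSpline (m + 1) x := by
  induction m generalizing x with
  | zero =>
    rw [cardinalBSpline, Set.indicator_of_mem]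
    · simp
    · exact ⟨h0.le, by simpa using h1.le⟩
  | succ m ih =>
    have hI : ∀ a b, IntervalIntegrable (cardinalBSpline (m + 1)) volume a b :=
      (isKernel_cardinalBSpline m).intervalIntegrable
    push_cast at h1 ih
    rw [cardinalBSpline_succ_succ, winInt]
    -- `[a, b]` is the part of the window on which the spline of lower order is positive by
    -- induction; it is nondegenerate because `0 < x < m + 2`.
    set a := max (x - 1) 0
    set b := min x (m + 1)
    have ha : x - 1 ≤ a := le_max_left _ _
    have ha0 : 0 ≤ a := le_max_right _ _
    have hb : b ≤ x := min_le_left _ _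
    have hb1 : b ≤ m + 1 := min_le_right _ _
    have hm : (0 : ℝ) < m + 1 := by positivity
    have hab : a < b := max_lt (lt_min (by linarith) (by linarith)) (lt_min h0 hm)
    have h2 : 0 < ∫ t in a..b, cardinalBSpline (m + 1) t :=
      intervalIntegral.intervalIntegral_pos_of_pos_on (hI _ _)
        (fun t ht => ih (ha0.trans_lt ht.1) (ht.2.trans_le hb1)) hab
    rw [← intervalIntegral.integral_add_adjacent_intervals (hI (x - 1) a) (hI a x),
      ← intervalIntegral.integral_add_adjacent_intervals (hI a b) (hI b x)]
    have h3 := intervalIntegral.integral_nonneg (μ := volume) ha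
      fun t _ => cardinalBSpline_nonneg m t
    have h4 := intervalIntegral.integral_nonneg (μ := volume) hb
      fun t _ => cardinalBSpline_nonneg m t
    linarith

theorem integral_cardinalBSpline (m : ℕ) : ∫ x, cardinalBSpline (m + 1) x = 1 := by
  induction m with
  | zero =>
    simp only [cardinalBSpline]
    rw [integral_indicator measurableSet_Icc]
    simp
  | succ m ih =>
    rw [cardinalBSpline_succ_succ, integral_winInt (isKernel_cardinalBSpline m).integrable, ih]

theorem isKernel_bspline {m : ℕ} (hm : 1 ≤ m) :
    IsKernel (-(m / 2 : ℕ)) (m - (m / 2 : ℕ)) (bspline m) := by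
  obtain ⟨n, rfl⟩ := Nat.exists_eq_add_of_le' hm
  have := (isKernel_cardinalBSpline n).translate ((n + 1) / 2 : ℕ)
  rw [zero_sub] at this
  exact this

theorem integral_bspline {m : ℕ} (hm : 1 ≤ m) : ∫ x, bspline m x = 1 := by
  obtain ⟨n, rfl⟩ := Nat.exists_eq_add_of_le' hm
  simp only [bspline]
  rw [integral_add_right_eq_self (cardinalBSpline (n + 1)), integral_cardinalBSpline]

theorem bspline_pos {m : ℕ} {x : ℝ} (h0 : 0 < x + (m / 2 : ℕ)) (h1 : x + (m / 2 : ℕ) < m) :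
    0 < bspline m x := by
  cases m with
  | zero => simp at h0 h1; linarith
  | succ n => exact cardinalBSpline_pos n h0 h1

/-- The leading constant of the mask `q_l`. -/
def maskConst (m l : ℕ) : ℝ := (if l = 0 then 1 else (-1) ^ (l + 1)) * √(m.choose l) / 2 ^ m

theorem maskConst_ne_zero {m l : ℕ} (hl : l ≤ m) : maskConst m l ≠ 0 := by
  have h1 : √(m.choose l : ℝ) ≠ 0 :=
    (Real.sqrt_pos.2 (by exact_mod_cast Nat.choose_pos hl)).ne'
  have h2 : (if l = 0 then (1 : ℝ) else (-1) ^ (l + 1)) ≠ 0 := by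
    split_ifs
    · exact one_ne_zero
    · exact pow_ne_zero _ (by norm_num)
  exact div_ne_zero (mul_ne_zero h2 h1) (by positivity)

theorem natDegree_maskPoly_le {m l : ℕ} (hl : l ≤ m) :
    ((1 - Polynomial.X) ^ l * (1 + Polynomial.X) ^ (m - l) : ℝ[X]).natDegree ≤ m := by
  have h1 : (1 - Polynomial.X : ℝ[X]).natDegree ≤ 1 := by compute_degree
  have h2 : (1 + Polynomial.X : ℝ[X]).natDegree ≤ 1 := by compute_degree
  refine Polynomial.natDegree_mul_le.trans ?_
  have h3 := Polynomial.natDegree_pow_le_of_le l h1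
  have h4 := Polynomial.natDegree_pow_le_of_le (m - l) h2
  omega

/-- The interval of integers containing the supports of the masks of order `m`. -/
def maskRange (m : ℕ) : Finset ℤ := Finset.Icc (-((m / 2 : ℕ) : ℤ)) (m - (m / 2 : ℕ))

theorem mask_eq_zero {m l : ℕ} (hl : l ≤ m) {r : ℤ} (hr : r ∉ maskRange m) : mask m l r = 0 := by
  rw [mask]
  by_cases h : 0 ≤ r + ((m / 2 : ℕ) : ℤ)
  · rw [if_pos h, Polynomial.coeff_eq_zero_of_natDegree_lt, mul_zero]
    refine (natDegree_maskPoly_le hl).trans_lt ?_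
    simp only [maskRange, Finset.mem_Icc, not_and_or, not_le] at hr
    omega
  · rw [if_neg h]

/-- The two extreme coefficients of the low-pass mask are the end coefficients of `(1 + X)^m`. They
turn membership in `indexK` into a distance from the boundary. -/
theorem mask_zero_left_ne_zero (m : ℕ) : mask m 0 (-((m / 2 : ℕ) : ℤ)) ≠ 0 := by
  simp [mask, Polynomial.coeff_zero_eq_eval_zero]

theorem mask_zero_right_ne_zero (m : ℕ) : mask m 0 (m - ((m / 2 : ℕ) : ℤ)) ≠ 0 := by
  simp [mask, Polynomial.coeff_one_add_X_pow]

/-- The filter `g ↦ ∑_r q_l[r] g(· - r)`. -/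
def maskOp (m l : ℕ) (g : ℝ → ℝ) (z : ℝ) : ℝ := ∑ r ∈ maskRange m, mask m l r * g (z - r)

/-- The operator taking `g` to the compactly supported function whose `l`-th derivative is
`∑_r q_l[r] g(· - r)`. -/
def liftOp (m l : ℕ) (g : ℝ → ℝ) (z : ℝ) : ℝ :=
  maskConst m l * (winInt^[l] (((1 + shift) ^ (m - l)) g)) (z + (m / 2 : ℕ))

/-- The generating polynomial of the mask, evaluated at the shift operator and translated by
`⌊m/2⌋`, is the filter. -/
theorem maskOp_eq {m l : ℕ} (hl : l ≤ m) (g : ℝ → ℝ) (z : ℝ) :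
    maskOp m l g z =
      maskConst m l * ((1 - shift) ^ l) (((1 + shift) ^ (m - l)) g) (z + (m / 2 : ℕ)) := by
  have h1 : (1 - shift) ^ l * (1 + shift) ^ (m - l) =
      ∑ i ∈ Finset.range (m + 1),
        ((1 - Polynomial.X) ^ l * (1 + Polynomial.X) ^ (m - l) : ℝ[X]).coeff i • shift ^ i := by
    rw [← Polynomial.aeval_eq_sum_range' (Nat.lt_succ_of_le (natDegree_maskPoly_le hl))]
    simp
  rw [← Module.End.mul_apply, h1, LinearMap.sum_apply, Finset.sum_apply, Finset.mul_sum, maskOp]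
  refine Finset.sum_nbij' (fun r => (r + (m / 2 : ℕ)).toNat) (fun i => (i : ℤ) - (m / 2 : ℕ))
    ?_ ?_ ?_ ?_ ?_
  · intro r hr
    simp only [maskRange, Finset.mem_Icc, Finset.mem_range] at hr ⊢
    omega
  · intro i hi
    simp only [maskRange, Finset.mem_Icc, Finset.mem_range] at hi ⊢
    omega
  · intro r hr
    simp only [maskRange, Finset.mem_Icc] at hr
    omega
  · intro i hi
    simp
  · intro r hr
    have hr' : 0 ≤ r + (m / 2 : ℕ) := by
      simp only [maskRange, Finset.mem_Icc] at hr
      omega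
    have hc : (((r + (m / 2 : ℕ)).toNat : ℕ) : ℝ) = (r : ℝ) + (m / 2 : ℕ) := by
      have : (((r + (m / 2 : ℕ)).toNat : ℕ) : ℤ) = r + (m / 2 : ℕ) := Int.toNat_of_nonneg hr'
      rw [← Int.cast_natCast (R := ℝ), this, Int.cast_add, Int.cast_natCast]
    rw [LinearMap.smul_apply, Pi.smul_apply, smul_eq_mul, shift_pow_apply, hc, mask, if_pos hr',
      maskConst, mul_assoc]
    congr 3
    ring

/-- The factors `1 + shift` widen the support by `m - l` and the window integrals by `l`, so the
total growth is `m` for every band. -/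
theorem IsKernel.liftOp {L R : ℝ} {g : ℝ → ℝ} (h : IsKernel L R g) {m l : ℕ} (hl : l ≤ m) :
    IsKernel (L - (m / 2 : ℕ)) (R + (m - (m / 2 : ℕ))) (liftOp m l g) := by
  have := (((h.one_add_shift_pow (m - l)).winInt_iterate l).translate (m / 2 : ℕ)).const_mul
    (maskConst m l)
  refine this.mono le_rfl ?_
  rw [Nat.cast_sub hl]
  linarith

/-- Window integrals preserve the mean and each `1 + shift` doubles it. Unlike the framelet, the
lifted kernel thus has nonzero mean, so the constants `c_b` and `c_ab` can be inverted. -/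
theorem IsKernel.integral_liftOp {L R : ℝ} {g : ℝ → ℝ} (h : IsKernel L R g) (m l : ℕ) :
    ∫ x, WaveletFrame.liftOp m l g x = maskConst m l * 2 ^ (m - l) * ∫ x, g x := by
  simp only [WaveletFrame.liftOp]
  rw [integral_const_mul, integral_add_right_eq_self,
    (h.one_add_shift_pow (m - l)).integral_winInt_iterate, h.integral_one_add_shift_pow, mul_assoc]

theorem IsKernel.integral_liftOp_ne_zero {L R : ℝ} {g : ℝ → ℝ} (h : IsKernel L R g) {m l : ℕ}
    (hl : l ≤ m) (hg : ∫ x, g x ≠ 0) : ∫ x, WaveletFrame.liftOp m l g x ≠ 0 := by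
  rw [h.integral_liftOp]
  exact mul_ne_zero (mul_ne_zero (maskConst_ne_zero hl) (by positivity)) hg

theorem IsKernel.primitive_maskOp {L R : ℝ} {g : ℝ → ℝ} (h : IsKernel L R g) {m l : ℕ}
    (hl : l ≤ m) (c : ℝ) {lam : ℝ} (hlam : 0 < lam) :
    primitive^[l] (fun x => c * maskOp m l g (lam * x)) =
      fun x => c * lam⁻¹ ^ l * WaveletFrame.liftOp m l g (lam * x) := by
  have h1 := (h.one_add_shift_pow (m - l)).primitive_iterate l (c * maskConst m l) hlam (m / 2 : ℕ)
  simp_rw [maskOp_eq hl, ← mul_assoc]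
  rw [h1]
  funext x
  rw [WaveletFrame.liftOp]
  ring

theorem tsum_mask {m l : ℕ} (hl : l ≤ m) (g : ℤ → ℝ) :
    ∑' r : ℤ, mask m l r * g r = ∑ r ∈ maskRange m, mask m l r * g r :=
  tsum_eq_sum fun r hr => by rw [mask_eq_zero hl hr, zero_mul]

theorem varphi_eq {m l : ℕ} (hm : 1 ≤ m) (hl : l ≤ m) (x : ℝ) :
    varphi m l x = 2 * 2⁻¹ ^ l * liftOp m l (bspline m) (2 * x) := by
  have h1 : framelet m l = fun x => 2 * maskOp m l (bspline m) (2 * x) := by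
    funext x
    rw [framelet, tsum_mask hl fun r => bspline m (2 * x - r), maskOp]
  rw [varphi, h1, (isKernel_bspline hm).primitive_maskOp hl 2 two_pos]

theorem varphiPair_eq {m a b : ℕ} (hm : 1 ≤ m) (ha : a ≤ m) (hb : b ≤ m) (x : ℝ) :
    varphiPair m a b x =
      2 * (2 * 2⁻¹ ^ b) * 4⁻¹ ^ a * liftOp m a (liftOp m b (bspline m)) (4 * x) := by
  have h1 : (fun z => 2 * ∑' r : ℤ, mask m a r * varphi m b (2 * z - r / 2)) =
      fun z => 2 * (2 * 2⁻¹ ^ b) * maskOp m a (liftOp m b (bspline m)) (4 * z) := by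
    funext z
    rw [tsum_mask ha fun r => varphi m b (2 * z - r / 2), maskOp, mul_assoc 2]
    congr 1
    rw [Finset.mul_sum]
    refine Finset.sum_congr rfl fun r _ => ?_
    -- The half-integer translates of `varphi` become integer translates at scale 4, so the filter
    -- acts again as `maskOp`.
    rw [varphi_eq hm hb, show 2 * (2 * z - (r : ℝ) / 2) = 4 * z - r by ring]
    ring
  rw [varphiPair, h1, ((isKernel_bspline hm).liftOp hb).primitive_maskOp ha _ four_pos]

theorem integral_varphi {m l : ℕ} (hm : 1 ≤ m) (hl : l ≤ m) :
    ∫ x, varphi m l x = 2⁻¹ ^ l * ∫ x, liftOp m l (bspline m) x := by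
  simp_rw [varphi_eq hm hl]
  rw [integral_const_mul, Measure.integral_comp_mul_left (liftOp m l (bspline m)) 2,
    abs_of_pos (by norm_num), smul_eq_mul]
  ring

theorem integral_varphiPair {m a b : ℕ} (hm : 1 ≤ m) (ha : a ≤ m) (hb : b ≤ m) :
    ∫ x, varphiPair m a b x =
      2⁻¹ ^ b * 4⁻¹ ^ a * ∫ x, liftOp m a (liftOp m b (bspline m)) x := by
  simp_rw [varphiPair_eq hm ha hb]
  rw [integral_const_mul, Measure.integral_comp_mul_left (liftOp m a (liftOp m b (bspline m))) 4,
    abs_of_pos (by norm_num), smul_eq_mul]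
  ring

theorem integral_tensor (f g : ℝ → ℝ) :
    ∫ x, tensor f g x = (∫ x, f x) * ∫ x, g x :=
  integral_prod_mul f g

theorem cst_eq {m : ℕ} (hm : 1 ≤ m) {b : ℕ × ℕ} (hb : b.1 ≤ m ∧ b.2 ≤ m) :
    cst m b = 2⁻¹ ^ order b *
      ((∫ x, liftOp m b.1 (bspline m) x) * ∫ x, liftOp m b.2 (bspline m) x) := by
  simp only [cst, varphi₂]
  rw [integral_tensor, integral_varphi hm hb.1, integral_varphi hm hb.2, order, pow_add]
  ring

theorem cstPair_eq {m : ℕ} (hm : 1 ≤ m) {a b : ℕ × ℕ} (ha : a.1 ≤ m ∧ a.2 ≤ m)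
    (hb : b.1 ≤ m ∧ b.2 ≤ m) :
    cstPair m a b = (cst m b)⁻¹ * (2⁻¹ ^ order b * 4⁻¹ ^ order a *
      ((∫ x, liftOp m a.1 (liftOp m b.1 (bspline m)) x) *
        ∫ x, liftOp m a.2 (liftOp m b.2 (bspline m)) x)) := by
  simp only [cstPair, varphiPair₂]
  rw [integral_const_mul, integral_tensor, integral_varphiPair hm ha.1 hb.1,
    integral_varphiPair hm ha.2 hb.2, order, order, pow_add, pow_add]
  ring

/-! ### Integration by parts against non-smooth tensor-product kernels -/

/-- Uniformly bounded almost everywhere convergence. -/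
structure BddTendsto (g : ℕ → ℝ → ℝ) (G : ℝ → ℝ) : Prop where
  bdd : ∃ M, ∀ i x, |g i x| ≤ M
  tendsto : ∀ᵐ x, Tendsto (fun i => g i x) atTop (𝓝 (G x))

namespace BddTendsto

variable {g : ℕ → ℝ → ℝ} {G : ℝ → ℝ}

theorem const {g : ℝ → ℝ} (h : ∃ M, ∀ x, |g x| ≤ M) : BddTendsto (fun _ => g) g :=
  ⟨h.imp fun _ hM _ => hM, Eventually.of_forall fun _ => tendsto_const_nhds⟩

theorem const_mul (h : BddTendsto g G) (c : ℝ) :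
    BddTendsto (fun i x => c * g i x) (fun x => c * G x) := by
  obtain ⟨M, hM⟩ := h.bdd
  refine ⟨⟨|c| * M, fun i x => ?_⟩, h.tendsto.mono fun x hx => hx.const_mul c⟩
  rw [abs_mul]
  exact mul_le_mul_of_nonneg_left (hM i x) (abs_nonneg c)

/-- An affine map with nonzero slope pulls null sets back to null sets. -/
theorem comp_affine (h : BddTendsto g G) {a : ℝ} (ha : a ≠ 0) (b : ℝ) :
    BddTendsto (fun i x => g i (a * x + b)) (fun x => G (a * x + b)) := by
  obtain ⟨M, hM⟩ := h.bdd
  refine ⟨⟨M, fun i x => hM i _⟩, ?_⟩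
  have h1 : Measure.QuasiMeasurePreserving (fun x : ℝ => a * x) volume volume := by
    refine ⟨measurable_const_mul a, ?_⟩
    rw [Real.map_volume_mul_left ha]
    exact Measure.smul_absolutelyContinuous
  have h2 : Measure.QuasiMeasurePreserving (fun x : ℝ => x + b) volume volume :=
    (measurePreserving_add_right volume b).quasiMeasurePreserving
  exact (h2.comp h1).ae h.tendsto

theorem one_sub_shift_pow (h : BddTendsto g G) (l : ℕ) :
    BddTendsto (fun i => ((1 - shift) ^ l) (g i)) (((1 - shift) ^ l) G) := by
  induction l with
  | zero => simpa using h
  | succ l ih =>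
    simp_rw [pow_succ', Module.End.mul_apply]
    obtain ⟨M, hM⟩ := ih.bdd
    have h2 := ih.comp_affine one_ne_zero (-1)
    refine ⟨⟨M + M, fun i x => (abs_sub _ _).trans (add_le_add (hM i x) (hM i _))⟩, ?_⟩
    filter_upwards [ih.tendsto, h2.tendsto] with x hx hx2
    simp only [one_mul, ← sub_eq_add_neg] at hx2
    exact hx.sub hx2

theorem winInt (h : BddTendsto g G) (hm : ∀ i, Measurable (g i)) :
    BddTendsto (fun i => winInt (g i)) (winInt G) := by
  obtain ⟨M, hM⟩ := h.bdd
  refine ⟨⟨M, fun i x => abs_winInt_le (hM i) x⟩, Eventually.of_forall fun x => ?_⟩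
  refine intervalIntegral.tendsto_integral_filter_of_dominated_convergence (fun _ => M)
    (Eventually.of_forall fun i => (hm i).aestronglyMeasurable)
    (Eventually.of_forall fun i => Eventually.of_forall fun t _ => hM i t) (by simp) ?_
  filter_upwards [h.tendsto] with t ht _ using ht

end BddTendsto

/-! ### Derivatives of window integrals and smooth approximation of kernels. -/

theorem hasDerivAt_winInt {g : ℝ → ℝ} (h : Continuous g) (x : ℝ) :
    HasDerivAt (winInt g) (((1 - shift) g) x) x := by
  have h1 : winInt g = fun x => (∫ t in (0 : ℝ)..x, g t) - ∫ t in (0 : ℝ)..(x - 1), g t := by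
    funext x
    rw [winInt, intervalIntegral.integral_interval_sub_left] <;> exact h.intervalIntegrable _ _
  have h2 : ∀ y, HasDerivAt (fun y => ∫ t in (0 : ℝ)..y, g t) (g y) y := fun y =>
    intervalIntegral.integral_hasDerivAt_right (h.intervalIntegrable _ _)
      h.stronglyMeasurable.stronglyMeasurableAtFilter h.continuousAt
  rw [h1]
  exact (h2 x).sub ((h2 (x - 1)).comp_sub_const x 1)

theorem deriv_winInt {g : ℝ → ℝ} (h : Continuous g) : deriv (winInt g) = (1 - shift) g :=
  funext fun x => (hasDerivAt_winInt h x).deriv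

theorem contDiff_one_sub_shift {g : ℝ → ℝ} (h : ContDiff ℝ ∞ g) :
    ContDiff ℝ ∞ ((1 - shift) g) :=
  h.sub (h.comp (contDiff_id.sub contDiff_const))

theorem contDiff_one_sub_shift_pow {g : ℝ → ℝ} (h : ContDiff ℝ ∞ g) (l : ℕ) :
    ContDiff ℝ ∞ (((1 - shift) ^ l) g) := by
  induction l with
  | zero => simpa using h
  | succ l ih =>
    rw [pow_succ', Module.End.mul_apply]
    exact contDiff_one_sub_shift ih

theorem contDiff_winInt {g : ℝ → ℝ} (h : ContDiff ℝ ∞ g) : ContDiff ℝ ∞ (winInt g) := by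
  rw [contDiff_infty_iff_deriv, deriv_winInt h.continuous]
  exact ⟨fun x => (hasDerivAt_winInt h.continuous x).differentiableAt, contDiff_one_sub_shift h⟩

theorem contDiff_winInt_iterate {g : ℝ → ℝ} (h : ContDiff ℝ ∞ g) (l : ℕ) :
    ContDiff ℝ ∞ (winInt^[l] g) := by
  induction l with
  | zero => exact h
  | succ l ih =>
    rw [Function.iterate_succ_apply']
    exact contDiff_winInt ih

/-- Differential counterpart of `IsKernel.primitive_iterate`: each derivative exchanges one window
integral for a factor `1 - shift`. -/
theorem deriv_iterate_winInt_iterate {g : ℝ → ℝ} (h : ContDiff ℝ ∞ g) (l : ℕ) :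
    deriv^[l] (winInt^[l] g) = ((1 - shift) ^ l) g := by
  induction l generalizing g with
  | zero => simp
  | succ l ih =>
    rw [Function.iterate_succ_apply', Function.iterate_succ_apply, ih (contDiff_winInt h),
      ← winInt_one_sub_shift_pow fun a b => h.continuous.intervalIntegrable a b,
      deriv_winInt (contDiff_one_sub_shift_pow h l).continuous, pow_succ', Module.End.mul_apply]

theorem deriv_iterate_comp_affine {g : ℝ → ℝ} (h : ContDiff ℝ ∞ g) (l : ℕ) (c a b : ℝ) :
    deriv^[l] (fun x => c * g (a * x + b)) = fun x => c * a ^ l * (deriv^[l] g) (a * x + b) := by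
  induction l with
  | zero => simp
  | succ l ih =>
    rw [Function.iterate_succ_apply', ih, Function.iterate_succ_apply']
    funext x
    have h1 : HasDerivAt (fun x : ℝ => a * x + b) a x := by
      simpa using ((hasDerivAt_id x).const_mul a).add_const b
    have h2 : HasDerivAt (deriv^[l] g) (deriv (deriv^[l] g) (a * x + b)) (a * x + b) :=
      ((h.iterate_deriv l).differentiable (by simp) _).hasDerivAt
    refine ((h2.comp x h1).const_mul (c * a ^ l)).deriv.trans ?_
    ring

/-- Mollify `G`, then multiply by smooth cutoffs whose plateaus exhaust `(L, R)`. Mollification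
alone would enlarge the support; the cutoff pushes it strictly inside, as is needed when the scaled
kernel just fits in the closed square. -/
theorem IsKernel.exists_smooth_approx {L R : ℝ} {G : ℝ → ℝ} (h : IsKernel L R G) (hLR : L < R) :
    ∃ g : ℕ → ℝ → ℝ, (∀ i, ContDiff ℝ ∞ (g i)) ∧
      (∀ i, ∃ δ > 0, IsKernel (L + δ) (R - δ) (g i)) ∧ BddTendsto g G := by
  obtain ⟨M, hM⟩ := h.bdd
  set c := (L + R) / 2 with hc
  set ρ := (R - L) / 2 with hρ
  have hρ0 : 0 < ρ := by simp only [hρ]; linarith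
  -- The offset 3 keeps the inner radius `ρ (1 - 2/(i + 3))` positive already at `i = 0`.
  have hi : ∀ i : ℕ, 0 < (1 : ℝ) / (i + 3) ∧ (1 : ℝ) / (i + 3) ≤ 1 / 3 := fun i =>
    ⟨by positivity, by apply one_div_le_one_div_of_le <;> linarith [i.cast_nonneg (α := ℝ)]⟩
  let χ : ℕ → ContDiffBump c := fun i =>
    { rIn := ρ * (1 - 2 * (1 / (i + 3)))
      rOut := ρ * (1 - 1 / (i + 3))
      rIn_pos := mul_pos hρ0 (by linarith [(hi i).2])
      rIn_lt_rOut := mul_lt_mul_of_pos_left (by linarith [(hi i).1]) hρ0 }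
  -- The ratio of the radii is fixed at 2, the condition under which Lebesgue differentiation gives
  -- almost everywhere convergence of the mollifications.
  let θ : ℕ → ContDiffBump (0 : ℝ) := fun i =>
    { rIn := 1 / (i + 1)
      rOut := 2 * (1 / (i + 1))
      rIn_pos := by positivity
      rIn_lt_rOut := by linarith [show 0 < (1 : ℝ) / (i + 1) by positivity] }
  set conv : ℕ → ℝ → ℝ := fun i =>
    convolution ((θ i).normed volume) G (ContinuousLinearMap.lsmul ℝ ℝ) volume
  have hbd : ∀ i x, |conv i x| ≤ M := by
    intro i x
    have h1 : ‖∫ t, (θ i).normed volume t • G (x - t)‖ ≤ ∫ t, (θ i).normed volume t * M := by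
      refine norm_integral_le_of_norm_le ((θ i).integrable_normed.mul_const M)
        (Eventually.of_forall fun t => ?_)
      rw [norm_smul, Real.norm_of_nonneg ((θ i).nonneg_normed t)]
      exact mul_le_mul_of_nonneg_left (hM _) ((θ i).nonneg_normed t)
    rwa [integral_mul_const, (θ i).integral_normed, one_mul] at h1
  have hsm : ∀ i, ContDiff ℝ ∞ (conv i) := fun i =>
    (θ i).hasCompactSupport_normed.contDiff_convolution_left _ (θ i).contDiff_normed
      h.integrable.locallyIntegrable
  have hχ1 : ∀ i x, |χ i x| ≤ 1 := fun i x => by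
    rw [abs_of_nonneg (χ i).nonneg]
    exact (χ i).le_one
  have hbd' : ∀ i x, |χ i x * conv i x| ≤ M := fun i x => by
    rw [abs_mul]
    calc _ ≤ 1 * M := mul_le_mul (hχ1 i x) (hbd i x) (abs_nonneg _) zero_le_one
      _ = M := one_mul M
  refine ⟨fun i x => χ i x * conv i x, fun i => (χ i).contDiff.mul (hsm i), fun i => ?_,
    ⟨M, hbd'⟩, ?_⟩
  · refine ⟨ρ * (1 / (i + 3)), mul_pos hρ0 (hi i).1,
      ((χ i).contDiff.mul (hsm i)).continuous.measurable, ⟨M, hbd' i⟩, fun x hx => ?_⟩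
    change χ i x * conv i x = 0
    rw [(χ i).zero_of_le_dist, zero_mul]
    by_contra hlt
    refine hx ?_
    rw [not_le, Real.dist_eq, abs_lt] at hlt
    change -(ρ * (1 - 1 / (i + 3))) < x - c ∧ x - c < ρ * (1 - 1 / (i + 3)) at hlt
    rw [mul_sub, mul_one] at hlt
    constructor <;> simp only [hc, hρ] at hlt ⊢ <;> linarith [hlt.1, hlt.2]
  · have hlim : Tendsto (fun i : ℕ => (1 : ℝ) / (i + 1)) atTop (𝓝 0) :=
      tendsto_one_div_add_atTop_nhds_zero_nat
    have hae := ContDiffBump.ae_convolution_tendsto_right_of_locallyIntegrable (μ := volume)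
      (φ := θ) (l := atTop) (K := 2) (g := G)
      (by simpa [θ] using hlim.const_mul 2)
      (Eventually.of_forall fun i => le_rfl) h.integrable.locallyIntegrable
    -- All cutoffs vanish at the endpoints, where `G` need not; two points are negligible.
    have hL : ∀ᵐ x : ℝ, x ≠ L := by simp [ae_iff]
    have hR : ∀ᵐ x : ℝ, x ≠ R := by simp [ae_iff]
    filter_upwards [hae, hL, hR] with x hx hxL hxR
    by_cases hmem : x ∈ Set.Icc L R
    · have hlt : |x - c| < ρ := by
        have h1 := lt_of_le_of_ne hmem.1 hxL.symm
        have h2 := lt_of_le_of_ne hmem.2 hxR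
        rw [abs_lt]
        constructor <;> simp only [hc, hρ] <;> linarith
      have hlim3 : Tendsto (fun i : ℕ => ρ * (1 - 2 * ((1 : ℝ) / (i + 3)))) atTop (𝓝 ρ) := by
        have h3 : Tendsto (fun i : ℕ => (1 : ℝ) / (i + 3)) atTop (𝓝 0) := by
          have := hlim.comp (tendsto_add_atTop_nat 2)
          refine this.congr fun i => ?_
          simp only [Function.comp_apply]
          push_cast
          ring_nf
        simpa using ((h3.const_mul 2).const_sub 1).const_mul ρ
      refine hx.congr' ?_
      filter_upwards [hlim3.eventually (eventually_gt_nhds hlt)] with i hi'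
      rw [(χ i).one_of_mem_closedBall, one_mul]
      rw [Metric.mem_closedBall, Real.dist_eq]
      exact hi'.le
    · have h0 : ∀ i, χ i x * conv i x = 0 := fun i => by
        rw [(χ i).zero_of_le_dist, zero_mul]
        by_contra hlt
        refine hmem ?_
        rw [not_le, Real.dist_eq, abs_lt] at hlt
        change -(ρ * (1 - 1 / (i + 3))) < x - c ∧ x - c < ρ * (1 - 1 / (i + 3)) at hlt
        have := mul_pos hρ0 (hi i).1
        rw [mul_sub, mul_one] at hlt
        constructor <;> simp only [hc, hρ] at hlt this ⊢ <;> linarith [hlt.1, hlt.2]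
      simp_rw [h0, h.supp x hmem]
      exact tendsto_const_nhds

/-- `F` and its `a`-th derivative `f` are limits of smooth functions compactly supported in
`(0,1)` and of their `a`-th derivatives. -/
def TestApprox (a : ℕ) (F f : ℝ → ℝ) : Prop :=
  ∃ η : ℕ → ℝ → ℝ, (∀ i, ContDiff ℝ ∞ (η i)) ∧ (∀ i, tsupport (η i) ⊆ Set.Ioo 0 1) ∧
    BddTendsto η F ∧ BddTendsto (fun i => deriv^[a] (η i)) f

/-- Smoothing is applied to `G` before the window integrals, so the `a`-th derivative of the
approximants is `(1 - shift)^a` of the smoothed kernel and remains bounded. The two inequalities say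
that the dilated support lies in `[0, 1]`. -/
theorem IsKernel.testApprox {L R : ℝ} {G : ℝ → ℝ} (h : IsKernel L R G) (hLR : L < R) (a : ℕ)
    (c : ℝ) {N d : ℝ} (hN : 0 < N) (h0 : 0 ≤ L - d) (h1 : R + a - d ≤ N) :
    TestApprox a (fun x => c * (WaveletFrame.winInt^[a] G) (N * x + d))
      (fun x => c * N ^ a * ((1 - WaveletFrame.shift) ^ a) G (N * x + d)) := by
  obtain ⟨g, hg1, hg2, hg3⟩ := h.exists_smooth_approx hLR
  have hwin : BddTendsto (fun i => WaveletFrame.winInt^[a] (g i)) (WaveletFrame.winInt^[a] G) := by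
    -- The support bound depends on `a` and would otherwise become a premise of the induction
    -- hypothesis.
    clear h1
    induction a with
    | zero => exact hg3
    | succ a ih =>
      simp_rw [Function.iterate_succ_apply']
      exact ih.winInt fun i => (contDiff_winInt_iterate (hg1 i) a).continuous.measurable
  have hsm := fun i => contDiff_winInt_iterate (hg1 i) a
  refine ⟨fun i x => c * (WaveletFrame.winInt^[a] (g i)) (N * x + d), fun i => ?_, fun i => ?_,
    (hwin.comp_affine hN.ne' d).const_mul c, ?_⟩
  · exact contDiff_const.mul ((hsm i).comp ((contDiff_const.mul contDiff_id).add contDiff_const))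
  · obtain ⟨δ, hδ, hk⟩ := hg2 i
    have hk' := hk.winInt_iterate a
    have hsub : tsupport (fun x => c * (WaveletFrame.winInt^[a] (g i)) (N * x + d)) ⊆
        Set.Icc ((L + δ - d) / N) ((R - δ + a - d) / N) := by
      refine closure_minimal (fun x hx => ?_) isClosed_Icc
      by_contra hx'
      refine hx ?_
      change c * _ = 0
      rw [hk'.supp, mul_zero]
      contrapose! hx'
      rw [Set.mem_Icc, div_le_iff₀ hN, le_div_iff₀ hN]
      exact ⟨by linarith [hx'.1], by linarith [hx'.2]⟩
    refine hsub.trans fun x hx => ⟨lt_of_lt_of_le (by apply div_pos <;> linarith) hx.1,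
      lt_of_le_of_lt hx.2 ((div_lt_one hN).2 (by linarith))⟩
  · have := ((hg3.one_sub_shift_pow a).comp_affine hN.ne' d).const_mul (c * N ^ a)
    convert this using 2 with i
    rw [deriv_iterate_comp_affine (hsm i), deriv_iterate_winInt_iterate (hg1 i)]

/-! ### Integration by parts against tensor products. -/

theorem contDiff_tensor {f g : ℝ → ℝ} (hf : ContDiff ℝ ∞ f) (hg : ContDiff ℝ ∞ g) :
    ContDiff ℝ ∞ (tensor f g) :=
  (hf.comp contDiff_fst).mul (hg.comp contDiff_snd)

theorem hasFDerivAt_tensor {f g : ℝ → ℝ} (hf : ContDiff ℝ ∞ f) (hg : ContDiff ℝ ∞ g)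
    (x : ℝ × ℝ) : HasFDerivAt (tensor f g)
      (f x.1 • (deriv g x.2 • ContinuousLinearMap.snd ℝ ℝ ℝ) +
        g x.2 • (deriv f x.1 • ContinuousLinearMap.fst ℝ ℝ ℝ)) x := by
  have h1 : HasDerivAt f (deriv f x.1) x.1 := (hf.differentiable (by simp) _).hasDerivAt
  have h2 : HasDerivAt g (deriv g x.2) x.2 := (hg.differentiable (by simp) _).hasDerivAt
  exact (h1.comp_hasFDerivAt x hasFDerivAt_fst).mul (h2.comp_hasFDerivAt x hasFDerivAt_snd)

theorem partialDeriv_tensor {f g : ℝ → ℝ} (hf : ContDiff ℝ ∞ f) (hg : ContDiff ℝ ∞ g)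
    (α : ℕ × ℕ) :
    partialDeriv α (tensor f g) = tensor (deriv^[α.1] f) (deriv^[α.2] g) := by
  have h2 : ∀ a, (fun (g : ℝ × ℝ → ℝ) x => fderiv ℝ g x (0, 1))^[a] (tensor f g) =
      tensor f (deriv^[a] g) := by
    intro a
    induction a with
    | zero => rfl
    | succ a ih =>
      rw [Function.iterate_succ_apply', Function.iterate_succ_apply', ih]
      funext x
      rw [(hasFDerivAt_tensor hf (hg.iterate_deriv a) x).fderiv]
      simp [tensor]
  have h1 : ∀ a, (fun (g : ℝ × ℝ → ℝ) x => fderiv ℝ g x (1, 0))^[a] (tensor f (deriv^[α.2] g)) =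
      tensor (deriv^[a] f) (deriv^[α.2] g) := by
    intro a
    induction a with
    | zero => rfl
    | succ a ih =>
      rw [Function.iterate_succ_apply', Function.iterate_succ_apply', ih]
      funext x
      rw [(hasFDerivAt_tensor (hf.iterate_deriv a) (hg.iterate_deriv α.2) x).fderiv]
      simp [tensor, mul_comm]
  rw [partialDeriv, h2, h1]

theorem tsupport_tensor_subset {f g : ℝ → ℝ} :
    tsupport (tensor f g) ⊆ tsupport f ×ˢ tsupport g := by
  refine closure_minimal (fun x hx => ?_) ((isClosed_tsupport f).prod (isClosed_tsupport g))
  have hx' : f x.1 * g x.2 ≠ 0 := hx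
  exact ⟨subset_tsupport f (left_ne_zero_of_mul hx'), subset_tsupport g (right_ne_zero_of_mul hx')⟩

/-- Dominated convergence; the exceptional null sets on each axis lift to null sets of the plane
through the coordinate projections. -/
theorem tendsto_integral_mul_tensor {u : ℝ × ℝ → ℝ} (hu : Integrable u volOmega)
    {η θ : ℕ → ℝ → ℝ} {F G : ℝ → ℝ} (h1 : BddTendsto η F) (h2 : BddTendsto θ G)
    (m1 : ∀ i, Measurable (η i)) (m2 : ∀ i, Measurable (θ i)) :
    Tendsto (fun i => ∫ x in Omega, u x * tensor (η i) (θ i) x) atTop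
      (𝓝 (∫ x in Omega, u x * tensor F G x)) := by
  obtain ⟨M, hM⟩ := h1.bdd
  obtain ⟨M', hM'⟩ := h2.bdd
  refine tendsto_integral_of_dominated_convergence (fun x => ‖u x‖ * (M * M')) (fun i => ?_)
    (hu.norm.mul_const _) (fun i => Eventually.of_forall fun x => ?_) ?_
  · exact hu.1.mul
      (((m1 i).comp measurable_fst).mul ((m2 i).comp measurable_snd)).aestronglyMeasurable
  · rw [norm_mul, tensor, norm_mul]
    gcongr
    · exact (abs_nonneg _).trans (hM i 0)
    · exact hM i _
    · exact hM' i _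
  · refine ae_restrict_of_ae ?_
    have e1 : ∀ᵐ x : ℝ × ℝ, Tendsto (fun i => η i x.1) atTop (𝓝 (F x.1)) :=
      Measure.quasiMeasurePreserving_fst.ae h1.tendsto
    have e2 : ∀ᵐ x : ℝ × ℝ, Tendsto (fun i => θ i x.2) atTop (𝓝 (G x.2)) :=
      Measure.quasiMeasurePreserving_snd.ae h2.tendsto
    filter_upwards [e1, e2] with x hx1 hx2
    exact (hx1.mul hx2).const_mul _

/-- The definition of the weak derivative applies to the smooth approximants, and both sides pass to
the limit. -/
theorem IsWeakDeriv.integral_tensor {α : ℕ × ℕ} {u g : ℝ × ℝ → ℝ} (h : IsWeakDeriv α u g)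
    (hu : Integrable u volOmega) (hg : Integrable g volOmega) {F₁ f₁ F₂ f₂ : ℝ → ℝ}
    (h₁ : TestApprox α.1 F₁ f₁) (h₂ : TestApprox α.2 F₂ f₂) :
    ∫ x in Omega, u x * tensor f₁ f₂ x =
      (-1) ^ order α * ∫ x in Omega, g x * tensor F₁ F₂ x := by
  obtain ⟨η, sη, tη, lη, dη⟩ := h₁
  obtain ⟨θ, sθ, tθ, lθ, dθ⟩ := h₂
  have e : ∀ i, ∫ x in Omega, u x * tensor (deriv^[α.1] (η i)) (deriv^[α.2] (θ i)) x =
      (-1) ^ order α * ∫ x in Omega, g x * tensor (η i) (θ i) x := by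
    intro i
    have hsub : tsupport (tensor (η i) (θ i)) ⊆ Omega :=
      tsupport_tensor_subset.trans (Set.prod_mono (tη i) (tθ i))
    have hc : HasCompactSupport (tensor (η i) (θ i)) := by
      refine HasCompactSupport.of_support_subset_isCompact
        (K := Set.Icc (0 : ℝ) 1 ×ˢ Set.Icc (0 : ℝ) 1) (isCompact_Icc.prod isCompact_Icc) ?_
      exact (subset_tsupport _).trans (hsub.trans
        (Set.prod_mono Set.Ioo_subset_Icc_self Set.Ioo_subset_Icc_self))
    rw [← partialDeriv_tensor (sη i) (sθ i)]
    exact h _ (contDiff_tensor (sη i) (sθ i)) hc hsub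
  refine tendsto_nhds_unique (tendsto_integral_mul_tensor hu dη dθ
    (fun i => ((sη i).iterate_deriv _).continuous.measurable)
    (fun i => ((sθ i).iterate_deriv _).continuous.measurable)) ?_
  simp_rw [e]
  exact (tendsto_integral_mul_tensor hg lη lθ (fun i => (sη i).continuous.measurable)
    (fun i => (sθ i).continuous.measurable)).const_mul _

/-! ### Local averages on dyadic grids -/

/-- The index of the dyadic cell of side `2^{-n}` containing `x`. -/
def cell (n : ℕ) (x : ℝ × ℝ) : ℤ × ℤ := (⌊2 ^ n * x.1⌋, ⌊2 ^ n * x.2⌋)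

theorem measurable_cell (n : ℕ) : Measurable (cell n) :=
  (Int.measurable_floor.comp (measurable_fst.const_mul _)).prodMk
    (Int.measurable_floor.comp (measurable_snd.const_mul _))

/-- The kernel `4^n κ(2^n · - k)`. -/
def scaled (κ : ℝ × ℝ → ℝ) (n : ℕ) (k : ℤ × ℤ) (y : ℝ × ℝ) : ℝ :=
  2 ^ n * 2 ^ n * κ (2 ^ n * y.1 - k.1, 2 ^ n * y.2 - k.2)

/-- The local average of `g` over `Ω` with respect to `4^n κ(2^n · - k)`. -/
def avg (κ : ℝ × ℝ → ℝ) (n : ℕ) (g : ℝ × ℝ → ℝ) (k : ℤ × ℤ) : ℝ :=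
  ∫ y in Omega, g y * scaled κ n k y

/-- The piecewise constant function with the values `a` on the cells indexed by `K`. -/
def stepFun (n : ℕ) (K : Set (ℤ × ℤ)) (a : ℤ × ℤ → ℝ) : ℝ × ℝ → ℝ :=
  (cell n ⁻¹' K).indicator fun x => a (cell n x)

theorem measurable_stepFun (n : ℕ) (K : Set (ℤ × ℤ)) (a : ℤ × ℤ → ℝ) :
    Measurable (stepFun n K a) :=
  ((measurable_of_countable a).comp (measurable_cell n)).indicator
    (measurable_cell n K.to_countable.measurableSet)

theorem norm_stepFun_le (n : ℕ) (K : Set (ℤ × ℤ)) (a : ℤ × ℤ → ℝ) (x : ℝ × ℝ) :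
    ‖stepFun n K a x‖ ≤ ‖a (cell n x)‖ :=
  norm_indicator_le_norm_self _ _

/-- Bounded kernels on the plane with bounded support and integral one. -/
structure IsAvgKernel (κ : ℝ × ℝ → ℝ) (M R : ℝ) : Prop where
  meas : Measurable κ
  bdd : ∀ z, |κ z| ≤ M
  supp : ∀ z, κ z ≠ 0 → |z.1| ≤ R ∧ |z.2| ≤ R
  integral_eq : ∫ z, κ z = 1

/-! ### Uniform `L_r` bound and pointwise convergence of averages. -/

theorem isOpen_Omega : IsOpen Omega := isOpen_Ioo.prod isOpen_Ioo

theorem measurableSet_Omega : MeasurableSet Omega := isOpen_Omega.measurableSet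

theorem volume_closedBall_prod (x : ℝ × ℝ) {ρ : ℝ} (hρ : 0 ≤ ρ) :
    volume (Metric.closedBall x ρ) = ENNReal.ofReal (4 * ρ ^ 2) := by
  rw [← closedBall_prod_same, Measure.volume_eq_prod, Measure.prod_prod, Real.volume_closedBall,
    Real.volume_closedBall, ← ENNReal.ofReal_mul (by positivity)]
  ring_nf

/-- Tonelli and the symmetry of the distance: each `y` is counted with the area of a ball, which is
a square of side `2ρ` in the sup metric. -/
theorem lintegral_lintegral_closedBall (μ : Measure (ℝ × ℝ)) [SFinite μ] {f : ℝ × ℝ → ℝ≥0∞}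
    (hf : AEMeasurable f μ) {ρ : ℝ} (hρ : 0 ≤ ρ) :
    ∫⁻ x, ∫⁻ y in Metric.closedBall x ρ, f y ∂μ = ENNReal.ofReal (4 * ρ ^ 2) * ∫⁻ y, f y ∂μ := by
  have hset : MeasurableSet {z : (ℝ × ℝ) × (ℝ × ℝ) | dist z.2 z.1 ≤ ρ} :=
    (isClosed_le (continuous_snd.dist continuous_fst) continuous_const).measurableSet
  have h1 : ∀ x : ℝ × ℝ, ∫⁻ y in Metric.closedBall x ρ, f y ∂μ =
      ∫⁻ y, {z : (ℝ × ℝ) × (ℝ × ℝ) | dist z.2 z.1 ≤ ρ}.indicator (fun z => f z.2) (x, y) ∂μ := by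
    intro x
    rw [← lintegral_indicator measurableSet_closedBall]
    rfl
  simp_rw [h1]
  rw [lintegral_lintegral_swap (f := fun x y => {z : (ℝ × ℝ) × (ℝ × ℝ) | dist z.2 z.1 ≤ ρ}.indicator
    (fun z => f z.2) (x, y)) ((hf.comp_snd).indicator hset), ← lintegral_const_mul' _ _ ENNReal.ofReal_ne_top]
  refine lintegral_congr fun y => ?_
  have h2 : ∀ x : ℝ × ℝ, {z : (ℝ × ℝ) × (ℝ × ℝ) | dist z.2 z.1 ≤ ρ}.indicator
      (fun z => f z.2) (x, y) = (Metric.closedBall y ρ).indicator (fun _ => f y) x := by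
    intro x
    simp only [Set.indicator, Set.mem_ofPred_eq, Metric.mem_closedBall, dist_comm y x]
  simp_rw [h2]
  rw [lintegral_indicator measurableSet_closedBall, setLIntegral_const, volume_closedBall_prod _ hρ,
    mul_comm]

theorem lintegral_rpow_closedBall_le (μ : Measure (ℝ × ℝ)) [SFinite μ] (hμ : μ ≤ volume)
    {g : ℝ × ℝ → ℝ} (hg : AEStronglyMeasurable g μ) {ρ : ℝ} (hρ : 0 < ρ) {r : ℝ} (hr : 1 ≤ r) :
    ∫⁻ x, (∫⁻ y in Metric.closedBall x ρ, ‖g y‖ₑ ∂μ) ^ r ≤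
      ENNReal.ofReal (4 * ρ ^ 2) ^ r * ∫⁻ y, ‖g y‖ₑ ^ r ∂μ := by
  have hr0 : 0 < r := by linarith
  set V := ENNReal.ofReal (4 * ρ ^ 2) with hV
  have hV0 : V ≠ 0 := by simp only [hV]; positivity
  have hVt : V ≠ ⊤ := ENNReal.ofReal_ne_top
  have key : ∀ x, (∫⁻ y in Metric.closedBall x ρ, ‖g y‖ₑ ∂μ) ^ r ≤
      V ^ (r - 1) * ∫⁻ y in Metric.closedBall x ρ, ‖g y‖ₑ ^ r ∂μ := by
    intro x
    -- Hölder on the ball: the `L_1` norm is at most the `L_r` norm times the measure to the power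
    -- `1 - 1/r`.
    have h1 := eLpNorm_le_eLpNorm_mul_rpow_measure_univ (p := 1) (q := ENNReal.ofReal r)
      (μ := μ.restrict (Metric.closedBall x ρ)) (f := g) (by simpa using hr) hg.restrict
    rw [eLpNorm_one_eq_lintegral_enorm, eLpNorm_eq_lintegral_rpow_enorm_toReal (by simpa using hr0)
      ENNReal.ofReal_ne_top, Measure.restrict_apply_univ, ENNReal.toReal_ofReal hr0.le,
      ENNReal.toReal_one] at h1
    have h2 := ENNReal.rpow_le_rpow h1 hr0.le
    rw [ENNReal.mul_rpow_of_nonneg _ _ hr0.le, ← ENNReal.rpow_mul, one_div_mul_cancel hr0.ne',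
      ENNReal.rpow_one, ← ENNReal.rpow_mul, mul_comm] at h2
    refine h2.trans ?_
    have h3 : (1 / 1 - 1 / r) * r = r - 1 := by field_simp
    rw [h3]
    gcongr
    exact (hμ _).trans (volume_closedBall_prod x hρ.le).le
  calc _ ≤ ∫⁻ x, V ^ (r - 1) * ∫⁻ y in Metric.closedBall x ρ, ‖g y‖ₑ ^ r ∂μ := lintegral_mono key
    _ = V ^ (r - 1) * (V * ∫⁻ y, ‖g y‖ₑ ^ r ∂μ) := by
      rw [lintegral_const_mul' _ _ (ENNReal.rpow_ne_top_of_nonneg (by linarith) hVt),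
        lintegral_lintegral_closedBall μ (hg.enorm.pow_const r) hρ.le]
    _ = V ^ r * ∫⁻ y, ‖g y‖ₑ ^ r ∂μ := by
      rw [← mul_assoc]
      congr 1
      conv_rhs => rw [show r = (r - 1) + 1 by ring, ENNReal.rpow_add _ _ hV0 hVt, ENNReal.rpow_one]

namespace IsAvgKernel

variable {κ : ℝ × ℝ → ℝ} {M R : ℝ}

theorem measurable_scaled (h : IsAvgKernel κ M R) (n : ℕ) (k : ℤ × ℤ) :
    Measurable (scaled κ n k) :=
  (h.meas.comp (((measurable_fst.const_mul _).sub_const _).prodMk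
    ((measurable_snd.const_mul _).sub_const _))).const_mul _

theorem nonneg_bound (h : IsAvgKernel κ M R) : 0 ≤ M := (abs_nonneg _).trans (h.bdd 0)

theorem nonneg_radius (h : IsAvgKernel κ M R) : 0 ≤ R := by
  by_contra hR
  have : κ = 0 := by
    funext z
    by_contra hz
    exact hR ((abs_nonneg _).trans (h.supp z hz).1)
  have h1 := h.integral_eq
  simp [this] at h1

theorem abs_scaled_le (h : IsAvgKernel κ M R) (n : ℕ) (k : ℤ × ℤ) (y : ℝ × ℝ) :
    |scaled κ n k y| ≤ 2 ^ n * 2 ^ n * M := by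
  rw [scaled, abs_mul, abs_of_nonneg (by positivity : (0 : ℝ) ≤ 2 ^ n * 2 ^ n)]
  exact mul_le_mul_of_nonneg_left (h.bdd _) (by positivity)

/-- The kernel attached to the cell of `x` is centred within one grid step of `x`, hence radius `R +
1` in units of `2^(-n)`. -/
theorem mem_closedBall_of_scaled_ne_zero (h : IsAvgKernel κ M R) {n : ℕ} {x y : ℝ × ℝ}
    (hy : scaled κ n (cell n x) y ≠ 0) : y ∈ Metric.closedBall x ((R + 1) / 2 ^ n) := by
  have hκ := h.supp _ (right_ne_zero_of_mul hy)
  have hp : (0 : ℝ) < 2 ^ n := by positivity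
  have key : ∀ a b : ℝ, |2 ^ n * b - (⌊2 ^ n * a⌋ : ℝ)| ≤ R → |b - a| ≤ (R + 1) / 2 ^ n := by
    intro a b hab
    have h1 := Int.floor_le (2 ^ n * a)
    have h2 := Int.lt_floor_add_one (2 ^ n * a)
    rw [abs_le] at hab
    rw [le_div_iff₀ hp, ← abs_of_pos hp, ← abs_mul, abs_le]
    constructor <;> linarith [hab.1, hab.2]
  rw [Metric.mem_closedBall, Prod.dist_eq, Real.dist_eq, Real.dist_eq]
  exact max_le (key _ _ hκ.1) (key _ _ hκ.2)

theorem integrable (h : IsAvgKernel κ M R) : Integrable κ := by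
  by_contra hc
  have := h.integral_eq
  rw [integral_undef hc] at this
  exact zero_ne_one this

theorem scaled_eq (κ : ℝ × ℝ → ℝ) (n : ℕ) (k : ℤ × ℤ) :
    scaled κ n k = fun y => 2 ^ n * 2 ^ n * (fun z => κ (z - ((k.1 : ℝ), (k.2 : ℝ))))
      ((2 ^ n : ℝ) • y) := rfl

theorem integral_scaled (κ : ℝ × ℝ → ℝ) (n : ℕ) (k : ℤ × ℤ) :
    ∫ y, scaled κ n k y = ∫ z, κ z := by
  rw [scaled_eq, integral_const_mul, Measure.integral_comp_smul volume
    (fun z => κ (z - ((k.1 : ℝ), (k.2 : ℝ)))) (2 ^ n), integral_sub_right_eq_self κ ((k.1 : ℝ), (k.2 : ℝ))]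
  have : (2 : ℝ) ^ n ≠ 0 := by positivity
  rw [Module.finrank_prod, Module.finrank_self, abs_of_nonneg (by positivity), smul_eq_mul]
  field_simp

theorem abs_integral_scaled (κ : ℝ × ℝ → ℝ) (n : ℕ) (k : ℤ × ℤ) :
    ∫ y, |scaled κ n k y| = ∫ z, |κ z| := by
  rw [← integral_scaled (fun z => |κ z|) n k]
  congr 1
  funext y
  rw [scaled, scaled, abs_mul, abs_of_nonneg (by positivity : (0 : ℝ) ≤ 2 ^ n * 2 ^ n)]

theorem integrable_scaled (h : IsAvgKernel κ M R) (n : ℕ) (k : ℤ × ℤ) :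
    Integrable (scaled κ n k) := by
  rw [scaled_eq]
  exact ((h.integrable.comp_sub_right ((k.1 : ℝ), (k.2 : ℝ))).comp_smul (by positivity)).const_mul _

theorem enorm_avg_le (h : IsAvgKernel κ M R) (n : ℕ) (g : ℝ × ℝ → ℝ) (x : ℝ × ℝ) :
    ‖avg κ n g (cell n x)‖ₑ ≤ ENNReal.ofReal (2 ^ n * 2 ^ n * M) *
      ∫⁻ y in Metric.closedBall x ((R + 1) / 2 ^ n), ‖g y‖ₑ ∂volOmega := by
  refine (enorm_integral_le_lintegral_enorm _).trans ?_
  rw [← lintegral_const_mul' _ _ ENNReal.ofReal_ne_top, ← lintegral_indicator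
    measurableSet_closedBall]
  refine lintegral_mono fun y => ?_
  by_cases hy : scaled κ n (cell n x) y = 0
  · simp [hy]
  · rw [Set.indicator_of_mem (h.mem_closedBall_of_scaled_ne_zero hy), enorm_mul, mul_comm]
    gcongr
    rw [Real.enorm_eq_ofReal_abs]
    exact ENNReal.ofReal_le_ofReal (h.abs_scaled_le n _ y)

/-- The height `4^n M` of the kernel cancels the area `4 (R + 1)^2 4^(-n)` of the ball, leaving a
bound independent of `n`. -/
theorem eLpNorm_avg_le (h : IsAvgKernel κ M R) (n : ℕ) {g : ℝ × ℝ → ℝ}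
    (hg : AEStronglyMeasurable g volOmega) {r : ℝ≥0∞} (hr : 1 ≤ r) (hr' : r ≠ ⊤) :
    eLpNorm (fun x => avg κ n g (cell n x)) r volOmega ≤
      ENNReal.ofReal (4 * (R + 1) ^ 2 * M) * eLpNorm g r volOmega := by
  have hr1 : 1 ≤ r.toReal := by
    rw [← ENNReal.toReal_one]
    exact ENNReal.toReal_mono hr' hr
  have hr0 : 0 < r.toReal := by linarith
  have hrn : r ≠ 0 := (zero_lt_one.trans_le hr).ne'
  have hp : (0 : ℝ) < 2 ^ n := by positivity
  have hρ : 0 < (R + 1) / 2 ^ n := div_pos (by linarith [h.nonneg_radius]) hp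
  have hM := h.nonneg_bound
  have h1 := lintegral_rpow_closedBall_le volOmega Measure.restrict_le_self hg hρ hr1
  have h2 : ∫⁻ x, ‖avg κ n g (cell n x)‖ₑ ^ r.toReal ∂volOmega ≤
      ENNReal.ofReal (4 * (R + 1) ^ 2 * M) ^ r.toReal * ∫⁻ y, ‖g y‖ₑ ^ r.toReal ∂volOmega := by
    calc _ ≤ ∫⁻ x, ‖avg κ n g (cell n x)‖ₑ ^ r.toReal :=
          lintegral_mono' Measure.restrict_le_self le_rfl
      _ ≤ ∫⁻ x, ENNReal.ofReal (2 ^ n * 2 ^ n * M) ^ r.toReal *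
          (∫⁻ y in Metric.closedBall x ((R + 1) / 2 ^ n), ‖g y‖ₑ ∂volOmega) ^ r.toReal := by
        refine lintegral_mono fun x => ?_
        rw [← ENNReal.mul_rpow_of_nonneg _ _ hr0.le]
        exact ENNReal.rpow_le_rpow (h.enorm_avg_le n g x) hr0.le
      _ ≤ ENNReal.ofReal (2 ^ n * 2 ^ n * M) ^ r.toReal *
          (ENNReal.ofReal (4 * ((R + 1) / 2 ^ n) ^ 2) ^ r.toReal *
            ∫⁻ y, ‖g y‖ₑ ^ r.toReal ∂volOmega) := by
        rw [lintegral_const_mul' _ _ (ENNReal.rpow_ne_top_of_nonneg hr0.le ENNReal.ofReal_ne_top)]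
        gcongr
      _ = _ := by
        rw [← mul_assoc, ← ENNReal.mul_rpow_of_nonneg _ _ hr0.le,
          ← ENNReal.ofReal_mul (by positivity)]
        congr 3
        field_simp
  rw [eLpNorm_eq_lintegral_rpow_enorm_toReal hrn hr', eLpNorm_eq_lintegral_rpow_enorm_toReal hrn hr']
  refine (ENNReal.rpow_le_rpow h2 (by positivity : 0 ≤ 1 / r.toReal)).trans ?_
  rw [ENNReal.mul_rpow_of_nonneg _ _ (by positivity), ← ENNReal.rpow_mul,
    mul_one_div_cancel hr0.ne', ENNReal.rpow_one]

theorem tendsto_avg (h : IsAvgKernel κ M R) {g : ℝ × ℝ → ℝ} (hg : Continuous g) {x : ℝ × ℝ}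
    (hx : x ∈ Omega) : Tendsto (fun n => avg κ n g (cell n x)) atTop (𝓝 (g x)) := by
  set I := ∫ z, |κ z| with hI
  have hI0 : 0 ≤ I := integral_nonneg fun z => abs_nonneg _
  rw [Metric.tendsto_atTop]
  intro ε hε
  -- The kernel may change sign, so its `L_1` norm `I` can exceed its integral 1; this tolerance
  -- absorbs it.
  have hε' : 0 < ε / (2 * (I + 1)) := by positivity
  obtain ⟨δ₁, hδ₁, hb₁⟩ := Metric.continuousAt_iff.1 hg.continuousAt _ hε'
  obtain ⟨δ₂, hδ₂, hb₂⟩ := Metric.isOpen_iff.1 isOpen_Omega x hx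
  have hlim : Tendsto (fun n : ℕ => (R + 1) / 2 ^ n) atTop (𝓝 0) := by
    have := (tendsto_pow_atTop_nhds_zero_of_lt_one (r := (2 : ℝ)⁻¹) (by norm_num)
      (by norm_num)).const_mul (R + 1)
    simpa [div_eq_mul_inv] using this
  obtain ⟨N, hN⟩ := eventually_atTop.1
    (hlim.eventually (eventually_lt_nhds (lt_min hδ₁ hδ₂)))
  refine ⟨N, fun n hn => ?_⟩
  have hρ := hN n hn
  have hz : ∀ y, scaled κ n (cell n x) y ≠ 0 → dist y x < δ₁ ∧ y ∈ Omega := fun y hy => by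
    have h1 := Metric.mem_closedBall.1 (h.mem_closedBall_of_scaled_ne_zero hy)
    have h2 := h1.trans_lt hρ
    exact ⟨h2.trans_le (min_le_left _ _), hb₂ (h2.trans_le (min_le_right _ _))⟩
  have e1 : avg κ n g (cell n x) = ∫ y, g y * scaled κ n (cell n x) y := by
    rw [avg, setIntegral_eq_integral_of_forall_compl_eq_zero]
    intro y hy
    by_contra hne
    exact hy (hz y (right_ne_zero_of_mul hne)).2
  have e2 : g x = ∫ y, g x * scaled κ n (cell n x) y := by
    rw [integral_const_mul, integral_scaled, h.integral_eq, mul_one]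
  have hbound : ∀ y, ‖(g y - g x) * scaled κ n (cell n x) y‖ ≤
      ε / (2 * (I + 1)) * |scaled κ n (cell n x) y| := by
    intro y
    by_cases hy : scaled κ n (cell n x) y = 0
    · simp [hy]
    · rw [norm_mul]
      exact mul_le_mul_of_nonneg_right (hb₁ (hz y hy).1).le (abs_nonneg _)
  have hsc := h.integrable_scaled n (cell n x)
  have hint2 : Integrable fun y => (g y - g x) * scaled κ n (cell n x) y :=
    (hsc.abs.const_mul (ε / (2 * (I + 1)))).mono'
      ((hg.sub continuous_const).aestronglyMeasurable.mul hsc.1) (Eventually.of_forall hbound)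
  have e3 : avg κ n g (cell n x) - g x = ∫ y, (g y - g x) * scaled κ n (cell n x) y := by
    have : Integrable fun y => g y * scaled κ n (cell n x) y := by
      refine (hint2.add (hsc.const_mul (g x))).congr (Eventually.of_forall fun y => ?_)
      simp only [Pi.add_apply]
      ring
    conv_lhs => rw [e1, e2]
    rw [← integral_sub this (hsc.const_mul _)]
    simp_rw [sub_mul]
  rw [Real.dist_eq, e3]
  calc _ ≤ ∫ y, ε / (2 * (I + 1)) * |scaled κ n (cell n x) y| :=
        norm_integral_le_of_norm_le (hsc.abs.const_mul _) (Eventually.of_forall hbound)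
    _ = ε * (I / (2 * (I + 1))) := by
      rw [integral_const_mul, abs_integral_scaled]
      ring
    _ < ε * 1 := by
      gcongr
      rw [div_lt_one (by positivity)]
      linarith
    _ = ε := mul_one ε

end IsAvgKernel

/-! ### Strong convergence of averages in `L_r`. -/

theorem tendsto_eLpNorm_zero_of_bdd {μ : Measure (ℝ × ℝ)} [IsFiniteMeasure μ]
    {F : ℕ → ℝ × ℝ → ℝ} (hF : ∀ n, AEStronglyMeasurable (F n) μ) {B : ℝ}
    (hB : ∀ n, ∀ᵐ x ∂μ, ‖F n x‖ ≤ B) (hlim : ∀ᵐ x ∂μ, Tendsto (fun n => F n x) atTop (𝓝 0))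
    {r : ℝ≥0∞} (hr : 1 ≤ r) (hr' : r ≠ ⊤) :
    Tendsto (fun n => eLpNorm (F n) r μ) atTop (𝓝 0) := by
  have hrn : r ≠ 0 := (zero_lt_one.trans_le hr).ne'
  have hr0 : 0 < r.toReal := ENNReal.toReal_pos hrn hr'
  simp_rw [eLpNorm_eq_lintegral_rpow_enorm_toReal hrn hr']
  have h0 : Tendsto (fun n => ∫⁻ x, ‖F n x‖ₑ ^ r.toReal ∂μ) atTop (𝓝 (∫⁻ _, 0 ∂μ)) := by
    refine tendsto_lintegral_of_dominated_convergence' (fun _ => ENNReal.ofReal B ^ r.toReal)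
      (fun n => (hF n).enorm.pow_const _) (fun n => ?_) ?_ ?_
    · filter_upwards [hB n] with x hx
      refine ENNReal.rpow_le_rpow ?_ hr0.le
      rw [← ofReal_norm]
      exact ENNReal.ofReal_le_ofReal hx
    · rw [lintegral_const]
      exact ENNReal.mul_ne_top (ENNReal.rpow_ne_top_of_nonneg hr0.le ENNReal.ofReal_ne_top)
        (measure_ne_top _ _)
    · filter_upwards [hlim] with x hx
      have h1 := (ENNReal.continuous_rpow_const (y := r.toReal)).continuousAt.tendsto.comp
        (hx.enorm)
      simpa [Function.comp_def, hr0] using h1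
  rw [lintegral_zero] at h0
  have h1 := (ENNReal.continuous_rpow_const (y := 1 / r.toReal)).continuousAt.tendsto.comp h0
  rw [ENNReal.zero_rpow_of_pos (by positivity)] at h1
  exact h1

theorem stepFun_sub (n : ℕ) (K : Set (ℤ × ℤ)) (a b : ℤ × ℤ → ℝ) :
    stepFun n K (a - b) = stepFun n K a - stepFun n K b := by
  rw [stepFun, stepFun, stepFun, ← Set.indicator_sub']
  rfl

namespace IsAvgKernel

variable {κ : ℝ × ℝ → ℝ} {M R : ℝ}

theorem integrable_mul_scaled (h : IsAvgKernel κ M R) (n : ℕ) (k : ℤ × ℤ) {g : ℝ × ℝ → ℝ}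
    (hg : Integrable g volOmega) : Integrable (fun y => g y * scaled κ n k y) volOmega :=
  hg.mul_bdd (h.measurable_scaled n k).aestronglyMeasurable
    (Eventually.of_forall fun y => h.abs_scaled_le n k y)

theorem avg_sub (h : IsAvgKernel κ M R) (n : ℕ) {f g : ℝ × ℝ → ℝ} (hf : Integrable f volOmega)
    (hg : Integrable g volOmega) : avg κ n (f - g) = avg κ n f - avg κ n g := by
  funext k
  rw [Pi.sub_apply, avg, avg, avg,
    ← integral_sub (h.integrable_mul_scaled n k hf) (h.integrable_mul_scaled n k hg)]
  simp [sub_mul]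

theorem eLpNorm_stepFun_avg_le (h : IsAvgKernel κ M R) (n : ℕ) (K : Set (ℤ × ℤ)) {g : ℝ × ℝ → ℝ}
    (hg : AEStronglyMeasurable g volOmega) {r : ℝ≥0∞} (hr : 1 ≤ r) (hr' : r ≠ ⊤) :
    eLpNorm (stepFun n K (avg κ n g)) r volOmega ≤
      ENNReal.ofReal (4 * (R + 1) ^ 2 * M) * eLpNorm g r volOmega :=
  (eLpNorm_mono (norm_stepFun_le n K _)).trans (h.eLpNorm_avg_le n hg hr hr')

theorem abs_avg_le (h : IsAvgKernel κ M R) (n : ℕ) (k : ℤ × ℤ) {g : ℝ × ℝ → ℝ} {H : ℝ}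
    (hH : ∀ x, ‖g x‖ ≤ H) : ‖avg κ n g k‖ ≤ H * ∫ z, |κ z| := by
  have hH0 : 0 ≤ H := (norm_nonneg _).trans (hH 0)
  have hsc := (h.integrable_scaled n k).abs.const_mul H
  calc _ ≤ ∫ y in Omega, H * |scaled κ n k y| := by
        refine norm_integral_le_of_norm_le hsc.integrableOn (Eventually.of_forall fun y => ?_)
        rw [norm_mul]
        exact mul_le_mul_of_nonneg_right (hH y) (abs_nonneg _)
    _ ≤ ∫ y, H * |scaled κ n k y| :=
      setIntegral_le_integral hsc (Eventually.of_forall fun y => mul_nonneg hH0 (abs_nonneg _))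
    _ = _ := by rw [integral_const_mul, abs_integral_scaled]

/-- Bounded convergence: every point of the square is eventually in a cell indexed by `K n`, and
there the average converges by continuity. -/
theorem tendsto_eLpNorm_stepFun_avg_sub_of_continuous (h : IsAvgKernel κ M R)
    {K : ℕ → Set (ℤ × ℤ)} (hK : ∀ x ∈ Omega, ∀ᶠ n in atTop, cell n x ∈ K n) {g : ℝ × ℝ → ℝ}
    (hg : Continuous g) (hc : HasCompactSupport g) {r : ℝ≥0∞} (hr : 1 ≤ r) (hr' : r ≠ ⊤) :
    Tendsto (fun n => eLpNorm (stepFun n (K n) (avg κ n g) - g) r volOmega) atTop (𝓝 0) := by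
  obtain ⟨H, hH⟩ := hg.bounded_above_of_compact_support hc
  refine tendsto_eLpNorm_zero_of_bdd (B := H * (∫ z, |κ z|) + H)
    (fun n => (measurable_stepFun _ _ _).aestronglyMeasurable.sub hg.aestronglyMeasurable)
    (fun n => Eventually.of_forall fun x => ?_) ?_ hr hr'
  · exact (norm_sub_le _ _).trans
      (add_le_add ((norm_stepFun_le _ _ _ _).trans (h.abs_avg_le n _ hH)) (hH x))
  · refine (ae_restrict_iff' measurableSet_Omega).2 (Eventually.of_forall fun x hx => ?_)
    have h1 := (h.tendsto_avg hg hx).sub_const (g x)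
    rw [sub_self] at h1
    refine h1.congr' ?_
    filter_upwards [hK x hx] with n hn
    rw [Pi.sub_apply, stepFun, Set.indicator_of_mem (Set.mem_preimage.2 hn)]

/-- Density of continuous compactly supported functions with the uniform operator bound `c`; an
approximation error is paid once directly and once through averaging, which is where `c + 1` comes
from. -/
theorem tendsto_eLpNorm_stepFun_avg_sub (h : IsAvgKernel κ M R)
    {K : ℕ → Set (ℤ × ℤ)} (hK : ∀ x ∈ Omega, ∀ᶠ n in atTop, cell n x ∈ K n) {g : ℝ × ℝ → ℝ}
    {r : ℝ≥0∞} (hg : MemLp g r volOmega) (hr : 1 ≤ r) (hr' : r ≠ ⊤) :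
    Tendsto (fun n => eLpNorm (stepFun n (K n) (avg κ n g) - g) r volOmega) atTop (𝓝 0) := by
  set c := ENNReal.ofReal (4 * (R + 1) ^ 2 * M) with hcdef
  rw [ENNReal.tendsto_nhds_zero]
  intro ε hε
  have hc1 : c + 1 ≠ 0 := by simp
  have hct : c + 1 ≠ ⊤ := by simp [hcdef]
  have hδ : ε / 2 / (c + 1) ≠ 0 :=
    (ENNReal.div_pos (ENNReal.div_pos hε.ne' (by simp)).ne' hct).ne'
  obtain ⟨f, hfc, hfδ, hf, hfm⟩ := hg.exists_hasCompactSupport_eLpNorm_sub_le hr' hδ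
  have h1 := h.tendsto_eLpNorm_stepFun_avg_sub_of_continuous hK hf hfc hr hr'
  rw [ENNReal.tendsto_nhds_zero] at h1
  filter_upwards [h1 (ε / 2) (ENNReal.div_pos hε.ne' (by simp))] with n hn
  have e : stepFun n (K n) (avg κ n g) - g =
      stepFun n (K n) (avg κ n (g - f)) + (stepFun n (K n) (avg κ n f) - f) + (f - g) := by
    rw [h.avg_sub n (hg.integrable hr) (hfm.integrable hr), stepFun_sub]
    abel
  have m1 : ∀ a, AEStronglyMeasurable (stepFun n (K n) a) volOmega := fun a =>
    (measurable_stepFun _ _ _).aestronglyMeasurable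
  rw [e]
  calc _ ≤ c * eLpNorm (g - f) r volOmega + ε / 2 + eLpNorm (g - f) r volOmega := by
        refine (eLpNorm_add_le ((m1 _).add ((m1 _).sub hfm.1)) (hfm.1.sub hg.1) hr).trans ?_
        refine add_le_add ((eLpNorm_add_le (m1 _) ((m1 _).sub hfm.1) hr).trans
          (add_le_add (h.eLpNorm_stepFun_avg_le n _ (hg.1.sub hfm.1) hr hr') hn)) ?_
        rw [eLpNorm_sub_comm]
    _ = (c + 1) * eLpNorm (g - f) r volOmega + ε / 2 := by ring
    _ ≤ (c + 1) * (ε / 2 / (c + 1)) + ε / 2 := by gcongr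
    _ = ε := by rw [ENNReal.mul_div_cancel hc1 hct, ENNReal.add_halves]

theorem tendsto_eLpNorm_stepFun_avg (h : IsAvgKernel κ M R)
    {K : ℕ → Set (ℤ × ℤ)} (hK : ∀ x ∈ Omega, ∀ᶠ n in atTop, cell n x ∈ K n)
    {r : ℝ≥0∞} (hr : 1 ≤ r) (hr' : r ≠ ⊤) {l : Filter ℕ} (hl : l ≤ atTop)
    {g : ℕ → ℝ × ℝ → ℝ} {G : ℝ × ℝ → ℝ} (hg : ∀ n, MemLp (g n) r volOmega)
    (hG : MemLp G r volOmega) (hlim : Tendsto (fun n => eLpNorm (g n - G) r volOmega) l (𝓝 0)) :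
    Tendsto (fun n => eLpNorm (stepFun n (K n) (avg κ n (g n)) - G) r volOmega) l (𝓝 0) := by
  have h1 := (h.tendsto_eLpNorm_stepFun_avg_sub hK hG hr hr').mono_left hl
  have h2 := (ENNReal.Tendsto.const_mul (a := ENNReal.ofReal (4 * (R + 1) ^ 2 * M)) hlim
    (Or.inr ENNReal.ofReal_ne_top)).add h1
  rw [mul_zero, add_zero] at h2
  refine tendsto_of_tendsto_of_tendsto_of_le_of_le tendsto_const_nhds h2 (fun _ => zero_le)
    fun n => ?_
  have e : stepFun n (K n) (avg κ n (g n)) - G =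
      stepFun n (K n) (avg κ n (g n - G)) + (stepFun n (K n) (avg κ n G) - G) := by
    rw [h.avg_sub n ((hg n).integrable hr) (hG.integrable hr), stepFun_sub]
    abel
  have m1 : ∀ a, AEStronglyMeasurable (stepFun n (K n) a) volOmega := fun a =>
    (measurable_stepFun _ _ _).aestronglyMeasurable
  change eLpNorm (stepFun n (K n) (avg κ n (g n)) - G) r volOmega ≤ _
  rw [e]
  exact (eLpNorm_add_le (m1 _) ((m1 _).sub hG.1) hr).trans
    (add_le_add (h.eLpNorm_stepFun_avg_le n _ ((hg n).1.sub hG.1) hr hr') le_rfl)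

end IsAvgKernel

/-! ### Discrete norms as norms of step functions -/

/-- The indices of the dyadic cells contained in `[0,1)²`. -/
def boxIndex (n : ℕ) : Set (ℤ × ℤ) := {k | 0 ≤ k.1 ∧ k.1 < 2 ^ n ∧ 0 ≤ k.2 ∧ k.2 < 2 ^ n}

theorem finite_boxIndex (n : ℕ) : (boxIndex n).Finite := by
  refine ((Set.finite_Ico (0 : ℤ) (2 ^ n)).prod (Set.finite_Ico (0 : ℤ) (2 ^ n))).subset ?_
  rintro k ⟨h1, h2, h3, h4⟩
  exact ⟨⟨h1, h2⟩, ⟨h3, h4⟩⟩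

theorem cell_mem_boxIndex {n : ℕ} {x : ℝ × ℝ} :
    cell n x ∈ boxIndex n ↔ x ∈ Set.Ico (0 : ℝ) 1 ×ˢ Set.Ico (0 : ℝ) 1 := by
  have hp : (0 : ℝ) < 2 ^ n := by positivity
  have key : ∀ a : ℝ, (0 ≤ ⌊2 ^ n * a⌋ ∧ ⌊2 ^ n * a⌋ < 2 ^ n) ↔ a ∈ Set.Ico (0 : ℝ) 1 := by
    intro a
    rw [Int.floor_nonneg, Int.floor_lt, Set.mem_Ico]
    push_cast
    rw [mul_nonneg_iff_of_pos_left hp, mul_lt_iff_lt_one_right hp]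
  rw [Set.mem_prod, ← key, ← key]
  exact and_assoc.symm

/-- Half-open squares are exact unions of dyadic cells; the difference from the open square is null.
-/
theorem volOmega_eq : volOmega = volume.restrict (Set.Ico (0 : ℝ) 1 ×ˢ Set.Ico (0 : ℝ) 1) := by
  refine Measure.restrict_congr_set ?_
  rw [Omega, Measure.volume_eq_prod]
  exact Measure.set_prod_ae_eq Ioo_ae_eq_Ico Ioo_ae_eq_Ico

theorem volume_cell_preimage (n : ℕ) (k : ℤ × ℤ) :
    volume (cell n ⁻¹' {k}) = ((2 : ℝ≥0∞) ^ (2 * n))⁻¹ := by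
  have hp : (0 : ℝ) < 2 ^ n := by positivity
  have h1 : cell n ⁻¹' {k} = Set.Ico ((k.1 : ℝ) / 2 ^ n) ((k.1 + 1) / 2 ^ n) ×ˢ
      Set.Ico ((k.2 : ℝ) / 2 ^ n) ((k.2 + 1) / 2 ^ n) := by
    ext x
    simp only [Set.mem_preimage, Set.mem_singleton_iff, cell, Prod.ext_iff, Int.floor_eq_iff,
      Set.mem_prod, Set.mem_Ico, div_le_iff₀ hp, lt_div_iff₀ hp, mul_comm]
  have h2 : ∀ a : ℝ, (a + 1) / 2 ^ n - a / 2 ^ n = ((2 : ℝ) ^ n)⁻¹ := fun a => by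
    rw [← sub_div, add_sub_cancel_left, one_div]
  rw [h1, Measure.volume_eq_prod, Measure.prod_prod, Real.volume_Ico, Real.volume_Ico, h2, h2,
    ENNReal.ofReal_inv_of_pos hp, ENNReal.ofReal_pow zero_le_two, two_mul, pow_add,
    ENNReal.mul_inv (by simp) (by simp)]
  simp

theorem lintegral_comp_cell (n : ℕ) (F : ℤ × ℤ → ℝ≥0∞) :
    ∫⁻ x, F (cell n x) = ((2 : ℝ≥0∞) ^ (2 * n))⁻¹ * ∑' k, F k := by
  rw [← lintegral_map (measurable_of_countable F) (measurable_cell n), lintegral_countable',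
    ← ENNReal.tsum_mul_left]
  congr 1
  funext k
  rw [Measure.map_apply (measurable_cell n) (measurableSet_singleton k), volume_cell_preimage,
    mul_comm]

/-- Each cell has area `2^(-2n)`, the weight in the discrete norm. The inclusion in `boxIndex n`
ensures that no indexed cell is cut off by the restriction to the square. -/
theorem discreteNorm_eq_eLpNorm {ι : Type} [Fintype ι] {n : ℕ} {K : Set (ℤ × ℤ)}
    (hK : K ⊆ boxIndex n) {r : ℝ≥0∞} (hr : 1 ≤ r) (hr' : r ≠ ⊤) (a : ι → ℤ × ℤ → ℝ) :
    discreteNorm n K r.toReal (fun i k => a i k) =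
      eLpNorm (fun x => WithLp.toLp 2 fun i => stepFun n K (a i) x) r volOmega := by
  have hrn : r ≠ 0 := (zero_lt_one.trans_le hr).ne'
  have hr0 : 0 < r.toReal := ENNReal.toReal_pos hrn hr'
  rw [eLpNorm_eq_lintegral_rpow_enorm_toReal hrn hr', discreteNorm]
  congr 1
  have e1 : ∀ x, ‖WithLp.toLp 2 fun i => stepFun n K (a i) x‖ₑ ^ r.toReal =
      K.indicator (fun k => ENNReal.ofReal ((∑ i, |a i k| ^ 2) ^ (r.toReal / 2))) (cell n x) := by
    intro x
    by_cases hx : cell n x ∈ K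
    · rw [Set.indicator_of_mem hx, ← ofReal_norm, EuclideanSpace.norm_eq, Real.sqrt_eq_rpow,
        ENNReal.ofReal_rpow_of_nonneg (by positivity) hr0.le, ← Real.rpow_mul (by positivity)]
      congr 2
      · refine Finset.sum_congr rfl fun i _ => ?_
        simp [stepFun, hx]
      · ring
    · rw [Set.indicator_of_notMem hx]
      have : (WithLp.toLp 2 fun i => stepFun n K (a i) x) = 0 := by
        ext i
        simp [stepFun, hx]
      rw [this, enorm_zero, ENNReal.zero_rpow_of_pos hr0]
  simp_rw [e1]
  rw [tsum_subtype K (fun k => ENNReal.ofReal ((∑ i, |a i k| ^ 2) ^ (r.toReal / 2))),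
    ← lintegral_comp_cell, volOmega_eq, setLIntegral_eq_of_support_subset]
  intro x hx
  by_contra hx'
  refine hx (Set.indicator_of_notMem (fun hx'' => hx' ?_) _)
  exact cell_mem_boxIndex.1 (hK hx'')

theorem continuumNorm_eq_eLpNorm {ι : Type} [Fintype ι] {r : ℝ≥0∞} (hr : 1 ≤ r) (hr' : r ≠ ⊤)
    (g : ι → ℝ × ℝ → ℝ) :
    continuumNorm r.toReal g = eLpNorm (fun x => WithLp.toLp 2 fun i => g i x) r volOmega := by
  have hrn : r ≠ 0 := (zero_lt_one.trans_le hr).ne'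
  have hr0 : 0 < r.toReal := ENNReal.toReal_pos hrn hr'
  rw [eLpNorm_eq_lintegral_rpow_enorm_toReal hrn hr', continuumNorm]
  congr 1
  refine lintegral_congr fun x => ?_
  rw [← ofReal_norm, EuclideanSpace.norm_eq, Real.sqrt_eq_rpow,
    ENNReal.ofReal_rpow_of_nonneg (by positivity) hr0.le, ← Real.rpow_mul (by positivity)]
  simp only [Real.norm_eq_abs]
  congr 2
  ring

theorem eLpNorm_toLp_le {ι : Type} [Fintype ι] {r : ℝ≥0∞} (hr : 1 ≤ r) {g : ι → ℝ × ℝ → ℝ}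
    (hg : ∀ i, AEStronglyMeasurable (g i) volOmega) :
    eLpNorm (fun x => WithLp.toLp 2 fun i => g i x) r volOmega ≤
      ∑ i, eLpNorm (g i) r volOmega := by
  have h1 : eLpNorm (fun x => WithLp.toLp 2 fun i => g i x) r volOmega ≤
      eLpNorm (∑ i, fun x => ‖g i x‖) r volOmega := by
    refine eLpNorm_mono fun x => ?_
    rw [EuclideanSpace.norm_eq, Finset.sum_apply,
      Real.norm_of_nonneg (Finset.sum_nonneg fun i _ => norm_nonneg _)]
    exact Real.sqrt_le_iff.2 ⟨Finset.sum_nonneg fun i _ => norm_nonneg _,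
      Finset.sum_sq_le_sq_sum_of_nonneg fun i _ => norm_nonneg _⟩
  refine h1.trans ((eLpNorm_sum_le (fun i _ => (hg i).norm) hr).trans ?_)
  exact Finset.sum_le_sum fun i _ => (eLpNorm_norm (g i)).le

theorem tendsto_eLpNorm_of_tendsto_eLpNorm_sub {E : Type*} [NormedAddCommGroup E]
    {r : ℝ≥0∞} (hr : 1 ≤ r) {l : Filter ℕ} {F : ℕ → ℝ × ℝ → E} {G : ℝ × ℝ → E}
    (hF : ∀ n, AEStronglyMeasurable (F n) volOmega) (hG : MemLp G r volOmega)
    (h : Tendsto (fun n => eLpNorm (F n - G) r volOmega) l (𝓝 0)) :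
    Tendsto (fun n => eLpNorm (F n) r volOmega) l (𝓝 (eLpNorm G r volOmega)) := by
  have h1 := ENNReal.Tendsto.sub (tendsto_const_nhds (x := eLpNorm G r volOmega) (f := l)) h
    (Or.inl hG.2.ne)
  have h2 := (tendsto_const_nhds (x := eLpNorm G r volOmega) (f := l)).add h
  rw [tsub_zero] at h1
  rw [add_zero] at h2
  refine tendsto_of_tendsto_of_tendsto_of_le_of_le h1 h2 (fun n => ?_) fun n => ?_
  · rw [tsub_le_iff_right]
    have e : G = F n - (F n - G) := by abel
    conv_lhs => rw [e]
    exact eLpNorm_sub_le (hF n) ((hF n).sub hG.1) hr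
  · have e : F n = G + (F n - G) := by abel
    conv_lhs => rw [e]
    exact eLpNorm_add_le hG.1 ((hF n).sub hG.1) hr

/-- Componentwise convergence suffices because the Euclidean norm is at most the sum of the absolute
values. -/
theorem tendsto_discreteNorm {ι : Type} [Fintype ι] {K : ℕ → Set (ℤ × ℤ)}
    (hK : ∀ n, K n ⊆ boxIndex n) {r : ℝ≥0∞} (hr : 1 ≤ r) (hr' : r ≠ ⊤) {l : Filter ℕ}
    {a : ℕ → ι → ℤ × ℤ → ℝ} {g : ι → ℝ × ℝ → ℝ} (hg : ∀ i, MemLp (g i) r volOmega)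
    (h : ∀ i, Tendsto (fun n => eLpNorm (stepFun n (K n) (a n i) - g i) r volOmega) l (𝓝 0)) :
    Tendsto (fun n => discreteNorm n (K n) r.toReal fun i k => a n i k) l
      (𝓝 (continuumNorm r.toReal g)) := by
  simp_rw [discreteNorm_eq_eLpNorm (hK _) hr hr', continuumNorm_eq_eLpNorm hr hr']
  have hm : ∀ f : ι → ℝ × ℝ → ℝ, (∀ i, AEStronglyMeasurable (f i) volOmega) →
      AEStronglyMeasurable (fun x => WithLp.toLp 2 fun i => f i x) volOmega := fun f hf =>
    (PiLp.continuous_toLp 2 _).comp_aestronglyMeasurable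
      (aemeasurable_pi_lambda _ fun i => (hf i).aemeasurable).aestronglyMeasurable
  have hs : ∀ n i, AEStronglyMeasurable (stepFun n (K n) (a n i)) volOmega := fun n i =>
    (measurable_stepFun _ _ _).aestronglyMeasurable
  refine tendsto_eLpNorm_of_tendsto_eLpNorm_sub hr (fun n => hm _ (hs n))
    ⟨hm _ fun i => (hg i).1, ?_⟩ ?_
  · refine (eLpNorm_toLp_le hr fun i => (hg i).1).trans_lt ?_
    exact ENNReal.sum_lt_top.2 fun i _ => (hg i).2
  · have h1 := tendsto_finsetSum Finset.univ fun i _ => h i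
    rw [Finset.sum_const_zero] at h1
    refine tendsto_of_tendsto_of_tendsto_of_le_of_le tendsto_const_nhds h1 (fun _ => zero_le)
      fun n => ?_
    exact eLpNorm_toLp_le hr fun i => (hs n i).sub (hg i).1

/-! ### The embedding of `W_1^1(Ω)` into `L_2(Ω)` -/

/-- A smooth bump with support in `(0,1)`. -/
def unitBump : ContDiffBump (1 / 2 : ℝ) where
  rIn := 1 / 8
  rOut := 1 / 4
  rIn_pos := by norm_num
  rIn_lt_rOut := by norm_num

/-- A smooth nonnegative function of integral one with support in `(0,1)`. -/
def unitMollifier : ℝ → ℝ := unitBump.normed volume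

theorem contDiff_unitMollifier : ContDiff ℝ ∞ unitMollifier := unitBump.contDiff_normed

theorem unitMollifier_nonneg (t : ℝ) : 0 ≤ unitMollifier t := unitBump.nonneg_normed t

theorem integral_unitMollifier : ∫ t, unitMollifier t = 1 := unitBump.integral_normed

theorem exists_unitMollifier_le : ∃ M, ∀ t, |unitMollifier t| ≤ M :=
  contDiff_unitMollifier.continuous.bounded_above_of_compact_support
    unitBump.hasCompactSupport_normed

theorem isKernel_unitMollifier : IsKernel (1 / 4) (3 / 4) unitMollifier := by
  refine ⟨contDiff_unitMollifier.continuous.measurable, exists_unitMollifier_le, fun t ht => ?_⟩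
  by_contra h
  have h1 : t ∈ Function.support (unitBump.normed volume) := h
  rw [unitBump.support_normed_eq, Metric.mem_ball, Real.dist_eq, abs_lt] at h1
  change -(1 / 4) < t - 1 / 2 ∧ t - 1 / 2 < 1 / 4 at h1
  exact ht ⟨by linarith [h1.1], by linarith [h1.2]⟩

/-- The mollifier `2^n ρ(2^n · - k)`. -/
def scaledMollifier (n : ℕ) (k : ℤ) (t : ℝ) : ℝ := 2 ^ n * unitMollifier (2 ^ n * t - k)

theorem contDiff_scaledMollifier (n : ℕ) (k : ℤ) : ContDiff ℝ ∞ (scaledMollifier n k) :=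
  contDiff_const.mul (contDiff_unitMollifier.comp
    ((contDiff_const.mul contDiff_id).sub contDiff_const))

theorem scaledMollifier_nonneg (n : ℕ) (k : ℤ) (t : ℝ) : 0 ≤ scaledMollifier n k t :=
  mul_nonneg (by positivity) (unitMollifier_nonneg _)

theorem integral_scaledMollifier (n : ℕ) (k : ℤ) : ∫ t, scaledMollifier n k t = 1 := by
  have hp : (0 : ℝ) < 2 ^ n := by positivity
  simp only [scaledMollifier]
  rw [integral_const_mul, Measure.integral_comp_mul_left (fun t => unitMollifier (t - k)) (2 ^ n),
    integral_sub_right_eq_self unitMollifier, integral_unitMollifier, abs_of_pos (inv_pos.2 hp),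
    smul_eq_mul, mul_one, mul_inv_cancel₀ hp.ne']

/-- The unit mollifier lives inside one cell, so for every cell of the square the scaled one keeps a
positive distance from the boundary, and it is an admissible test function. -/
theorem isKernel_scaledMollifier (n : ℕ) {k : ℤ} (h0 : 0 ≤ k) (h1 : k < 2 ^ n) :
    IsKernel (1 / 4 / 2 ^ n) (1 - 1 / 4 / 2 ^ n) (scaledMollifier n k) := by
  have hp : (0 : ℝ) < 2 ^ n := by positivity
  obtain ⟨M, hM⟩ := exists_unitMollifier_le
  refine ⟨(contDiff_scaledMollifier n k).continuous.measurable, ⟨2 ^ n * M, fun t => ?_⟩,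
    fun t ht => ?_⟩
  · rw [scaledMollifier, abs_mul, abs_of_pos hp]
    exact mul_le_mul_of_nonneg_left (hM _) hp.le
  · rw [scaledMollifier, isKernel_unitMollifier.supp, mul_zero]
    contrapose! ht
    have h0' : (0 : ℝ) ≤ k := by exact_mod_cast h0
    have h1' : (k : ℝ) + 1 ≤ 2 ^ n := by exact_mod_cast h1
    rw [Set.mem_Icc, div_le_iff₀ hp, le_sub_comm, div_le_iff₀ hp, sub_mul, one_mul, mul_comm t]
    exact ⟨by linarith [ht.1], by linarith [ht.2]⟩

theorem isKernel_unitMollifier' (n : ℕ) :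
    IsKernel (1 / 4 / 2 ^ n) (1 - 1 / 4 / 2 ^ n) unitMollifier := by
  have h : (1 : ℝ) / 4 / 2 ^ n ≤ 1 / 4 :=
    div_le_self (by norm_num) (one_le_pow₀ one_le_two)
  exact isKernel_unitMollifier.mono h (by linarith)

theorem IsKernel.tsupport_subset {g : ℝ → ℝ} {δ : ℝ} (h : IsKernel δ (1 - δ) g) (hδ : 0 < δ) :
    tsupport g ⊆ Set.Ioo 0 1 := by
  have h1 : tsupport g ⊆ Set.Icc δ (1 - δ) :=
    closure_minimal (fun t ht => by_contra fun ht' => ht (h.supp t ht')) isClosed_Icc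
  exact h1.trans fun t ht => ⟨hδ.trans_le ht.1, ht.2.trans_lt (by linarith)⟩

theorem testApprox_zero {g : ℝ → ℝ} {δ : ℝ} (h : IsKernel δ (1 - δ) g) (hδ : 0 < δ)
    (hg : ContDiff ℝ ∞ g) : TestApprox 0 g g :=
  ⟨fun _ => g, fun _ => hg, fun _ => h.tsupport_subset hδ, BddTendsto.const h.bdd,
    BddTendsto.const h.bdd⟩

/-- The compactly supported primitive of `2^n ρ(2^n · - k) - ρ`. -/
def mollifierPrimitive (n : ℕ) (k : ℤ) (t : ℝ) : ℝ :=
  ∫ s in Set.Iic t, (scaledMollifier n k s - unitMollifier s)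

theorem abs_mollifierPrimitive_le (n : ℕ) {k : ℤ} (h0 : 0 ≤ k) (h1 : k < 2 ^ n) (t : ℝ) :
    |mollifierPrimitive n k t| ≤ 2 := by
  have i1 := (isKernel_scaledMollifier n h0 h1).integrable
  have i2 := isKernel_unitMollifier.integrable
  rw [mollifierPrimitive, integral_sub i1.integrableOn i2.integrableOn]
  have a1 : ∫ s in Set.Iic t, scaledMollifier n k s ≤ 1 := by
    rw [← integral_scaledMollifier n k]
    exact setIntegral_le_integral i1 (Eventually.of_forall (scaledMollifier_nonneg n k))
  have a2 : ∫ s in Set.Iic t, unitMollifier s ≤ 1 := by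
    rw [← integral_unitMollifier]
    exact setIntegral_le_integral i2 (Eventually.of_forall unitMollifier_nonneg)
  have b1 : 0 ≤ ∫ s in Set.Iic t, scaledMollifier n k s :=
    integral_nonneg (scaledMollifier_nonneg n k)
  have b2 : 0 ≤ ∫ s in Set.Iic t, unitMollifier s := integral_nonneg unitMollifier_nonneg
  rw [abs_le]
  constructor <;> linarith

theorem hasDerivAt_mollifierPrimitive (n : ℕ) {k : ℤ} (h0 : 0 ≤ k) (h1 : k < 2 ^ n) (t : ℝ) :
    HasDerivAt (mollifierPrimitive n k) ((scaledMollifier n k - unitMollifier) t) t := by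
  have hI := ((isKernel_scaledMollifier n h0 h1).sub (isKernel_unitMollifier' n)).integrable
  have hc : Continuous (scaledMollifier n k - unitMollifier) :=
    (contDiff_scaledMollifier n k).continuous.sub contDiff_unitMollifier.continuous
  have e : mollifierPrimitive n k = fun t => (∫ s in (0 : ℝ)..t,
      (scaledMollifier n k - unitMollifier) s) +
        ∫ s in Set.Iic 0, (scaledMollifier n k - unitMollifier) s := by
    funext t
    rw [← intervalIntegral.integral_Iic_sub_Iic hI.integrableOn hI.integrableOn, sub_add_cancel]
    rfl
  rw [e]
  exact (intervalIntegral.integral_hasDerivAt_right (hc.intervalIntegrable _ _)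
    hc.stronglyMeasurable.stronglyMeasurableAtFilter hc.continuousAt).add_const _

theorem deriv_mollifierPrimitive (n : ℕ) {k : ℤ} (h0 : 0 ≤ k) (h1 : k < 2 ^ n) :
    deriv (mollifierPrimitive n k) = scaledMollifier n k - unitMollifier :=
  funext fun t => (hasDerivAt_mollifierPrimitive n h0 h1 t).deriv

theorem contDiff_mollifierPrimitive (n : ℕ) {k : ℤ} (h0 : 0 ≤ k) (h1 : k < 2 ^ n) :
    ContDiff ℝ ∞ (mollifierPrimitive n k) := by
  rw [contDiff_infty_iff_deriv, deriv_mollifierPrimitive n h0 h1]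
  exact ⟨fun t => (hasDerivAt_mollifierPrimitive n h0 h1 t).differentiableAt,
    (contDiff_scaledMollifier n k).sub contDiff_unitMollifier⟩

/-- The two mollifiers have equal mass, so the primitive of their difference vanishes to the right
of both supports. -/
theorem isKernel_mollifierPrimitive (n : ℕ) {k : ℤ} (h0 : 0 ≤ k) (h1 : k < 2 ^ n) :
    IsKernel (1 / 4 / 2 ^ n) (1 - 1 / 4 / 2 ^ n) (mollifierPrimitive n k) := by
  have hk := (isKernel_scaledMollifier n h0 h1).sub (isKernel_unitMollifier' n)
  refine ⟨(contDiff_mollifierPrimitive n h0 h1).continuous.measurable,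
    ⟨2, abs_mollifierPrimitive_le n h0 h1⟩, fun t ht => ?_⟩
  rw [Set.mem_Icc, not_and_or, not_le, not_le] at ht
  rw [mollifierPrimitive]
  rcases ht with ht | ht
  · refine setIntegral_eq_zero_of_forall_eq_zero fun s hs => hk.supp s fun hs' => ?_
    exact absurd (hs'.1.trans hs) (not_le.2 ht)
  · rw [setIntegral_eq_integral_of_forall_compl_eq_zero,
      integral_sub (isKernel_scaledMollifier n h0 h1).integrable isKernel_unitMollifier.integrable,
      integral_scaledMollifier, integral_unitMollifier, sub_self]
    exact fun s hs => hk.supp s fun hs' => hs (hs'.2.trans ht.le)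

theorem testApprox_mollifierPrimitive (n : ℕ) {k : ℤ} (h0 : 0 ≤ k) (h1 : k < 2 ^ n) :
    TestApprox 1 (mollifierPrimitive n k) (scaledMollifier n k - unitMollifier) := by
  have hker := isKernel_mollifierPrimitive n h0 h1
  refine ⟨fun _ => mollifierPrimitive n k, fun _ => contDiff_mollifierPrimitive n h0 h1,
    fun _ => hker.tsupport_subset (by positivity), BddTendsto.const hker.bdd, ?_⟩
  simp only [Function.iterate_one, deriv_mollifierPrimitive n h0 h1]
  exact BddTendsto.const ((isKernel_scaledMollifier n h0 h1).sub (isKernel_unitMollifier' n)).bdd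

theorem isAvgKernel_unitMollifier {M : ℝ} (hM : ∀ t, |unitMollifier t| ≤ M) :
    IsAvgKernel (tensor unitMollifier unitMollifier) (M * M) 1 := by
  have hm := isKernel_unitMollifier.meas
  have hs : ∀ t, unitMollifier t ≠ 0 → |t| ≤ 1 := fun t ht => by
    have h1 : t ∈ Set.Icc (1 / 4 : ℝ) (3 / 4) :=
      by_contra fun h => ht (isKernel_unitMollifier.supp t h)
    rw [abs_le]
    constructor <;> linarith [h1.1, h1.2]
  refine ⟨(hm.comp measurable_fst).mul (hm.comp measurable_snd), fun z => ?_, fun z hz => ?_, ?_⟩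
  · rw [tensor, abs_mul]
    exact mul_le_mul (hM _) (hM _) (abs_nonneg _) ((abs_nonneg _).trans (hM 0))
  · exact ⟨hs _ (left_ne_zero_of_mul hz), hs _ (right_ne_zero_of_mul hz)⟩
  · rw [integral_tensor, integral_unitMollifier, one_mul]

theorem scaled_unitMollifier (n : ℕ) (k : ℤ × ℤ) :
    scaled (tensor unitMollifier unitMollifier) n k =
      tensor (scaledMollifier n k.1) (scaledMollifier n k.2) := by
  funext y
  simp only [scaled, tensor, scaledMollifier]
  ring

theorem integrable_mul_tensor {u : ℝ × ℝ → ℝ} (hu : Integrable u volOmega) {f g : ℝ → ℝ}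
    (hf : Measurable f) (hf' : ∃ M, ∀ t, |f t| ≤ M) (hg : Measurable g)
    (hg' : ∃ M, ∀ t, |g t| ≤ M) : Integrable (fun y => u y * tensor f g y) volOmega := by
  obtain ⟨M, hM⟩ := hf'
  obtain ⟨M', hM'⟩ := hg'
  refine hu.mul_bdd (c := M * M')
    ((hf.comp measurable_fst).mul (hg.comp measurable_snd)).aestronglyMeasurable
    (Eventually.of_forall fun y => ?_)
  rw [tensor, norm_mul]
  exact mul_le_mul (hM _) (hM' _) (norm_nonneg _) ((abs_nonneg _).trans (hM 0))

/-! ### Gagliardo's slicing argument. -/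

theorem enorm_integral_mul_sub_mul_le {u g P Q s : ℝ × ℝ → ℝ} {c : ℝ} (hc : 0 ≤ c)
    (hP : ∀ y, |P y| ≤ c * s y) (hQ : ∀ y, |Q y| ≤ c * s y) :
    ‖∫ y in Omega, (u y * P y - g y * Q y)‖ₑ ≤
      ∫⁻ y in Omega, ENNReal.ofReal c * (‖u y‖ₑ + ‖g y‖ₑ) * ENNReal.ofReal (s y) := by
  refine (enorm_integral_le_lintegral_enorm _).trans (lintegral_mono fun y => ?_)
  have hreal : ‖u y * P y - g y * Q y‖ ≤ c * (‖u y‖ + ‖g y‖) * s y := by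
    refine (norm_sub_le _ _).trans ?_
    rw [norm_mul, norm_mul]
    calc _ ≤ ‖u y‖ * (c * s y) + ‖g y‖ * (c * s y) :=
          add_le_add (mul_le_mul_of_nonneg_left (hP y) (norm_nonneg _))
            (mul_le_mul_of_nonneg_left (hQ y) (norm_nonneg _))
      _ = _ := by ring
  rw [← ofReal_norm]
  refine (ENNReal.ofReal_le_ofReal hreal).trans (le_of_eq ?_)
  rw [ENNReal.ofReal_mul (by positivity), ENNReal.ofReal_mul hc,
    ENNReal.ofReal_add (norm_nonneg _) (norm_nonneg _), ofReal_norm, ofReal_norm]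

theorem abs_tensor_le {f g : ℝ → ℝ} {y : ℝ × ℝ} {a b : ℝ} (hf : |f y.1| ≤ a) (hg : |g y.2| ≤ b) :
    |tensor f g y| ≤ a * b := by
  rw [tensor, abs_mul]
  exact mul_le_mul hf hg (abs_nonneg _) ((abs_nonneg _).trans hf)

/-- The concentrated mollifier in the first variable is replaced by the fixed one; the difference is
the derivative of a bounded primitive and is moved onto `∂₁ u`. The bound no longer depends on
`k.1`. The constant `M + 2` dominates both the fixed mollifier and the primitive. -/
theorem enorm_avg_unitMollifier_le_snd {M : ℝ} (hM : ∀ t, |unitMollifier t| ≤ M)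
    {u g : ℝ × ℝ → ℝ} (hu : Integrable u volOmega) (hg : Integrable g volOmega)
    (h : IsWeakDeriv (1, 0) u g) {n : ℕ} {k : ℤ × ℤ} (hk : k ∈ boxIndex n) :
    ‖avg (tensor unitMollifier unitMollifier) n u k‖ₑ ≤
      ∫⁻ y in Omega, ENNReal.ofReal (M + 2) * (‖u y‖ₑ + ‖g y‖ₑ) *
        ENNReal.ofReal (scaledMollifier n k.2 y.2) := by
  obtain ⟨h1, h2, h3, h4⟩ := hk
  have hM0 : 0 ≤ M := (abs_nonneg _).trans (hM 0)
  have k1 := (isKernel_scaledMollifier n h1 h2).sub (isKernel_unitMollifier' n)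
  have k2 := isKernel_scaledMollifier n h3 h4
  have kW := isKernel_mollifierPrimitive n h1 h2
  have key := h.integral_tensor hu hg (testApprox_mollifierPrimitive n h1 h2)
    (testApprox_zero k2 (by positivity) (contDiff_scaledMollifier n k.2))
  have i1 := integrable_mul_tensor hu isKernel_unitMollifier.meas ⟨M, hM⟩ k2.meas k2.bdd
  have i2 := integrable_mul_tensor hu k1.meas k1.bdd k2.meas k2.bdd
  have i3 := integrable_mul_tensor hg kW.meas kW.bdd k2.meas k2.bdd
  have e1 : avg (tensor unitMollifier unitMollifier) n u k =
      (∫ y in Omega, u y * tensor unitMollifier (scaledMollifier n k.2) y) +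
        ∫ y in Omega, u y * tensor (scaledMollifier n k.1 - unitMollifier)
          (scaledMollifier n k.2) y := by
    rw [← integral_add i1 i2, avg, scaled_unitMollifier]
    congr 1
    funext y
    simp only [tensor, Pi.sub_apply]
    ring
  have e : avg (tensor unitMollifier unitMollifier) n u k =
      ∫ y in Omega, (u y * tensor unitMollifier (scaledMollifier n k.2) y -
        g y * tensor (mollifierPrimitive n k.1) (scaledMollifier n k.2) y) := by
    rw [integral_sub i1 i3, e1, key, order]
    ring
  have hs : ∀ y : ℝ × ℝ, |scaledMollifier n k.2 y.2| ≤ scaledMollifier n k.2 y.2 := fun y =>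
    (abs_of_nonneg (scaledMollifier_nonneg n k.2 y.2)).le
  rw [e]
  exact enorm_integral_mul_sub_mul_le (by linarith)
    (fun y => abs_tensor_le ((hM _).trans (by linarith)) (hs y))
    fun y => abs_tensor_le ((abs_mollifierPrimitive_le n h1 h2 _).trans (by linarith)) (hs y)

/-- The mirror bound, which uses `∂₂ u` and does not depend on `k.2`. -/
theorem enorm_avg_unitMollifier_le_fst {M : ℝ} (hM : ∀ t, |unitMollifier t| ≤ M)
    {u g : ℝ × ℝ → ℝ} (hu : Integrable u volOmega) (hg : Integrable g volOmega)
    (h : IsWeakDeriv (0, 1) u g) {n : ℕ} {k : ℤ × ℤ} (hk : k ∈ boxIndex n) :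
    ‖avg (tensor unitMollifier unitMollifier) n u k‖ₑ ≤
      ∫⁻ y in Omega, ENNReal.ofReal (M + 2) * (‖u y‖ₑ + ‖g y‖ₑ) *
        ENNReal.ofReal (scaledMollifier n k.1 y.1) := by
  obtain ⟨h1, h2, h3, h4⟩ := hk
  have hM0 : 0 ≤ M := (abs_nonneg _).trans (hM 0)
  have k1 := isKernel_scaledMollifier n h1 h2
  have k2 := (isKernel_scaledMollifier n h3 h4).sub (isKernel_unitMollifier' n)
  have kW := isKernel_mollifierPrimitive n h3 h4
  have key := h.integral_tensor hu hg
    (testApprox_zero k1 (by positivity) (contDiff_scaledMollifier n k.1))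
    (testApprox_mollifierPrimitive n h3 h4)
  have i1 := integrable_mul_tensor hu k1.meas k1.bdd isKernel_unitMollifier.meas ⟨M, hM⟩
  have i2 := integrable_mul_tensor hu k1.meas k1.bdd k2.meas k2.bdd
  have i3 := integrable_mul_tensor hg k1.meas k1.bdd kW.meas kW.bdd
  have e1 : avg (tensor unitMollifier unitMollifier) n u k =
      (∫ y in Omega, u y * tensor (scaledMollifier n k.1) unitMollifier y) +
        ∫ y in Omega, u y * tensor (scaledMollifier n k.1)
          (scaledMollifier n k.2 - unitMollifier) y := by
    rw [← integral_add i1 i2, avg, scaled_unitMollifier]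
    congr 1
    funext y
    simp only [tensor, Pi.sub_apply]
    ring
  have e : avg (tensor unitMollifier unitMollifier) n u k =
      ∫ y in Omega, (u y * tensor (scaledMollifier n k.1) unitMollifier y -
        g y * tensor (scaledMollifier n k.1) (mollifierPrimitive n k.2) y) := by
    rw [integral_sub i1 i3, e1, key, order]
    ring
  have hs : ∀ y : ℝ × ℝ, |scaledMollifier n k.1 y.1| ≤ scaledMollifier n k.1 y.1 := fun y =>
    (abs_of_nonneg (scaledMollifier_nonneg n k.1 y.1)).le
  rw [e]
  refine enorm_integral_mul_sub_mul_le (by linarith) (fun y => ?_) fun y => ?_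
  · rw [mul_comm]
    exact abs_tensor_le (hs y) ((hM _).trans (by linarith))
  · rw [mul_comm]
    exact abs_tensor_le (hs y) ((abs_mollifierPrimitive_le n h3 h4 _).trans (by linarith))

/-- For fixed `s` the integrand is at most `2^n M` and lives on an interval of length `2 · 2^(-n)`
around `s`. -/
theorem lintegral_scaledMollifier_floor_le {M : ℝ} (hM : ∀ t, |unitMollifier t| ≤ M) (n : ℕ)
    (s : ℝ) : ∫⁻ t : ℝ, ENNReal.ofReal (scaledMollifier n ⌊2 ^ n * t⌋ s) ≤ ENNReal.ofReal (2 * M) := by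
  have hp : (0 : ℝ) < 2 ^ n := by positivity
  have hM0 : 0 ≤ M := (abs_nonneg _).trans (hM 0)
  have h1 : ∀ t : ℝ, ENNReal.ofReal (scaledMollifier n ⌊2 ^ n * t⌋ s) ≤
      (Metric.closedBall s (1 / 2 ^ n)).indicator (fun _ => ENNReal.ofReal (2 ^ n * M)) t := by
    intro t
    by_cases ht : 2 ^ n * s - ⌊2 ^ n * t⌋ ∈ Set.Icc (1 / 4 : ℝ) (3 / 4)
    · rw [Set.indicator_of_mem]
      · exact ENNReal.ofReal_le_ofReal
          (mul_le_mul_of_nonneg_left ((le_abs_self _).trans (hM _)) hp.le)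
      · have h2 := Int.floor_le (2 ^ n * t)
        have h3 := Int.lt_floor_add_one (2 ^ n * t)
        rw [Metric.mem_closedBall, Real.dist_eq, le_div_iff₀ hp, ← abs_of_pos hp, ← abs_mul,
          abs_le]
        constructor <;> linarith [ht.1, ht.2]
    · rw [scaledMollifier, isKernel_unitMollifier.supp _ ht]
      simp
  refine (lintegral_mono h1).trans (le_of_eq ?_)
  rw [lintegral_indicator measurableSet_closedBall, setLIntegral_const, Real.volume_closedBall,
    ← ENNReal.ofReal_mul (by positivity)]
  congr 1
  field_simp

theorem lintegral_lintegral_scaledMollifier_le {M : ℝ} (hM : ∀ t, |unitMollifier t| ≤ M) (n : ℕ)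
    {Φ : ℝ × ℝ → ℝ≥0∞} (hΦ : AEMeasurable Φ volOmega) {π : ℝ × ℝ → ℝ} (hπ : Measurable π) :
    ∫⁻ t : ℝ, ∫⁻ y in Omega, Φ y * ENNReal.ofReal (scaledMollifier n ⌊2 ^ n * t⌋ (π y)) ≤
      ENNReal.ofReal (2 * M) * ∫⁻ y in Omega, Φ y := by
  have hfl : Measurable fun t : ℝ => ((⌊2 ^ n * t⌋ : ℤ) : ℝ) :=
    (measurable_of_countable (fun k : ℤ => (k : ℝ))).comp
      (Int.measurable_floor.comp (measurable_id.const_mul _))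
  have hm : Measurable fun z : ℝ × ℝ × ℝ =>
      ENNReal.ofReal (scaledMollifier n ⌊2 ^ n * z.1⌋ (π z.2)) :=
    ENNReal.measurable_ofReal.comp ((isKernel_unitMollifier.meas.comp
      (((hπ.comp measurable_snd).const_mul (2 ^ n)).sub
        (hfl.comp measurable_fst))).const_mul (2 ^ n))
  have hm' : AEMeasurable (fun z : ℝ × ℝ × ℝ =>
      Φ z.2 * ENNReal.ofReal (scaledMollifier n ⌊2 ^ n * z.1⌋ (π z.2)))
      (volume.prod volOmega) := hΦ.comp_snd.mul hm.aemeasurable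
  have hsw := lintegral_lintegral_swap (f := fun (t : ℝ) (y : ℝ × ℝ) =>
    Φ y * ENNReal.ofReal (scaledMollifier n ⌊2 ^ n * t⌋ (π y))) hm'
  rw [hsw, ← lintegral_const_mul' _ _ ENNReal.ofReal_ne_top]
  refine lintegral_mono fun y => ?_
  have h1 : Measurable fun t : ℝ => ENNReal.ofReal (scaledMollifier n ⌊2 ^ n * t⌋ (π y)) :=
    ENNReal.measurable_ofReal.comp ((isKernel_unitMollifier.meas.comp
      (hfl.const_sub (2 ^ n * π y))).const_mul (2 ^ n))
  rw [lintegral_const_mul _ h1, mul_comm]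
  exact mul_le_mul' (lintegral_scaledMollifier_floor_le hM n _) le_rfl

/-- The `L_1`-type Sobolev norm of first order. -/
def sobolevNormOne (u g₁ g₂ : ℝ × ℝ → ℝ) : ℝ≥0∞ :=
  eLpNorm u 1 volOmega + eLpNorm g₁ 1 volOmega + eLpNorm g₂ 1 volOmega

theorem eLpNorm_stepFun_unitMollifier_le {M : ℝ} (hM : ∀ t, |unitMollifier t| ≤ M)
    {u g₁ g₂ : ℝ × ℝ → ℝ} (hu : Integrable u volOmega) (hg₁ : Integrable g₁ volOmega)
    (hg₂ : Integrable g₂ volOmega) (h₁ : IsWeakDeriv (1, 0) u g₁) (h₂ : IsWeakDeriv (0, 1) u g₂)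
    (n : ℕ) :
    eLpNorm (stepFun n (boxIndex n) (avg (tensor unitMollifier unitMollifier) n u)) 2 volOmega ≤
      ENNReal.ofReal (2 * M) * (ENNReal.ofReal (M + 2) * sobolevNormOne u g₁ g₂) := by
  set Φ : ℝ × ℝ → ℝ≥0∞ := fun y => ENNReal.ofReal (M + 2) * (‖u y‖ₑ + ‖g₁ y‖ₑ + ‖g₂ y‖ₑ) with hΦ
  have hΦm : AEMeasurable Φ volOmega :=
    ((hu.1.enorm.add hg₁.1.enorm).add hg₂.1.enorm).const_mul _
  have hΦi : ∫⁻ y in Omega, Φ y = ENNReal.ofReal (M + 2) * sobolevNormOne u g₁ g₂ := by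
    rw [hΦ, lintegral_const_mul' _ _ ENNReal.ofReal_ne_top, lintegral_add_right' _ hg₂.1.enorm,
      lintegral_add_right' _ hg₁.1.enorm, sobolevNormOne, eLpNorm_one_eq_lintegral_enorm,
      eLpNorm_one_eq_lintegral_enorm, eLpNorm_one_eq_lintegral_enorm]
  let P : (ℝ × ℝ → ℝ) → ℝ → ℝ≥0∞ := fun π t =>
    ∫⁻ y in Omega, Φ y * ENNReal.ofReal (scaledMollifier n ⌊2 ^ n * t⌋ (π y))
  -- `P π` factors through the integer `⌊2^n t⌋`, so measurability needs no parametric integral.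
  have hP : ∀ π, Measurable (P π) := fun π =>
    (measurable_of_countable fun k : ℤ =>
      ∫⁻ y in Omega, Φ y * ENNReal.ofReal (scaledMollifier n k (π y))).comp
      (Int.measurable_floor.comp (measurable_id.const_mul _))
  set B := ENNReal.ofReal (2 * M) * (ENNReal.ofReal (M + 2) * sobolevNormOne u g₁ g₂) with hB
  have hPi : ∀ π, Measurable π → ∫⁻ t, P π t ≤ B := fun π hπ => by
    rw [hB, ← hΦi]
    exact lintegral_lintegral_scaledMollifier_le hM n hΦm hπ
  -- One factor of the square is bounded by a function of `x.1` alone, the other by a function of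
  -- `x.2` alone; the integral over the plane then splits into a product of one-dimensional
  -- integrals.
  have hbd : ∀ x, ‖stepFun n (boxIndex n) (avg (tensor unitMollifier unitMollifier) n u) x‖ₑ ^ 2 ≤
      P Prod.fst x.1 * P Prod.snd x.2 := by
    intro x
    by_cases hx : cell n x ∈ boxIndex n
    · rw [stepFun, Set.indicator_of_mem (Set.mem_preimage.2 hx), sq]
      refine mul_le_mul' ?_ ?_
      · refine (enorm_avg_unitMollifier_le_fst hM hu hg₂ h₂ hx).trans (lintegral_mono fun y => ?_)
        simp only [hΦ, cell]
        exact mul_le_mul' (mul_le_mul' le_rfl (add_le_add le_self_add le_rfl)) le_rfl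
      · refine (enorm_avg_unitMollifier_le_snd hM hu hg₁ h₁ hx).trans (lintegral_mono fun y => ?_)
        simp only [hΦ, cell]
        exact mul_le_mul' (mul_le_mul' le_rfl le_self_add) le_rfl
    · rw [stepFun, Set.indicator_of_notMem (mt Set.mem_preimage.1 hx)]
      simp
  have hsq : ∫⁻ x in Omega, ‖stepFun n (boxIndex n)
      (avg (tensor unitMollifier unitMollifier) n u) x‖ₑ ^ 2 ≤ B ^ 2 := by
    calc _ ≤ ∫⁻ x : ℝ × ℝ, P Prod.fst x.1 * P Prod.snd x.2 :=
          lintegral_mono' Measure.restrict_le_self hbd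
      _ = (∫⁻ t, P Prod.fst t) * ∫⁻ t, P Prod.snd t :=
        lintegral_prod_mul (hP _).aemeasurable (hP _).aemeasurable
      _ ≤ B * B := mul_le_mul' (hPi _ measurable_fst) (hPi _ measurable_snd)
      _ = B ^ 2 := (sq B).symm
  rw [eLpNorm_eq_lintegral_rpow_enorm_toReal two_ne_zero ENNReal.ofNat_ne_top]
  simp only [ENNReal.toReal_ofNat, ENNReal.rpow_ofNat]
  refine (ENNReal.rpow_le_rpow hsq (by norm_num)).trans (le_of_eq ?_)
  rw [← ENNReal.rpow_natCast, ← ENNReal.rpow_mul]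
  norm_num

theorem cell_mem_boxIndex_of_mem_Omega {x : ℝ × ℝ} (hx : x ∈ Omega) (n : ℕ) :
    cell n x ∈ boxIndex n :=
  cell_mem_boxIndex.2 ⟨Set.Ioo_subset_Ico_self hx.1, Set.Ioo_subset_Ico_self hx.2⟩

/-- The mollified step functions satisfy the bound uniformly and converge to `u` in `L_1`; Fatou
along an almost everywhere convergent subsequence transfers it to `u`. -/
theorem exists_eLpNorm_two_le : ∃ c : ℝ≥0∞, c ≠ ⊤ ∧ ∀ u g₁ g₂ : ℝ × ℝ → ℝ,
    Integrable u volOmega → Integrable g₁ volOmega → Integrable g₂ volOmega →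
    IsWeakDeriv (1, 0) u g₁ → IsWeakDeriv (0, 1) u g₂ →
    eLpNorm u 2 volOmega ≤ c * sobolevNormOne u g₁ g₂ := by
  obtain ⟨M, hM⟩ := exists_unitMollifier_le
  refine ⟨ENNReal.ofReal (2 * M) * ENNReal.ofReal (M + 2),
    ENNReal.mul_ne_top ENNReal.ofReal_ne_top ENNReal.ofReal_ne_top, ?_⟩
  intro u g₁ g₂ hu hg₁ hg₂ h₁ h₂
  have hlim := (isAvgKernel_unitMollifier hM).tendsto_eLpNorm_stepFun_avg_sub
    (K := boxIndex) (fun x hx => Eventually.of_forall (cell_mem_boxIndex_of_mem_Omega hx))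
    (memLp_one_iff_integrable.2 hu) le_rfl ENNReal.one_ne_top
  have hm : ∀ n, AEStronglyMeasurable
      (stepFun n (boxIndex n) (avg (tensor unitMollifier unitMollifier) n u)) volOmega := fun n =>
    (measurable_stepFun _ _ _).aestronglyMeasurable
  obtain ⟨ns, -, hns⟩ :=
    (tendstoInMeasure_of_tendsto_eLpNorm one_ne_zero hm hu.1 hlim).exists_seq_tendsto_ae
  rw [mul_assoc]
  exact Lp.eLpNorm_le_of_ae_tendsto (Eventually.of_forall fun i =>
    eLpNorm_stepFun_unitMollifier_le hM hu hg₁ hg₂ h₁ h₂ (ns i)) (fun i => hm (ns i)) hns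

/-! ### Index sets -/

theorem closure_Omega : closure Omega = Set.Icc (0 : ℝ) 1 ×ˢ Set.Icc (0 : ℝ) 1 := by
  rw [Omega, closure_prod_eq, closure_Ioo zero_ne_one]

theorem mem_indexM {m n : ℕ} (hm : 1 ≤ m) {k : ℤ × ℤ} :
    k ∈ indexM m n ↔ ((m / 2 : ℕ) ≤ k.1 ∧ k.1 + m - (m / 2 : ℕ) ≤ 2 ^ n) ∧
      ((m / 2 : ℕ) ≤ k.2 ∧ k.2 + m - (m / 2 : ℕ) ≤ 2 ^ n) := by
  have hp : (0 : ℝ) < 2 ^ n := by positivity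
  have hm' : (1 : ℝ) ≤ m := by exact_mod_cast hm
  set h : ℕ := m / 2
  constructor
  · intro hk
    have key : ∀ s : ℝ, 0 < s → s < m →
        ((s - h + k.1) / 2 ^ n, (s - h + k.2) / 2 ^ n) ∈ closure Omega := by
      intro s h0 h1
      refine hk (subset_tsupport _ ?_)
      have hb : 0 < bspline m (s - h) := bspline_pos (by simpa [h] using h0) (by simpa [h] using h1)
      rw [Function.mem_support, phiScaled, phi₂, tensor]
      simp only [mul_div_cancel₀ _ hp.ne', add_sub_cancel_right]
      positivity
    rw [closure_Omega] at key
    -- Points half a unit inside each end of the support give the inequalities up to `1/2`, and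
    -- integrality makes them sharp.
    have k1 := key (1 / 2) (by norm_num) (by linarith)
    have k2 := key (m - 1 / 2) (by linarith) (by linarith)
    have low : ∀ a : ℤ, 0 ≤ (1 / 2 - (h : ℝ) + a) / 2 ^ n → (h : ℤ) ≤ a := by
      intro a ha
      rw [le_div_iff₀ hp, zero_mul] at ha
      have : (h : ℝ) < a + 1 := by linarith
      have : (h : ℤ) < a + 1 := by exact_mod_cast this
      omega
    have high : ∀ a : ℤ, ((m : ℝ) - 1 / 2 - h + a) / 2 ^ n ≤ 1 → a + m - (h : ℤ) ≤ 2 ^ n := by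
      intro a ha
      rw [div_le_iff₀ hp, one_mul] at ha
      have : (a : ℝ) + m - h < 2 ^ n + 1 := by linarith
      have : a + m - (h : ℤ) < 2 ^ n + 1 := by exact_mod_cast this
      omega
    exact ⟨⟨low _ k1.1.1, high _ k2.1.2⟩, ⟨low _ k1.2.1, high _ k2.2.2⟩⟩
  · rintro ⟨⟨h1, h2⟩, h3, h4⟩
    change tsupport _ ⊆ closure Omega
    refine closure_minimal (fun x hx => ?_) isClosed_closure
    rw [closure_Omega]
    have hxne : bspline m (2 ^ n * x.1 - k.1) * bspline m (2 ^ n * x.2 - k.2) ≠ 0 :=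
      right_ne_zero_of_mul hx
    have key : ∀ (a : ℤ) (t : ℝ), (h : ℤ) ≤ a → a + m - (h : ℤ) ≤ 2 ^ n →
        bspline m (2 ^ n * t - a) ≠ 0 → t ∈ Set.Icc (0 : ℝ) 1 := by
      intro a t ha1 ha2 hb
      have hmem : 2 ^ n * t - a ∈ Set.Icc (-(h : ℝ)) (m - h) :=
        by_contra fun hn => hb ((isKernel_bspline hm).supp _ hn)
      have ha1' : (h : ℝ) ≤ a := by exact_mod_cast ha1
      have ha2' : (a : ℝ) + m - h ≤ 2 ^ n := by exact_mod_cast ha2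
      constructor
      · by_contra! hneg
        nlinarith [hmem.1]
      · by_contra! hgt
        nlinarith [hmem.2]
    exact ⟨key _ _ h1 h2 (left_ne_zero_of_mul hxne), key _ _ h3 h4 (right_ne_zero_of_mul hxne)⟩

/-- The coordinate bound that the entries of indices in `K_n` satisfy. -/
def CoordBound (m n : ℕ) (a : ℤ) : Prop :=
  0 ≤ a - 3 * (m / 2 : ℕ) ∧ a + 3 * (m - (m / 2 : ℕ)) ≤ 2 ^ n

theorem CoordBound.cast {m n : ℕ} {a : ℤ} (h : CoordBound m n a) :
    0 ≤ (a : ℝ) - 3 * (m / 2 : ℕ) ∧ (a : ℝ) + 3 * (m - (m / 2 : ℕ)) ≤ 2 ^ n := by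
  obtain ⟨h1, h2⟩ := h
  generalize m / 2 = d at *
  exact ⟨by exact_mod_cast h1, by exact_mod_cast h2⟩

/-- Moving `k` by `C ≥ 2` times an extreme low-pass index stays in `indexM`, which itself requires
one more margin: hence the factor 3. It is what the second-order transform consumes: one spline
support and two lifts. -/
theorem coordBound_of_mem_indexK {m J C n : ℕ} (hm : 1 ≤ m) (hC : 2 ≤ C) {β : Fin J → ℕ × ℕ}
    {k : ℤ × ℤ} (hk : k ∈ indexK m β C n) : CoordBound m n k.1 ∧ CoordBound m n k.2 := by
  have h1 := hk.2 0 (Or.inl rfl) (-((m / 2 : ℕ) : ℤ), -((m / 2 : ℕ) : ℤ))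
    (mul_ne_zero (mask_zero_left_ne_zero m) (mask_zero_left_ne_zero m))
  have h2 := hk.2 0 (Or.inl rfl) (m - ((m / 2 : ℕ) : ℤ), m - ((m / 2 : ℕ) : ℤ))
    (mul_ne_zero (mask_zero_right_ne_zero m) (mask_zero_right_ne_zero m))
  rw [mem_indexM hm] at h1 h2
  simp only [Prod.fst_add, Prod.snd_add, Prod.smul_fst, Prod.smul_snd] at h1 h2
  simp only [nsmul_eq_mul] at h1 h2
  have hC' : (2 : ℤ) ≤ C := by exact_mod_cast hC
  have hh : ((m / 2 : ℕ) : ℤ) ≤ m := by exact_mod_cast Nat.div_le_self m 2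
  have hh0 : (0 : ℤ) ≤ ((m / 2 : ℕ) : ℤ) := Int.natCast_nonneg _
  simp only [CoordBound]
  generalize ((m / 2 : ℕ) : ℤ) = h at *
  have p1 : 2 * h ≤ C * h := mul_le_mul_of_nonneg_right hC' hh0
  have p2 : 2 * (m - h) ≤ C * (m - h) := mul_le_mul_of_nonneg_right hC' (by linarith)
  have e : (C : ℤ) * -h = -(C * h) := by ring
  rw [e] at h1
  refine ⟨⟨?_, ?_⟩, ⟨?_, ?_⟩⟩
  · linarith [h1.1.1]
  · linarith [h2.1.2]
  · linarith [h1.2.1]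
  · linarith [h2.2.2]

theorem indexK_subset_boxIndex {m J C n : ℕ} (hm : 1 ≤ m) (hC : 2 ≤ C) (β : Fin J → ℕ × ℕ) :
    indexK m β C n ⊆ boxIndex n := by
  intro k hk
  obtain ⟨⟨h1, h2⟩, h3, h4⟩ := coordBound_of_mem_indexK hm hC hk
  refine ⟨?_, ?_, ?_, ?_⟩ <;> omega

theorem mem_maskRange_of_mask_ne_zero {m l : ℕ} (hl : l ≤ m) {r : ℤ} (h : mask m l r ≠ 0) :
    -(m : ℤ) ≤ r ∧ r ≤ m := by
  have h1 : r ∈ maskRange m := by_contra fun hr => h (mask_eq_zero hl hr)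
  simp only [maskRange, Finset.mem_Icc] at h1
  omega

theorem eventually_cell_mem_indexK {m J : ℕ} (hm : 1 ≤ m) (C : ℕ) {β : Fin J → ℕ × ℕ}
    (hβ : ∀ j, (β j).1 ≤ m ∧ (β j).2 ≤ m) {x : ℝ × ℝ} (hx : x ∈ Omega) :
    ∀ᶠ n in atTop, cell n x ∈ indexK m β C n := by
  -- The margin `(C + 1) m` covers `C` times any mask index, of size at most `m`, plus the `m`
  -- required by `indexM`.
  have key : ∀ t : ℝ, t ∈ Set.Ioo (0 : ℝ) 1 → ∀ᶠ n : ℕ in atTop,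
      ((C + 1) * m : ℤ) ≤ ⌊2 ^ n * t⌋ ∧ ⌊2 ^ n * t⌋ + ((C + 1) * m : ℤ) ≤ 2 ^ n := by
    intro t ht
    have hpow : Tendsto (fun n : ℕ => (2 : ℝ) ^ n) atTop atTop :=
      tendsto_pow_atTop_atTop_of_one_lt one_lt_two
    have h1 := (hpow.atTop_mul_const ht.1).eventually_ge_atTop ((C + 1) * m : ℝ)
    have h2 := (hpow.atTop_mul_const (sub_pos.2 ht.2)).eventually_ge_atTop ((C + 1) * m : ℝ)
    filter_upwards [h1, h2] with n hn1 hn2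
    constructor
    · rw [Int.le_floor]
      push_cast
      exact hn1
    · have h3 := Int.floor_le ((2 : ℝ) ^ n * t)
      have h4 : (⌊(2 : ℝ) ^ n * t⌋ : ℝ) + (C + 1) * m ≤ 2 ^ n := by
        rw [mul_sub, mul_one] at hn2
        linarith
      exact_mod_cast h4
  filter_upwards [key _ hx.1, key _ hx.2] with n hn1 hn2
  have hh : ((m / 2 : ℕ) : ℤ) ≤ m := by exact_mod_cast Nat.div_le_self m 2
  have hh0 : (0 : ℤ) ≤ ((m / 2 : ℕ) : ℤ) := Int.natCast_nonneg _
  have hCm : (0 : ℤ) ≤ C * m := by positivity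
  rw [add_mul, one_mul] at hn1 hn2
  refine ⟨(mem_indexM hm).2 ?_, fun b hb r hr => (mem_indexM hm).2 ?_⟩
  · simp only [cell]
    generalize ((m / 2 : ℕ) : ℤ) = h at *
    refine ⟨⟨?_, ?_⟩, ⟨?_, ?_⟩⟩ <;> linarith [hn1.1, hn1.2, hn2.1, hn2.2]
  · have hbm : b.1 ≤ m ∧ b.2 ≤ m := by
      rcases hb with rfl | ⟨j, rfl⟩
      · simp
      · exact hβ j
    have r1 := mem_maskRange_of_mask_ne_zero hbm.1 (left_ne_zero_of_mul hr)
    have r2 := mem_maskRange_of_mask_ne_zero hbm.2 (right_ne_zero_of_mul hr)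
    simp only [cell, Prod.fst_add, Prod.snd_add, Prod.smul_fst, Prod.smul_snd]
    simp only [nsmul_eq_mul]
    have hC0 : (0 : ℤ) ≤ C := Int.natCast_nonneg _
    have q1 := mul_le_mul_of_nonneg_left r1.1 hC0
    have q2 := mul_le_mul_of_nonneg_left r1.2 hC0
    have q3 := mul_le_mul_of_nonneg_left r2.1 hC0
    have q4 := mul_le_mul_of_nonneg_left r2.2 hC0
    rw [mul_neg] at q1 q3
    generalize ((m / 2 : ℕ) : ℤ) = h at *
    refine ⟨⟨?_, ?_⟩, ⟨?_, ?_⟩⟩ <;> linarith [hn1.1, hn1.2, hn2.1, hn2.2]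

/-! ### Sampling operators as local averages -/

/-- The tensor product of `f` and `g`, normalised to have integral one. -/
def normTensor (f g : ℝ → ℝ) (z : ℝ × ℝ) : ℝ := ((∫ t, f t) * ∫ t, g t)⁻¹ * tensor f g z

theorem exists_isAvgKernel_normTensor {L R : ℝ} {f g : ℝ → ℝ} (hf : IsKernel L R f)
    (hg : IsKernel L R g) (hf0 : ∫ t, f t ≠ 0) (hg0 : ∫ t, g t ≠ 0) :
    ∃ M ρ, IsAvgKernel (normTensor f g) M ρ := by
  obtain ⟨M, hM⟩ := hf.bdd
  obtain ⟨M', hM'⟩ := hg.bdd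
  have hs : ∀ t ∈ Set.Icc L R, |t| ≤ max |L| |R| := fun t ht => abs_le_max_abs_abs ht.1 ht.2
  refine ⟨|((∫ t, f t) * ∫ t, g t)⁻¹| * (M * M'), max |L| |R|,
    ((hf.meas.comp measurable_fst).mul (hg.meas.comp measurable_snd)).const_mul _, fun z => ?_,
    fun z hz => ?_, ?_⟩
  · rw [normTensor, abs_mul]
    exact mul_le_mul_of_nonneg_left (abs_tensor_le (hM _) (hM' _)) (abs_nonneg _)
  · have hz' : f z.1 * g z.2 ≠ 0 := right_ne_zero_of_mul hz
    exact ⟨hs _ (by_contra fun h => left_ne_zero_of_mul hz' (hf.supp _ h)),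
      hs _ (by_contra fun h => right_ne_zero_of_mul hz' (hg.supp _ h))⟩
  · simp only [normTensor]
    rw [integral_const_mul, integral_tensor, inv_mul_cancel₀ (mul_ne_zero hf0 hg0)]

theorem avg_const_mul (c : ℝ) (κ : ℝ × ℝ → ℝ) (n : ℕ) (g : ℝ × ℝ → ℝ) (k : ℤ × ℤ) :
    avg (fun z => c * κ z) n g k = c * avg κ n g k := by
  rw [avg, avg, ← integral_const_mul]
  congr 1
  funext y
  simp only [scaled]
  ring

theorem avg_normTensor (f f' : ℝ → ℝ) (n : ℕ) (g : ℝ × ℝ → ℝ) (k : ℤ × ℤ) :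
    avg (normTensor f f') n g k = ((∫ t, f t) * ∫ t, f' t)⁻¹ * avg (tensor f f') n g k :=
  avg_const_mul _ _ n g k

theorem sampleT_eq_avg (m n : ℕ) (g : ℝ × ℝ → ℝ) (k : ℤ × ℤ) :
    sampleT m n g k = avg (tensor (bspline m) (bspline m)) n g k := by
  rw [sampleT, avg, ← integral_const_mul]
  congr 1
  funext y
  simp only [scaled, phiScaled, phi₂]
  ring

theorem sampleT_eq_avg_normTensor {m : ℕ} (hm : 1 ≤ m) (n : ℕ) (g : ℝ × ℝ → ℝ) (k : ℤ × ℤ) :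
    sampleT m n g k = avg (normTensor (bspline m) (bspline m)) n g k := by
  rw [avg_normTensor, integral_bspline hm, sampleT_eq_avg]
  simp

theorem two_zpow_sub_one (n : ℕ) : (2 : ℝ) ^ ((n : ℤ) - 1) = 2 ^ n * 2⁻¹ := by
  rw [zpow_sub₀ two_ne_zero, zpow_natCast, zpow_one, div_eq_mul_inv]

theorem two_zpow_sub_two (n : ℕ) : (2 : ℝ) ^ ((n : ℤ) - 2) = 2 ^ n * 4⁻¹ := by
  rw [zpow_sub₀ two_ne_zero, zpow_natCast, div_eq_mul_inv]
  norm_num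

/-- `varphi` is the lifted spline at doubled argument, so the half-scale translates of `S_n` are
integer translates at scale `2^n`; `c_b` supplies the normalisation. -/
theorem sampleS_eq_avg {m J : ℕ} (hm : 1 ≤ m) {β : Fin J → ℕ × ℕ} {j : Fin J}
    (hβ : (β j).1 ≤ m ∧ (β j).2 ≤ m) (n : ℕ) (v : Fin J → ℝ × ℝ → ℝ) (k : ℤ × ℤ) :
    sampleS m β n v j k = avg (normTensor (liftOp m (β j).1 (bspline m))
      (liftOp m (β j).2 (bspline m))) n (v j) k := by
  rw [avg_normTensor, sampleS, avg, ← integral_const_mul, ← integral_const_mul]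
  congr 1
  funext y
  simp only [scaled, varphiScaled, varphi₂, tensor]
  rw [varphi_eq hm hβ.1, varphi_eq hm hβ.2, two_zpow_sub_one, two_zpow_sub_two, cst_eq hm hβ, order,
    pow_add]
  have e1 : ∀ (a : ℝ) (b : ℤ), 2 * (2 ^ n * 2⁻¹ * a - (b : ℝ) / 2) = 2 ^ n * a - b := fun a b => by
    ring
  rw [e1, e1]
  simp only [mul_inv, inv_pow, inv_inv]
  have p1 : (2 : ℝ) ^ (β j).1 ≠ 0 := by positivity
  have p2 : (2 : ℝ) ^ (β j).2 ≠ 0 := by positivity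
  field_simp
  ring

/-! ### Frame transforms of samples as averages of weak derivatives. -/

theorem conv_eq_sum {m : ℕ} {b : ℕ × ℕ} (hb : b.1 ≤ m ∧ b.2 ≤ m) (a : ℤ × ℤ → ℝ) (k : ℤ × ℤ) :
    conv m b a k = ∑ r ∈ maskRange m ×ˢ maskRange m, mask₂ m b r * a (r + k) := by
  rw [conv, ← (Equiv.addRight k).tsum_eq]
  simp only [Equiv.coe_addRight, add_sub_cancel_right]
  refine tsum_eq_sum fun r hr => ?_
  rw [Finset.mem_product, not_and_or] at hr
  rcases hr with hr | hr
  · rw [mask₂, mask_eq_zero hb.1 hr]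
    ring
  · rw [mask₂, mask_eq_zero hb.2 hr]
    ring

/-- By linearity of the integral, filtering the samples amounts to filtering the kernel. -/
theorem conv_avg {m : ℕ} {b : ℕ × ℕ} (hb : b.1 ≤ m ∧ b.2 ≤ m) {L R : ℝ} {f g : ℝ → ℝ}
    (hf : IsKernel L R f) (hg : IsKernel L R g) (n : ℕ) {u : ℝ × ℝ → ℝ}
    (hu : Integrable u volOmega) (k : ℤ × ℤ) :
    conv m b (avg (tensor f g) n u) k = avg (tensor (maskOp m b.1 f) (maskOp m b.2 g)) n u k := by
  rw [conv_eq_sum hb]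
  simp only [avg]
  have e : ∀ r : ℤ × ℤ, scaled (tensor f g) n (r + k) = fun y => 2 ^ n * 2 ^ n *
      tensor (fun t => f (2 ^ n * t - (r + k).1)) (fun t => g (2 ^ n * t - (r + k).2)) y :=
    fun r => rfl
  have hI : ∀ r : ℤ × ℤ, Integrable (fun y => u y * scaled (tensor f g) n (r + k) y) volOmega := by
    intro r
    have hb' : ∀ {f : ℝ → ℝ} (a : ℤ), IsKernel L R f →
        Measurable (fun t => f (2 ^ n * t - a)) ∧ ∃ M, ∀ t : ℝ, |f (2 ^ n * t - a)| ≤ M :=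
      fun a hf => ⟨hf.meas.comp ((measurable_id.const_mul _).sub_const _),
        hf.bdd.imp fun M hM t => hM _⟩
    have := (integrable_mul_tensor hu (hb' (r + k).1 hf).1 (hb' (r + k).1 hf).2
      (hb' (r + k).2 hg).1 (hb' (r + k).2 hg).2).const_mul (2 ^ n * 2 ^ n)
    refine this.congr (Eventually.of_forall fun y => ?_)
    simp only [e]
    ring
  simp_rw [← integral_const_mul]
  rw [← integral_finsetSum _ fun r _ => (hI r).const_mul _]
  congr 1
  funext y
  simp only [scaled, tensor, maskOp, mask₂]
  rw [Finset.sum_product, Finset.sum_mul_sum, Finset.mul_sum, Finset.mul_sum]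
  refine Finset.sum_congr rfl fun r _ => ?_
  rw [Finset.mul_sum, Finset.mul_sum]
  refine Finset.sum_congr rfl fun s _ => ?_
  simp only [Prod.fst_add, Prod.snd_add, Int.cast_add]
  rw [show 2 ^ n * y.1 - ((r : ℝ) + k.1) = 2 ^ n * y.1 - k.1 - r by ring,
    show 2 ^ n * y.2 - ((s : ℝ) + k.2) = 2 ^ n * y.2 - k.2 - s by ring]
  ring

theorem IsKernel.testApprox_liftOp {L R : ℝ} {f : ℝ → ℝ} (h : IsKernel L R f) (hLR : L < R)
    {m l : ℕ} (hl : l ≤ m) {N a : ℝ} (hN : 0 < N) (h0 : 0 ≤ L - (m / 2 : ℕ) + a)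
    (h1 : R + (m - (m / 2 : ℕ)) + a ≤ N) :
    TestApprox l (fun t => (N ^ l)⁻¹ * WaveletFrame.liftOp m l f (N * t - a))
      (fun t => maskOp m l f (N * t - a)) := by
  have hml : (0 : ℝ) ≤ (m - l : ℕ) := Nat.cast_nonneg _
  have key := (h.one_add_shift_pow (m - l)).testApprox (by linarith) l
    ((N ^ l)⁻¹ * maskConst m l) (N := N) (d := (m / 2 : ℕ) - a) hN (by linarith)
    (by rw [Nat.cast_sub hl]; linarith)
  have hNl : N ^ l ≠ 0 := by positivity
  have e : ∀ t, N * t - a + (m / 2 : ℕ) = N * t + ((m / 2 : ℕ) - a) := fun t => by ring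
  simp only [WaveletFrame.liftOp, maskOp_eq hl, e, ← mul_assoc]
  rwa [show (N ^ l)⁻¹ * maskConst m l * N ^ l = maskConst m l by field_simp] at key

/-- Integration by parts in both variables: every derivative costs a sign and a factor `2^(-n)`. The
four inequalities place the lifted kernel in the closed square. -/
theorem IsWeakDeriv.avg_maskOp {α : ℕ × ℕ} {u g : ℝ × ℝ → ℝ} (h : IsWeakDeriv α u g)
    (hu : Integrable u volOmega) (hg : Integrable g volOmega) {m : ℕ} (hα : α.1 ≤ m ∧ α.2 ≤ m)
    {L R : ℝ} (hLR : L < R) {f f' : ℝ → ℝ} (hf : IsKernel L R f) (hf' : IsKernel L R f') (n : ℕ)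
    {k : ℤ × ℤ} (h0 : 0 ≤ L - (m / 2 : ℕ) + k.1) (h1 : R + (m - (m / 2 : ℕ)) + k.1 ≤ 2 ^ n)
    (h0' : 0 ≤ L - (m / 2 : ℕ) + k.2) (h1' : R + (m - (m / 2 : ℕ)) + k.2 ≤ 2 ^ n) :
    avg (tensor (maskOp m α.1 f) (maskOp m α.2 f')) n u k =
      (-1) ^ order α * ((2 ^ n) ^ order α)⁻¹ *
        avg (tensor (liftOp m α.1 f) (liftOp m α.2 f')) n g k := by
  have hN : (0 : ℝ) < 2 ^ n := by positivity
  have key := h.integral_tensor hu hg (hf.testApprox_liftOp hLR hα.1 hN h0 h1)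
    (hf'.testApprox_liftOp hLR hα.2 hN h0' h1')
  have e1 : avg (tensor (maskOp m α.1 f) (maskOp m α.2 f')) n u k = 2 ^ n * 2 ^ n *
      ∫ y in Omega, u y * tensor (fun t => maskOp m α.1 f (2 ^ n * t - k.1))
        (fun t => maskOp m α.2 f' (2 ^ n * t - k.2)) y := by
    rw [avg, ← integral_const_mul]
    congr 1
    funext y
    simp only [scaled, tensor]
    ring
  rw [e1, key, avg, ← integral_const_mul, ← integral_const_mul, ← integral_const_mul]
  congr 1
  funext y
  simp only [scaled, tensor, order, pow_add, mul_inv]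
  ring

/-- The weight cancels the sign, the powers of `2^n` and the mean of the kernel. The resulting
kernel is the one in `sampleS_eq_avg`, so the first energy term becomes the average of a single
function. -/
theorem transform₁_sampleT {m J n : ℕ} (hm : 1 ≤ m) {β : Fin J → ℕ × ℕ} {j : Fin J}
    (hβ : (β j).1 ≤ m ∧ (β j).2 ≤ m) {u g : ℝ × ℝ → ℝ} (h : IsWeakDeriv (β j) u g)
    (hu : Integrable u volOmega) (hg : Integrable g volOmega) {k : ℤ × ℤ}
    (hk : CoordBound m n k.1 ∧ CoordBound m n k.2) :
    transform₁ m β n (sampleT m n u) j k = avg (normTensor (liftOp m (β j).1 (bspline m))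
      (liftOp m (β j).2 (bspline m))) n g k := by
  have hB := isKernel_bspline hm
  have hm' : (1 : ℝ) ≤ m := by exact_mod_cast hm
  have hh : ((m / 2 : ℕ) : ℝ) ≤ m := by exact_mod_cast Nat.div_le_self m 2
  have hh0 : (0 : ℝ) ≤ ((m / 2 : ℕ) : ℝ) := Nat.cast_nonneg _
  obtain ⟨⟨h1, h2⟩, h3, h4⟩ := And.intro hk.1.cast hk.2.cast
  have e : sampleT m n u = avg (tensor (bspline m) (bspline m)) n u :=
    funext fun k => sampleT_eq_avg m n u k
  have h0 : ∫ t, bspline m t ≠ 0 := by simp [integral_bspline hm]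
  have I1 := hB.integral_liftOp_ne_zero hβ.1 h0
  have I2 := hB.integral_liftOp_ne_zero hβ.2 h0
  rw [transform₁, e, conv_avg hβ hB hB n hu, h.avg_maskOp hu hg hβ (by linarith) hB hB n
    (by linarith) (by linarith) (by linarith) (by linarith), avg_normTensor, cst_eq hm hβ,
    two_zpow_sub_one, mul_pow]
  have hs : ((-1 : ℝ) ^ order (β j)) * (-1) ^ order (β j) = 1 := by
    rw [← mul_pow]
    simp
  have hp : ((2 : ℝ) ^ n) ^ order (β j) ≠ 0 := by positivity
  have hq : (2⁻¹ : ℝ) ^ order (β j) ≠ 0 := by positivity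
  generalize avg (tensor (liftOp m (β j).1 (bspline m)) (liftOp m (β j).2 (bspline m))) n g k = X
  generalize ∫ t, liftOp m (β j).1 (bspline m) t = i1 at *
  generalize ∫ t, liftOp m (β j).2 (bspline m) t = i2 at *
  generalize (2⁻¹ : ℝ) ^ order (β j) = q at *
  generalize ((2 : ℝ) ^ n) ^ order (β j) = P at *
  generalize (-1 : ℝ) ^ order (β j) = s at *
  field_simp
  linear_combination X * hs

/-- As for the first-order transform, starting from the kernel of `S_n`, itself a lifted spline, and
lifting it once more; `c_ab` contains `c_b⁻¹`, which accounts for the normalisation in `S_n`. -/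
theorem transform₂_sampleS {m J n : ℕ} (hm : 1 ≤ m) {β : Fin J → ℕ × ℕ} {ij : Fin J × Fin J}
    (hβ : ∀ j, (β j).1 ≤ m ∧ (β j).2 ≤ m) {v : Fin J → ℝ × ℝ → ℝ} {g : ℝ × ℝ → ℝ}
    (h : IsWeakDeriv (β ij.1) (v ij.2) g) (hv : Integrable (v ij.2) volOmega)
    (hg : Integrable g volOmega) {k : ℤ × ℤ} (hk : CoordBound m n k.1 ∧ CoordBound m n k.2) :
    transform₂ m β n (sampleS m β n v) ij k =
      avg (normTensor (liftOp m (β ij.1).1 (liftOp m (β ij.2).1 (bspline m)))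
        (liftOp m (β ij.1).2 (liftOp m (β ij.2).2 (bspline m)))) n g k := by
  have hB := isKernel_bspline hm
  have hm' : (1 : ℝ) ≤ m := by exact_mod_cast hm
  have hh : ((m / 2 : ℕ) : ℝ) ≤ m := by exact_mod_cast Nat.div_le_self m 2
  have hh0 : (0 : ℝ) ≤ ((m / 2 : ℕ) : ℝ) := Nat.cast_nonneg _
  obtain ⟨⟨h1, h2⟩, h3, h4⟩ := And.intro hk.1.cast hk.2.cast
  set f := liftOp m (β ij.2).1 (bspline m) with hf
  set f' := liftOp m (β ij.2).2 (bspline m) with hf'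
  have kf := hB.liftOp (hβ ij.2).1
  have kf' := hB.liftOp (hβ ij.2).2
  rw [← hf] at kf
  rw [← hf'] at kf'
  have h0 : ∫ t, bspline m t ≠ 0 := by simp [integral_bspline hm]
  have I1 : ∫ t, f t ≠ 0 := hB.integral_liftOp_ne_zero (hβ ij.2).1 h0
  have I2 : ∫ t, f' t ≠ 0 := hB.integral_liftOp_ne_zero (hβ ij.2).2 h0
  have I3 := kf.integral_liftOp_ne_zero (hβ ij.1).1 I1
  have I4 := kf'.integral_liftOp_ne_zero (hβ ij.1).2 I2
  have e : conv m (β ij.1) (sampleS m β n v ij.2) k = ((∫ t, f t) * ∫ t, f' t)⁻¹ *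
      conv m (β ij.1) (avg (tensor f f') n (v ij.2)) k := by
    rw [conv_eq_sum (hβ ij.1), conv_eq_sum (hβ ij.1), Finset.mul_sum]
    refine Finset.sum_congr rfl fun r _ => ?_
    rw [sampleS_eq_avg hm (hβ ij.2), avg_normTensor]
    ring
  rw [transform₂, e, conv_avg (hβ ij.1) kf kf' n hv, h.avg_maskOp hv hg (hβ ij.1) (by linarith) kf
    kf' n (by linarith) (by linarith) (by linarith) (by linarith), avg_normTensor,
    cstPair_eq hm (hβ ij.1) (hβ ij.2), cst_eq hm (hβ ij.2), two_zpow_sub_two, mul_pow, ← hf, ← hf']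
  have hs : ((-1 : ℝ) ^ order (β ij.1)) * (-1) ^ order (β ij.1) = 1 := by
    rw [← mul_pow]
    simp
  have hp : ((2 : ℝ) ^ n) ^ order (β ij.1) ≠ 0 := by positivity
  have hq : (2⁻¹ : ℝ) ^ order (β ij.2) ≠ 0 := by positivity
  have hq' : (4⁻¹ : ℝ) ^ order (β ij.1) ≠ 0 := by positivity
  generalize avg (tensor (liftOp m (β ij.1).1 f) (liftOp m (β ij.1).2 f')) n g k = X
  generalize ∫ t, liftOp m (β ij.1).1 f t = i3 at *
  generalize ∫ t, liftOp m (β ij.1).2 f' t = i4 at *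
  generalize ∫ t, f t = i1 at *
  generalize ∫ t, f' t = i2 at *
  generalize (2⁻¹ : ℝ) ^ order (β ij.2) = q at *
  generalize (4⁻¹ : ℝ) ^ order (β ij.1) = q' at *
  generalize ((2 : ℝ) ^ n) ^ order (β ij.1) = P at *
  generalize (-1 : ℝ) ^ order (β ij.1) = s at *
  field_simp
  linear_combination X * hs

/-! ### Sobolev functions -/

/-- Total mass one makes `L_p` norms on the square monotone in `p` with constant one. -/
instance isProbabilityMeasure_volOmega : IsProbabilityMeasure volOmega :=
  ⟨by
    rw [Measure.restrict_apply_univ, Omega, Measure.volume_eq_prod, Measure.prod_prod]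
    simp⟩

section Sobolev

variable {k : ℕ} {p : ℝ≥0∞} [hp : Fact (1 ≤ p)]

theorem memLp_sobolevDeriv (u : Sobolev k p) (α : ℕ × ℕ) (h : α.1 + α.2 ≤ k) :
    MemLp (sobolevDeriv u α h) p volOmega := Lp.memLp _

theorem integrable_sobolevDeriv (u : Sobolev k p) (α : ℕ × ℕ) (h : α.1 + α.2 ≤ k) :
    Integrable (sobolevDeriv u α h) volOmega := (memLp_sobolevDeriv u α h).integrable hp.out

theorem memLp_sobolevFun (u : Sobolev k p) : MemLp (sobolevFun u) p volOmega :=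
  memLp_sobolevDeriv _ _ _

theorem integrable_sobolevFun (u : Sobolev k p) : Integrable (sobolevFun u) volOmega :=
  integrable_sobolevDeriv _ _ _

theorem isWeakDeriv_sobolevDeriv (u : Sobolev k p) (α : ℕ × ℕ) (h : α.1 + α.2 ≤ k) :
    IsWeakDeriv α (sobolevFun u) (sobolevDeriv u α h) := u.2 ⟨α, mem_multiIndices.2 h⟩

theorem tendsto_eLpNorm_sobolevDeriv {l : Filter ℕ} {w : ℕ → Sobolev k p} {w' : Sobolev k p}
    (hw : Tendsto w l (𝓝 w')) (α : ℕ × ℕ) (h : α.1 + α.2 ≤ k) :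
    Tendsto (fun n => eLpNorm (sobolevDeriv (w n) α h - sobolevDeriv w' α h) p volOmega) l
      (𝓝 0) := by
  have h1 : Continuous fun u : Sobolev k p =>
      (u : PiLp p fun _ : multiIndices k => Lp ℝ p volOmega) ⟨α, mem_multiIndices.2 h⟩ :=
    (PiLp.continuous_apply p _ _).comp continuous_subtype_val
  exact (Lp.tendsto_Lp_iff_tendsto_eLpNorm' _ _).1 ((h1.tendsto w').comp hw)

theorem exists_eLpNorm_two_sobolevFun_le (hk : 1 ≤ k) : ∃ c : ℝ≥0∞, c ≠ ⊤ ∧ ∀ u : Sobolev k p,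
    eLpNorm (sobolevFun u) 2 volOmega ≤ c * (eLpNorm (sobolevFun u) p volOmega +
      eLpNorm (sobolevDeriv u (1, 0) hk) p volOmega +
      eLpNorm (sobolevDeriv u (0, 1) hk) p volOmega) := by
  obtain ⟨c, hc, h⟩ := exists_eLpNorm_two_le
  refine ⟨c, hc, fun u => ?_⟩
  refine (h _ _ _ (integrable_sobolevFun u) (integrable_sobolevDeriv u (1, 0) hk)
    (integrable_sobolevDeriv u (0, 1) hk) (isWeakDeriv_sobolevDeriv u _ _)
    (isWeakDeriv_sobolevDeriv u _ _)).trans ?_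
  rw [sobolevNormOne]
  gcongr
  · exact eLpNorm_le_eLpNorm_of_exponent_le hp.out (integrable_sobolevFun u).1
  · exact eLpNorm_le_eLpNorm_of_exponent_le hp.out (integrable_sobolevDeriv u _ _).1
  · exact eLpNorm_le_eLpNorm_of_exponent_le hp.out (integrable_sobolevDeriv u _ _).1

/-- In particular the infinite branch in `fidelity` is never taken once `k ≥ 1`. -/
theorem memLp_two_sobolevFun (hk : 1 ≤ k) (u : Sobolev k p) :
    MemLp (sobolevFun u) 2 volOmega := by
  obtain ⟨c, hc, h⟩ := exists_eLpNorm_two_sobolevFun_le (p := p) hk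
  refine ⟨(integrable_sobolevFun u).1, (h u).trans_lt (ENNReal.mul_lt_top hc.lt_top ?_)⟩
  exact ENNReal.add_lt_top.2 ⟨ENNReal.add_lt_top.2 ⟨(memLp_sobolevFun u).2,
    (memLp_sobolevDeriv u _ _).2⟩, (memLp_sobolevDeriv u _ _).2⟩

theorem sobolevDeriv_sub (u v : Sobolev k p) (α : ℕ × ℕ) (h : α.1 + α.2 ≤ k) :
    sobolevDeriv (u - v) α h =ᵐ[volOmega] sobolevDeriv u α h - sobolevDeriv v α h :=
  Lp.coeFn_sub _ _

theorem tendsto_eLpNorm_two_sobolevFun (hk : 1 ≤ k) {l : Filter ℕ} {w : ℕ → Sobolev k p}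
    {w' : Sobolev k p} (hw : Tendsto w l (𝓝 w')) :
    Tendsto (fun n => eLpNorm (sobolevFun (w n) - sobolevFun w') 2 volOmega) l (𝓝 0) := by
  obtain ⟨c, hc, h⟩ := exists_eLpNorm_two_sobolevFun_le (p := p) hk
  have h0 := ((tendsto_eLpNorm_sobolevDeriv hw 0 (by simp)).add
    (tendsto_eLpNorm_sobolevDeriv hw (1, 0) hk)).add (tendsto_eLpNorm_sobolevDeriv hw (0, 1) hk)
  have h1 := ENNReal.Tendsto.const_mul (a := c) h0 (Or.inr hc)
  rw [add_zero, add_zero, mul_zero] at h1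
  refine tendsto_of_tendsto_of_tendsto_of_le_of_le tendsto_const_nhds h1 (fun _ => zero_le)
    fun n => ?_
  have h2 := h (w n - w')
  simp only [sobolevFun] at h2
  rwa [eLpNorm_congr_ae (sobolevDeriv_sub _ _ _ _), eLpNorm_congr_ae (sobolevDeriv_sub _ _ _ _),
    eLpNorm_congr_ae (sobolevDeriv_sub _ _ _ _), eLpNorm_congr_ae (sobolevDeriv_sub _ _ _ _)] at h2

end Sobolev

/-! ### Arrays as elements of `L_2(Ω)` -/

open Classical in
/-- The extension by zero of an array on `K`. -/
def extendZero (K : Set (ℤ × ℤ)) (a : K → ℝ) (k : ℤ × ℤ) : ℝ :=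
  if h : k ∈ K then a ⟨k, h⟩ else 0

theorem extendZero_coe (K : Set (ℤ × ℤ)) (a : K → ℝ) (k : K) : extendZero K a k = a k := by
  simp [extendZero]

theorem stepFun_congr {n : ℕ} {K : Set (ℤ × ℤ)} {a b : ℤ × ℤ → ℝ} (h : ∀ k ∈ K, a k = b k) :
    stepFun n K a = stepFun n K b := by
  funext x
  by_cases hx : cell n x ∈ K
  · simp [stepFun, hx, h _ hx]
  · simp [stepFun, hx]

theorem memLp_stepFun_extendZero (n : ℕ) (K : Set (ℤ × ℤ)) [Finite K] (a : K → ℝ) :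
    MemLp (stepFun n K (extendZero K a)) 2 volOmega := by
  obtain ⟨M, hM⟩ := (Set.finite_range fun k => |a k|).bddAbove
  refine MemLp.of_bound (measurable_stepFun _ _ _).aestronglyMeasurable (max M 0)
    (Eventually.of_forall fun x => ?_)
  by_cases hx : cell n x ∈ K
  · rw [stepFun, Set.indicator_of_mem (Set.mem_preimage.2 hx)]
    have h1 : extendZero K a (cell n x) = a ⟨_, hx⟩ := extendZero_coe K a ⟨_, hx⟩
    rw [h1]
    exact (hM ⟨_, rfl⟩).trans (le_max_left _ _)
  · rw [stepFun, Set.indicator_of_notMem (mt Set.mem_preimage.1 hx), norm_zero]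
    exact le_max_right _ _

/-- The step function of an array on the finite set `K`, as an element of `L_2(Ω)`. -/
def stepLp (n : ℕ) (K : Set (ℤ × ℤ)) [Finite K] : (K → ℝ) →ₗ[ℝ] Lp ℝ 2 volOmega where
  toFun a := (memLp_stepFun_extendZero n K a).toLp
  map_add' a b := by
    rw [← MemLp.toLp_add]
    congr 1
    funext x
    by_cases hx : cell n x ∈ K <;> simp [stepFun, extendZero, hx]
  map_smul' c a := by
    rw [RingHom.id_apply, ← MemLp.toLp_const_smul]
    congr 1
    funext x
    by_cases hx : cell n x ∈ K <;> simp [stepFun, extendZero, hx]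

theorem discreteNorm₂_eq_enorm {n : ℕ} {K : Set (ℤ × ℤ)} [Finite K] (hK : K ⊆ boxIndex n)
    (a : K → ℝ) : discreteNorm₂ n K a = ‖stepLp n K a‖ₑ := by
  have h1 := discreteNorm_eq_eLpNorm (ι := Unit) hK (r := 2) one_le_two ENNReal.ofNat_ne_top
    fun _ => extendZero K a
  simp only [extendZero_coe, ENNReal.toReal_ofNat] at h1
  rw [discreteNorm₂, h1, stepLp]
  change _ = ‖(memLp_stepFun_extendZero n K a).toLp‖ₑ
  rw [Lp.enorm_toLp]
  refine eLpNorm_congr_norm_ae (Eventually.of_forall fun x => ?_)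
  rw [EuclideanSpace.norm_eq]
  simp [Real.sqrt_sq_eq_abs]

theorem avg_congr_ae (κ : ℝ × ℝ → ℝ) (n : ℕ) {f g : ℝ × ℝ → ℝ} (h : f =ᵐ[volOmega] g) :
    avg κ n f = avg κ n g := by
  funext k
  refine integral_congr_ae ?_
  filter_upwards [h] with y hy
  rw [hy]

theorem IsAvgKernel.memLp_scaled {κ : ℝ × ℝ → ℝ} {M R : ℝ} (h : IsAvgKernel κ M R) (n : ℕ)
    (k : ℤ × ℤ) : MemLp (scaled κ n k) 2 volOmega :=
  MemLp.of_bound (h.measurable_scaled n k).aestronglyMeasurable _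
    (Eventually.of_forall (h.abs_scaled_le n k))

/-- The local averages with indices in `K`, as a continuous linear map on `L_2(Ω)`. -/
def avgCLM {κ : ℝ × ℝ → ℝ} {M R : ℝ} (h : IsAvgKernel κ M R) (n : ℕ) (K : Set (ℤ × ℤ)) :
    Lp ℝ 2 volOmega →L[ℝ] (K → ℝ) :=
  ContinuousLinearMap.pi fun k => innerSL ℝ (h.memLp_scaled n k).toLp

theorem avgCLM_apply {κ : ℝ × ℝ → ℝ} {M R : ℝ} (h : IsAvgKernel κ M R) (n : ℕ)
    (K : Set (ℤ × ℤ)) (u : Lp ℝ 2 volOmega) (k : K) : avgCLM h n K u k = avg κ n u k := by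
  simp only [avgCLM, ContinuousLinearMap.coe_pi', innerSL_apply_apply]
  rw [L2.inner_def, avg]
  refine integral_congr_ae ?_
  filter_upwards [(h.memLp_scaled n k).coeFn_toLp] with y hy
  rw [hy]
  simp

/-- Strong convergence of averages, restated for elements of `L_2` so that it can be combined with
operator bounds. -/
theorem tendsto_stepLp_avgCLM {κ : ℝ × ℝ → ℝ} {M R : ℝ} (h : IsAvgKernel κ M R)
    {K : ℕ → Set (ℤ × ℤ)} [∀ n, Finite (K n)]
    (hK : ∀ x ∈ Omega, ∀ᶠ n in atTop, cell n x ∈ K n) (u : Lp ℝ 2 volOmega) :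
    Tendsto (fun n => stepLp n (K n) (avgCLM h n (K n) u)) atTop (𝓝 u) := by
  rw [Lp.tendsto_Lp_iff_tendsto_eLpNorm']
  refine (h.tendsto_eLpNorm_stepFun_avg_sub hK (Lp.memLp u) one_le_two
    ENNReal.ofNat_ne_top).congr fun n => eLpNorm_congr_ae ?_
  have h1 : stepFun n (K n) (avg κ n u) =
      stepFun n (K n) (extendZero (K n) (avgCLM h n (K n) u)) := by
    refine stepFun_congr fun k hk => ?_
    rw [extendZero, dif_pos hk, avgCLM_apply]
  rw [h1]
  exact (memLp_stepFun_extendZero n (K n) (avgCLM h n (K n) u)).coeFn_toLp.symm.sub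
    EventuallyEq.rfl

/-- If the discretisations `A_n` are consistent with `A`, they converge along `L_2`-convergent
sequences. -/
theorem tendsto_stepLp_of_consistent {κ : ℝ × ℝ → ℝ} {M R : ℝ} (h : IsAvgKernel κ M R)
    {K : ℕ → Set (ℤ × ℤ)} [∀ n, Finite (K n)]
    (hK : ∀ x ∈ Omega, ∀ᶠ n in atTop, cell n x ∈ K n)
    (A : Lp ℝ 2 volOmega →ₗ[ℝ] Lp ℝ 2 volOmega) (An : (n : ℕ) → (K n → ℝ) →ₗ[ℝ] (K n → ℝ))
    (hA : ∀ u, Tendsto (fun n => stepLp n (K n)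
      (avgCLM h n (K n) (A u) - An n (avgCLM h n (K n) u))) atTop (𝓝 0))
    {l : Filter ℕ} (hl : l ≤ atTop) {U : ℕ → Lp ℝ 2 volOmega} {u : Lp ℝ 2 volOmega}
    (hU : Tendsto U l (𝓝 u)) :
    Tendsto (fun n => stepLp n (K n) (An n (avgCLM h n (K n) (U n)))) l (𝓝 (A u)) := by
  -- Continuity is automatic: `A_n` acts between finite-dimensional spaces and the averages are
  -- `L_2` pairings.
  let B : ℕ → Lp ℝ 2 volOmega →L[ℝ] Lp ℝ 2 volOmega := fun n =>
    (LinearMap.toContinuousLinearMap (stepLp n (K n) ∘ₗ An n)).comp (avgCLM h n (K n))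
  have hB : ∀ v, Tendsto (fun n => B n v) atTop (𝓝 (A v)) := by
    intro v
    have h1 := (tendsto_stepLp_avgCLM h hK (A v)).sub (hA v)
    rw [sub_zero] at h1
    refine h1.congr fun n => ?_
    rw [map_sub, sub_sub_cancel]
    rfl
  -- Pointwise boundedness is read off from convergence of whole sequences along `atTop`, so the
  -- bound holds for every `n` and serves any filter `l`.
  obtain ⟨c, hc⟩ := banach_steinhaus (g := B) fun v => by
    obtain ⟨c, hc⟩ := (hB v).norm.bddAbove_range
    exact ⟨c, fun n => hc ⟨n, rfl⟩⟩
  have h1 : Tendsto (fun n => B n (U n - u)) l (𝓝 0) := by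
    have h2 : Tendsto (fun n => c * ‖U n - u‖) l (𝓝 0) := by
      simpa using (tendsto_iff_norm_sub_tendsto_zero.1 hU).const_mul c
    exact squeeze_zero_norm (fun n => (B n).le_of_opNorm_le (hc n) _) h2
  have h3 := h1.add ((hB u).mono_left hl)
  rw [zero_add] at h3
  refine h3.congr fun n => ?_
  rw [map_sub, sub_add_cancel]
  rfl

/-! ### Convergence of the discrete energies -/

section Energy

variable {m J C : ℕ} {β : Fin J → ℕ × ℕ} {p q : ℝ≥0∞} [hp : Fact (1 ≤ p)] [hq : Fact (1 ≤ q)]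

/-- A nonzero band provides at least one derivative, which is what the embedding into `L_2`
consumes. -/
theorem one_le_maxOrder (hJ : 1 ≤ J) (hβ : ∀ j, β j ≠ 0) : 1 ≤ maxOrder β := by
  refine le_trans ?_ (order_le_maxOrder β ⟨0, hJ⟩)
  have := hβ ⟨0, hJ⟩
  rw [Ne, Prod.ext_iff, not_and_or] at this
  simp only [Prod.fst_zero, Prod.snd_zero] at this
  omega

theorem finite_indexK (hm : 1 ≤ m) (hC : 2 ≤ C) (β : Fin J → ℕ × ℕ) (n : ℕ) :
    Finite (indexK m β C n) :=
  ((finite_boxIndex n).subset (indexK_subset_boxIndex hm hC β)).to_subtype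

theorem tendsto_discreteNorm_transform₁ (hm : 1 ≤ m) (hC : 2 ≤ C)
    (hβ : ∀ j, (β j).1 ≤ m ∧ (β j).2 ≤ m) (hs : 1 ≤ maxOrder β) (hp2 : p ≤ 2) {l : Filter ℕ}
    (hl : l ≤ atTop) {w : ℕ → EnergySpace β p q} {w' : EnergySpace β p q}
    (hw : Tendsto w l (𝓝 w')) :
    Tendsto (fun n => discreteNorm n (indexK m β C n) p.toReal
      (fun j k => transform₁ m β n (sampleT m n (sobolevFun (w n).1)) j k -
        sampleS m β n (fun i => sobolevFun ((w n).2 i)) j k)) l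
      (𝓝 (continuumNorm p.toReal (fun j x =>
        sobolevDeriv w'.1 (β j) ((order_le_maxOrder β j).trans (by omega)) x -
          sobolevFun (w'.2 j) x))) := by
  have hpt : p ≠ ⊤ := (hp2.trans_lt ENNReal.ofNat_lt_top).ne
  have hw1 : Tendsto (fun n => (w n).1) l (𝓝 w'.1) := (continuous_fst.tendsto w').comp hw
  have hw2 : ∀ j, Tendsto (fun n => (w n).2 j) l (𝓝 (w'.2 j)) := fun j =>
    (((continuous_apply j).comp continuous_snd).tendsto w').comp hw
  have hord : ∀ j, (β j).1 + (β j).2 ≤ 2 * maxOrder β := fun j =>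
    (order_le_maxOrder β j).trans (by omega)
  -- `v_j` is only given in `W_s^q`, and `q < p` is possible; it reaches `L_p` through `L_2`, which
  -- uses `p ≤ 2`.
  have hmem : ∀ (x : EnergySpace β p q) (j : Fin J),
      MemLp (sobolevDeriv x.1 (β j) (hord j) - sobolevFun (x.2 j)) p volOmega := fun x j =>
    (memLp_sobolevDeriv _ _ _).sub ((memLp_two_sobolevFun hs (x.2 j)).mono_exponent hp2)
  refine tendsto_discreteNorm
    (a := fun n j k => transform₁ m β n (sampleT m n (sobolevFun (w n).1)) j k -
        sampleS m β n (fun i => sobolevFun ((w n).2 i)) j k)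
    (g := fun j => sobolevDeriv w'.1 (β j) (hord j) - sobolevFun (w'.2 j))
    (fun n => indexK_subset_boxIndex hm hC β) hp.out hpt (hmem w') fun j => ?_
  have hB := isKernel_bspline hm
  have h0 : ∫ t, bspline m t ≠ 0 := by simp [integral_bspline hm]
  obtain ⟨M, R, hκ⟩ := exists_isAvgKernel_normTensor (hB.liftOp (hβ j).1) (hB.liftOp (hβ j).2)
    (hB.integral_liftOp_ne_zero (hβ j).1 h0) (hB.integral_liftOp_ne_zero (hβ j).2 h0)
  have hlim : Tendsto (fun n => eLpNorm
      ((sobolevDeriv (w n).1 (β j) (hord j) - sobolevFun ((w n).2 j)) -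
        (sobolevDeriv w'.1 (β j) (hord j) - sobolevFun (w'.2 j))) p volOmega) l (𝓝 0) := by
    have h1 := (tendsto_eLpNorm_sobolevDeriv hw1 (β j) (hord j)).add
      (tendsto_eLpNorm_two_sobolevFun hs (hw2 j))
    rw [add_zero] at h1
    refine tendsto_of_tendsto_of_tendsto_of_le_of_le tendsto_const_nhds h1 (fun _ => zero_le)
      fun n => ?_
    have m1 := ((memLp_sobolevDeriv (w n).1 (β j) (hord j)).1).sub
      (memLp_sobolevDeriv w'.1 (β j) (hord j)).1
    have m2 := (memLp_sobolevFun ((w n).2 j)).1.sub (memLp_sobolevFun (w'.2 j)).1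
    change eLpNorm _ p volOmega ≤ _
    rw [sub_sub_sub_comm]
    exact (eLpNorm_sub_le m1 m2 hp.out).trans
      (add_le_add le_rfl (eLpNorm_le_eLpNorm_of_exponent_le hp2 m2))
  refine (hκ.tendsto_eLpNorm_stepFun_avg (K := fun n => indexK m β C n)
    (fun x hx => eventually_cell_mem_indexK hm C hβ hx) hp.out hpt hl
    (fun n => hmem (w n) j) (hmem w' j) hlim).congr fun n => ?_
  congr 2
  refine stepFun_congr fun k hk => ?_
  -- On `K_n` the array is exactly the average of `D_j u - v_j`, since both terms use the same
  -- kernel.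
  rw [hκ.avg_sub n (integrable_sobolevDeriv _ _ _) (integrable_sobolevFun _), Pi.sub_apply,
    transform₁_sampleT hm (hβ j) (isWeakDeriv_sobolevDeriv (w n).1 (β j) (hord j))
      (integrable_sobolevFun _) (integrable_sobolevDeriv _ _ _) (coordBound_of_mem_indexK hm hC hk),
    sampleS_eq_avg hm (hβ j)]

theorem tendsto_discreteNorm_transform₂ (hm : 1 ≤ m) (hC : 2 ≤ C)
    (hβ : ∀ j, (β j).1 ≤ m ∧ (β j).2 ≤ m) (hq2 : q ≤ 2) {l : Filter ℕ}
    (hl : l ≤ atTop) {v : ℕ → Fin J → Sobolev (maxOrder β) q} {v' : Fin J → Sobolev (maxOrder β) q}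
    (hv : Tendsto v l (𝓝 v')) :
    Tendsto (fun n => discreteNorm n (indexK m β C n) q.toReal
      (fun ij k => transform₂ m β n (sampleS m β n fun i => sobolevFun (v n i)) ij k)) l
      (𝓝 (continuumNorm q.toReal (fun (ij : Fin J × Fin J) x =>
        sobolevDeriv (v' ij.2) (β ij.1) (order_le_maxOrder β ij.1) x))) := by
  have hqt : q ≠ ⊤ := (hq2.trans_lt ENNReal.ofNat_lt_top).ne
  refine tendsto_discreteNorm
    (a := fun n ij k => transform₂ m β n (sampleS m β n fun i => sobolevFun (v n i)) ij k)
    (g := fun ij => sobolevDeriv (v' ij.2) (β ij.1) (order_le_maxOrder β ij.1))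
    (fun n => indexK_subset_boxIndex hm hC β) hq.out hqt (fun ij => memLp_sobolevDeriv _ _ _)
    fun ij => ?_
  have hB := isKernel_bspline hm
  have h0 : ∫ t, bspline m t ≠ 0 := by simp [integral_bspline hm]
  have k1 := hB.liftOp (hβ ij.2).1
  have k2 := hB.liftOp (hβ ij.2).2
  obtain ⟨M, R, hκ⟩ := exists_isAvgKernel_normTensor (k1.liftOp (hβ ij.1).1)
    (k2.liftOp (hβ ij.1).2)
    (k1.integral_liftOp_ne_zero (hβ ij.1).1 (hB.integral_liftOp_ne_zero (hβ ij.2).1 h0))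
    (k2.integral_liftOp_ne_zero (hβ ij.1).2 (hB.integral_liftOp_ne_zero (hβ ij.2).2 h0))
  have hv2 : Tendsto (fun n => v n ij.2) l (𝓝 (v' ij.2)) :=
    ((continuous_apply ij.2).tendsto v').comp hv
  refine (hκ.tendsto_eLpNorm_stepFun_avg (K := fun n => indexK m β C n)
    (fun x hx => eventually_cell_mem_indexK hm C hβ hx) hq.out hqt hl
    (fun n => memLp_sobolevDeriv (v n ij.2) (β ij.1) (order_le_maxOrder β ij.1))
    (memLp_sobolevDeriv _ _ _) (tendsto_eLpNorm_sobolevDeriv hv2 _ _)).congr fun n => ?_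
  congr 2
  refine stepFun_congr fun k hk => ?_
  rw [transform₂_sampleS hm hβ (isWeakDeriv_sobolevDeriv (v n ij.2) (β ij.1) _)
    (integrable_sobolevFun _) (integrable_sobolevDeriv _ _ _) (coordBound_of_mem_indexK hm hC hk)]

theorem tendsto_discreteNorm₂_fidelity (hm : 1 ≤ m) (hC : 2 ≤ C)
    (hβ : ∀ j, (β j).1 ≤ m ∧ (β j).2 ≤ m) {k : ℕ} (hk : 1 ≤ k) (f : Lp ℝ 2 volOmega)
    (A : Lp ℝ 2 volOmega →ₗ[ℝ] Lp ℝ 2 volOmega)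
    (An : (n : ℕ) → (indexK m β C n → ℝ) →ₗ[ℝ] (indexK m β C n → ℝ))
    (hA : ∀ u : Lp ℝ 2 volOmega, Tendsto
      (fun n => discreteNorm₂ n (indexK m β C n)
        (sampleTK m β C n (A u) - An n (sampleTK m β C n u))) atTop (𝓝 0))
    {l : Filter ℕ} (hl : l ≤ atTop) {u : ℕ → Sobolev k p} {u' : Sobolev k p}
    (hu : Tendsto u l (𝓝 u')) :
    Tendsto (fun n => discreteNorm₂ n (indexK m β C n)
      (An n (sampleTK m β C n (sobolevFun (u n))) - sampleTK m β C n f)) l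
      (𝓝 (fidelity A f (sobolevFun u'))) := by
  have hB := isKernel_bspline hm
  have h0 : ∫ t, bspline m t ≠ 0 := by simp [integral_bspline hm]
  obtain ⟨M, R, hκ⟩ := exists_isAvgKernel_normTensor hB hB h0 h0
  have : ∀ n, Finite (indexK m β C n) := finite_indexK hm hC β
  have hbox : ∀ n, indexK m β C n ⊆ boxIndex n := fun n => indexK_subset_boxIndex hm hC β
  have hK : ∀ x ∈ Omega, ∀ᶠ n in atTop, cell n x ∈ indexK m β C n := fun x hx =>
    eventually_cell_mem_indexK hm C hβ hx
  have hT : ∀ (n : ℕ) (g : Lp ℝ 2 volOmega),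
      sampleTK m β C n g = avgCLM hκ n (indexK m β C n) g := by
    intro n g
    funext k
    rw [avgCLM_apply, sampleTK, sampleT_eq_avg_normTensor hm]
  have hL2 : ∀ n, MemLp (sobolevFun (u n)) 2 volOmega := fun n => memLp_two_sobolevFun hk _
  have hL2' : MemLp (sobolevFun u') 2 volOmega := memLp_two_sobolevFun hk _
  have hTu : ∀ n, sampleTK m β C n (sobolevFun (u n)) =
      avgCLM hκ n (indexK m β C n) ((hL2 n).toLp) := by
    intro n
    rw [← hT]
    funext k
    rw [sampleTK, sampleTK, sampleT_eq_avg_normTensor hm, sampleT_eq_avg_normTensor hm,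
      avg_congr_ae _ _ (hL2 n).coeFn_toLp]
  have hU : Tendsto (fun n => (hL2 n).toLp) l (𝓝 hL2'.toLp) := by
    rw [Lp.tendsto_Lp_iff_tendsto_eLpNorm']
    refine (tendsto_eLpNorm_two_sobolevFun hk hu).congr fun n => eLpNorm_congr_ae ?_
    exact ((hL2 n).coeFn_toLp.sub hL2'.coeFn_toLp).symm
  -- The consistency hypothesis, rewritten as norm convergence of step functions in `L_2`.
  have hA' : ∀ v, Tendsto (fun n => stepLp n (indexK m β C n)
      (avgCLM hκ n (indexK m β C n) (A v) - An n (avgCLM hκ n (indexK m β C n) v))) atTop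
      (𝓝 0) := by
    intro v
    rw [tendsto_zero_iff_enorm_tendsto_zero]
    refine (hA v).congr fun n => ?_
    rw [discreteNorm₂_eq_enorm (hbox n), hT, hT]
  have h1 := (tendsto_stepLp_of_consistent hκ hK A An hA' hl hU).sub
    ((tendsto_stepLp_avgCLM hκ hK f).mono_left hl)
  rw [fidelity, dif_pos hL2']
  refine h1.enorm.congr fun n => ?_
  rw [discreteNorm₂_eq_enorm (hbox n), map_sub, hTu, hT]

theorem tendsto_discreteEnergy (hm : 1 ≤ m) (hC : 2 ≤ C)
    (hβ : ∀ j, (β j).1 ≤ m ∧ (β j).2 ≤ m) (hs : 1 ≤ maxOrder β) (hp2 : p ≤ 2) (hq2 : q ≤ 2)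
    (ν₁ ν₂ : ℝ≥0) (f : Lp ℝ 2 volOmega) (A : Lp ℝ 2 volOmega →ₗ[ℝ] Lp ℝ 2 volOmega)
    (An : (n : ℕ) → (indexK m β C n → ℝ) →ₗ[ℝ] (indexK m β C n → ℝ))
    (hA : ∀ u : Lp ℝ 2 volOmega, Tendsto
      (fun n => discreteNorm₂ n (indexK m β C n)
        (sampleTK m β C n (A u) - An n (sampleTK m β C n u))) atTop (𝓝 0))
    {l : Filter ℕ} (hl : l ≤ atTop) {w : ℕ → EnergySpace β p q} {w' : EnergySpace β p q}
    (hw : Tendsto w l (𝓝 w')) :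
    Tendsto (fun n => discreteEnergy m β C p q ν₁ ν₂ f n (An n) (w n)) l
      (𝓝 (energy β p q ν₁ ν₂ A f w')) := by
  have hw1 : Tendsto (fun n => (w n).1) l (𝓝 w'.1) := (continuous_fst.tendsto w').comp hw
  have hw2 : Tendsto (fun n => (w n).2) l (𝓝 w'.2) := (continuous_snd.tendsto w').comp hw
  have t1 := ENNReal.Tendsto.const_mul (a := (ν₁ : ℝ≥0∞))
    ((ENNReal.continuous_rpow_const (y := p.toReal)).continuousAt.tendsto.comp
      (tendsto_discreteNorm_transform₁ hm hC hβ hs hp2 hl hw)) (Or.inr ENNReal.coe_ne_top)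
  have t2 := ENNReal.Tendsto.const_mul (a := (ν₂ : ℝ≥0∞))
    ((ENNReal.continuous_rpow_const (y := q.toReal)).continuousAt.tendsto.comp
      (tendsto_discreteNorm_transform₂ hm hC hβ hq2 hl hw2)) (Or.inr ENNReal.coe_ne_top)
  have t3 := ENNReal.Tendsto.const_mul (a := (2⁻¹ : ℝ≥0∞))
    (((ENNReal.continuous_pow 2).tendsto _).comp (tendsto_discreteNorm₂_fidelity hm hC hβ
      (k := 2 * maxOrder β) (by omega) f A An hA hl hw1)) (Or.inr (by simp))
  exact (t1.add t2).add t3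

/-- Working with ultrafilters instead of subsequences requires no countability of the space;
continuous convergence is used for `w` and for each constant competitor. -/
theorem isEpsOptimal_of_mapClusterPt {X : Type} [TopologicalSpace X] {F : ℕ → X → ℝ≥0∞}
    {G : X → ℝ≥0∞} (hF : ∀ l : Filter ℕ, l ≤ atTop → ∀ (w : ℕ → X) (w' : X), Tendsto w l (𝓝 w') →
      Tendsto (fun n => F n (w n)) l (𝓝 (G w')))
    {ε : ℝ≥0} {w : ℕ → X} {w' : X} (hw : ∀ n, IsEpsOptimal (F n) ε (w n))
    (hw' : MapClusterPt w' atTop w) : IsEpsOptimal G ε w' := by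
  obtain ⟨U, hU, hlim⟩ := mapClusterPt_iff_ultrafilter.1 hw'
  rw [IsEpsOptimal, ENNReal.iInf_add]
  refine le_iInf fun y => ?_
  refine le_of_tendsto_of_tendsto' (hF U hU w w' hlim)
    ((hF U hU (fun _ => y) y tendsto_const_nhds).add_const (ε : ℝ≥0∞)) fun n => ?_
  exact (hw n).trans (add_le_add (iInf_le _ y) le_rfl)

end Energy

end

end WaveletFrame

theorem corollary3p2
    (m J C : ℕ) (hm : 1 ≤ m) (hJ : 1 ≤ J) (hC : 2 ≤ C)
    (β : Fin J → ℕ × ℕ) (hβ : ∀ j, β j ≠ 0 ∧ (β j).1 ≤ m ∧ (β j).2 ≤ m)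
    (p q : ℝ≥0∞) [Fact (1 ≤ p)] [Fact (1 ≤ q)] (hp : p ≤ 2) (hq : q ≤ 2)
    (ν₁ ν₂ : ℝ≥0) (f : Lp ℝ 2 volOmega)
    (A : Lp ℝ 2 volOmega →ₗ[ℝ] Lp ℝ 2 volOmega)
    (An : (n : ℕ) → (indexK m β C n → ℝ) →ₗ[ℝ] (indexK m β C n → ℝ))
    (hA : ∀ u : Lp ℝ 2 volOmega, Tendsto
      (fun n => discreteNorm₂ n (indexK m β C n)
        (sampleTK m β C n (A u) - An n (sampleTK m β C n u))) atTop (𝓝 0)) :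
    (∀ ε : ℝ≥0, 0 < ε → ∀ (w : ℕ → EnergySpace β p q) (w' : EnergySpace β p q),
      (∀ n, IsEpsOptimal (discreteEnergy m β C p q ν₁ ν₂ f n (An n)) ε (w n)) →
      MapClusterPt w' atTop w →
      IsEpsOptimal (energy β p q ν₁ ν₂ A f) ε w') ∧
    (∀ (w : ℕ → EnergySpace β p q) (w' : EnergySpace β p q),
      (∀ n, IsMinimizer (discreteEnergy m β C p q ν₁ ν₂ f n (An n)) (w n)) →
      MapClusterPt w' atTop w →
      IsMinimizer (energy β p q ν₁ ν₂ A f) w') := by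
  have hβ' : ∀ j, (β j).1 ≤ m ∧ (β j).2 ≤ m := fun j => (hβ j).2
  have hs := one_le_maxOrder hJ fun j => (hβ j).1
  have hlim : ∀ l : Filter ℕ, l ≤ atTop → ∀ (w : ℕ → EnergySpace β p q) (w' : EnergySpace β p q),
      Tendsto w l (𝓝 w') → Tendsto (fun n => discreteEnergy m β C p q ν₁ ν₂ f n (An n) (w n)) l
        (𝓝 (energy β p q ν₁ ν₂ A f w')) := fun l hl w w' hw =>
    tendsto_discreteEnergy hm hC hβ' hs hp hq ν₁ ν₂ f A An hA hl hw
  -- A minimizer is by definition the case `ε = 0`, so the same lemma proves both parts.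
  exact ⟨fun ε _ w w' hw hw' => isEpsOptimal_of_mapClusterPt hlim hw hw',
    fun w w' hw hw' => isEpsOptimal_of_mapClusterPt hlim hw hw'⟩
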